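/- Let $a>0$ and $0<t<\frac1{a+4}$, let $S(x,y)=x+y+\frac1x+\frac1y+axy$ and let $K(x,y)=xy\,(1-tS(x,y))$, a polynomial of bidegree $(2,2)$. Let $\mathcal C=\{(x,y)\in\overline{\mathbb C}\times\overline{\mathbb C}:K(x,y)=0\}$, where $\overline{\mathbb C}=\mathbb C\cup\{\infty\}$ (at points with an infinite coordinate the equation is read bihomogeneously in $\mathbb P^1\times\mathbb P^1$). For $\operatorname{Im}\tau>0$ let $$\vartheta(z|\tau)=\sum_{n\ge 0}(-1)^n e^{i\pi\tau(n+\frac12)^2}\bigl(e^{(2n+1)iz}-e^{-(2n+1)iz}\bigr),$$ and let $\vartheta'$ denote its derivative in $z$. Then there are $c,\gamma,\tau\in\mathbb C$ with $\gamma,\tau\in i\mathbb R$ and $0<\operatorname{Im}(2\gamma)<\operatorname{Im}(\pi\tau)$ such that $$ac^3=-\frac{\vartheta(4\gamma|\tau)}{\vartheta(2\gamma|\tau)},\qquad c^2=\frac{\vartheta(3\gamma|\tau)}{\vartheta(\gamma|\tau)},\qquad \frac ct=4\frac{\vartheta'(\gamma|\tau)\vartheta(2\gamma|\tau)}{\vartheta'(0|\tau)\vartheta(\gamma|\tau)}-2\frac{\vartheta'(2\gamma|\tau)}{\vartheta'(0|\tau)},$$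 and such that the functions $$X(z)=c\,\frac{\vartheta(z|\tau)\vartheta(z+\gamma|\tau)}{\vartheta(z-\gamma|\tau)\vartheta(z+2\gamma|\tau)},\qquad Y(z)=c\,\frac{\vartheta(z|\tau)\vartheta(z-\gamma|\tau)}{\vartheta(z+\gamma|\tau)\vartheta(z-2\gamma|\tau)}=X(-z)$$ have the following properties. (A) $X,Y:\mathbb C\to\overline{\mathbb C}$ are meromorphic and $\mathcal C=\{(X(z),Y(z)):z\in\mathbb C\}$; for all $z$ one has $K(X(z),Y(z))=0$, $X(z)=X(z+\pi)=X(z+\pi\tau)=X(-\gamma-z)$ and $Y(z)=Y(z+\pi)=Y(z+\pi\tau)=Y(\gamma-z)$; moreover $|X(-\frac\gamma2)|<1$ and $|Y(\frac\gamma2)|<1$; and, counted with multiplicity, $X$ and $Y$ each have exactly two roots and two poles in each fundamental domain $\{z_c+r_1\pi+r_2\pi\tau:r_1,r_2\in[0,1)\}$, $z_c\in\mathbb C$. (B) The plane $\mathbb C$ can be partitioned into simply connected regions $(\Omega_s)_{s\in\mathbb Z}$, stacked as a sequence of bands, i.e. $\overline{\Omega_r}\cap\overline{\Omega_s}=\emptyset$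 if $|r-s|\ge2$, with $\bigcup_s\overline{\Omega_{2s}}\cap\overline{\Omega_{2s+1}}=\{|X|=1\}$ and $\bigcup_s\overline{\Omega_{2s-1}}\cap\overline{\Omega_{2s}}=\{|Y|=1\}$, such that $$\bigcup_{s}\Omega_{4s}\cup\Omega_{4s+1}=\{|Y|<1\},\quad \bigcup_{s}\Omega_{4s-2}\cup\Omega_{4s-1}=\{|Y|\ge1\},$$ $$\bigcup_{s}\Omega_{4s-1}\cup\Omega_{4s}=\{|X|<1\},\quad \bigcup_{s}\Omega_{4s+1}\cup\Omega_{4s+2}=\{|X|\ge1\}$$ (with $|\infty|=\infty$), and, for every $s\in\mathbb Z$, $\pi+\Omega_s=\Omega_s$, $$s\pi\tau+\gamma-(\Omega_{2s}\cup\Omega_{2s+1})=\Omega_{2s}\cup\Omega_{2s+1}\supset\tfrac{s\pi\tau+\gamma}2+\mathbb R,$$ $$s\pi\tau-\gamma-(\Omega_{2s}\cup\Omega_{2s-1})=\Omega_{2s}\cup\Omega_{2s-1}\supset\tfrac{s\pi\tau-\gamma}2+\mathbb R.$$ -/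

import Mathlib

open scoped Topology

namespace AModel

noncomputable section

/-- The Jacobi theta function
`ϑ(z|τ) = ∑_{n ≥ 0} (-1)^n e^{iπτ(n+1/2)²} (e^{(2n+1)iz} - e^{-(2n+1)iz})`
(the series converges for `Im τ > 0`). -/
def theta (z τ : ℂ) : ℂ :=
  ∑' n : ℕ, (-1 : ℂ) ^ n * Complex.exp (Complex.I * Real.pi * τ * ((n : ℂ) + 1 / 2) ^ 2) *
    (Complex.exp ((2 * (n : ℂ) + 1) * Complex.I * z) -
      Complex.exp (-((2 * (n : ℂ) + 1) * Complex.I * z)))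

/-- The derivative `ϑ'(z|τ)` with respect to `z`. -/
def thetaDeriv (z τ : ℂ) : ℂ := deriv (fun w => theta w τ) z

/-- The step polynomial `S(x,y) = x + y + 1/x + 1/y + a x y` (for `x, y ≠ 0`). -/
def stepPoly (a x y : ℂ) : ℂ := x + y + 1 / x + 1 / y + a * x * y

/-- The kernel `K(x,y) = x y (1 - t S(x,y))`, expanded as a polynomial so that it makes sense
for all `x` and `y`; see `kernel_eq`. -/
def kernel (a t x y : ℂ) : ℂ :=
  x * y - t * (x ^ 2 * y + x * y ^ 2 + y + x + a * x ^ 2 * y ^ 2)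

theorem kernel_eq (a t x y : ℂ) (hx : x ≠ 0) (hy : y ≠ 0) :
    kernel a t x y = x * y * (1 - t * stepPoly a x y) := by
  unfold kernel stepPoly
  field_simp

/-- The kernel as a form of bidegree `(2,2)` in `([x₀ : x₁], [y₀ : y₁])`. -/
def kernelForm (a t x₀ x₁ y₀ y₁ : ℂ) : ℂ :=
  x₀ * x₁ * y₀ * y₁ -
    t * (x₀ ^ 2 * y₀ * y₁ + x₀ * x₁ * y₀ ^ 2 + x₁ ^ 2 * y₀ * y₁ + x₀ * x₁ * y₁ ^ 2 +
      a * x₀ ^ 2 * y₀ ^ 2)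

theorem kernelForm_eq (a t x₀ x₁ y₀ y₁ : ℂ) (hx : x₁ ≠ 0) (hy : y₁ ≠ 0) :
    kernelForm a t x₀ x₁ y₀ y₁ = x₁ ^ 2 * y₁ ^ 2 * kernel a t (x₀ / x₁) (y₀ / y₁) := by
  unfold kernelForm kernel
  field_simp

/-- Homogeneous coordinates on `ℂ ∪ {∞}`: `x = [x : 1]` and `∞ = [1 : 0]`. -/
def homCoord (p : OnePoint ℂ) : ℂ × ℂ := p.elim (1, 0) (fun x => (x, 1))

/-- The kernel on `(ℂ ∪ {∞}) × (ℂ ∪ {∞})`; only its vanishing is meaningful at infinity. -/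
def kernelExt (a t : ℂ) (p q : OnePoint ℂ) : ℂ :=
  kernelForm a t (homCoord p).1 (homCoord p).2 (homCoord q).1 (homCoord q).2

theorem kernelExt_coe (a t x y : ℂ) :
    kernelExt a t (x : OnePoint ℂ) (y : OnePoint ℂ) = kernel a t x y := by
  simp [kernelExt, homCoord, kernelForm, kernel]

/-- The kernel curve `𝒞 = {(x,y) ∈ (ℂ ∪ {∞})² : K(x,y) = 0}`. -/
def kernelCurve (a t : ℂ) : Set (OnePoint ℂ × OnePoint ℂ) :=
  {p | kernelExt a t p.1 p.2 = 0}

/-- The modulus on `ℂ ∪ {∞}`, with `|∞| = ∞`. -/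
def modulus (p : OnePoint ℂ) : ENNReal := p.elim ⊤ (fun x => ‖x‖ₑ)

/-- The complex value of a point of `ℂ ∪ {∞}`, with the placeholder `0` at `∞`. -/
def finPart (p : OnePoint ℂ) : ℂ := p.elim 0 id

/-- `F : ℂ → ℂ ∪ {∞}` is a meromorphic function: its poles are isolated, it is meromorphic as a
complex-valued function off them, and its values (including `∞` at the poles) are the limits. -/
def IsMeromorphic (F : ℂ → OnePoint ℂ) : Prop :=
  Meromorphic (fun z => finPart (F z)) ∧ Continuous F ∧
    ∀ z, ∀ᶠ w in 𝓝[≠] z, F w ≠ OnePoint.infty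

/-- The order of `F` at `z`: positive at a root, negative at a pole. -/
def orderAt (F : ℂ → OnePoint ℂ) (z : ℂ) : ℤ :=
  (meromorphicOrderAt (fun w => finPart (F w)) z).untop₀

/-- The number of roots of `F` in `D`, counted with multiplicity. -/
def rootCount (F : ℂ → OnePoint ℂ) (D : Set ℂ) : ℤ := ∑ᶠ z ∈ D, max (orderAt F z) 0

/-- The number of poles of `F` in `D`, counted with multiplicity. -/
def poleCount (F : ℂ → OnePoint ℂ) (D : Set ℂ) : ℤ := ∑ᶠ z ∈ D, max (-orderAt F z) 0

/-- The fundamental domain `{z_c + r₁ π + r₂ π τ : r₁, r₂ ∈ [0,1)}`. -/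
def fundDomain (τ zc : ℂ) : Set ℂ :=
  {z | ∃ r₁ ∈ Set.Ico (0 : ℝ) 1, ∃ r₂ ∈ Set.Ico (0 : ℝ) 1,
    z = zc + r₁ * Real.pi + r₂ * Real.pi * τ}

/-- `X(z) = c ϑ(z)ϑ(z+γ) / (ϑ(z-γ)ϑ(z+2γ))`, with value `∞` where the denominator vanishes
(for `0 < Im 2γ < Im πτ` the numerator does not vanish there). -/
def Xfun (c γ τ z : ℂ) : OnePoint ℂ :=
  open Classical in
  if theta (z - γ) τ * theta (z + 2 * γ) τ = 0 then OnePoint.infty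
  else ((c * (theta z τ * theta (z + γ) τ) /
    (theta (z - γ) τ * theta (z + 2 * γ) τ) : ℂ) : OnePoint ℂ)

/-- `Y(z) = c ϑ(z)ϑ(z-γ) / (ϑ(z+γ)ϑ(z-2γ))`, with value `∞` where the denominator vanishes. -/
def Yfun (c γ τ z : ℂ) : OnePoint ℂ :=
  open Classical in
  if theta (z + γ) τ * theta (z - 2 * γ) τ = 0 then OnePoint.infty
  else ((c * (theta z τ * theta (z - γ) τ) /
    (theta (z + γ) τ * theta (z - 2 * γ) τ) : ℂ) : OnePoint ℂ)

/-- `X` and `Y` are meromorphic functions parametrising the kernel curve, with the stated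
symmetries, sizes and numbers of roots and poles. -/
structure ParametrisesKernel (a t : ℝ) (γ τ : ℂ) (X Y : ℂ → OnePoint ℂ) : Prop where
  meromorphic_X : IsMeromorphic X
  meromorphic_Y : IsMeromorphic Y
  curve_eq : kernelCurve a t = Set.range (fun z => (X z, Y z))
  gamma_re : γ.re = 0
  tau_re : τ.re = 0
  gamma_pos : 0 < (2 * γ).im
  gamma_lt : (2 * γ).im < ((Real.pi : ℂ) * τ).im
  kernel_zero : ∀ z, kernelExt a t (X z) (Y z) = 0
  X_add_pi : ∀ z, X (z + Real.pi) = X z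
  X_add_pi_tau : ∀ z, X (z + Real.pi * τ) = X z
  X_reflect : ∀ z, X (-γ - z) = X z
  Y_add_pi : ∀ z, Y (z + Real.pi) = Y z
  Y_add_pi_tau : ∀ z, Y (z + Real.pi * τ) = Y z
  Y_reflect : ∀ z, Y (γ - z) = Y z
  X_small : modulus (X (-γ / 2)) < 1
  Y_small : modulus (Y (γ / 2)) < 1
  roots_X : ∀ zc, rootCount X (fundDomain τ zc) = 2
  poles_X : ∀ zc, poleCount X (fundDomain τ zc) = 2
  roots_Y : ∀ zc, rootCount Y (fundDomain τ zc) = 2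
  poles_Y : ∀ zc, poleCount Y (fundDomain τ zc) = 2

/-- The sets `Ω s` partition the plane into simply connected regions, stacked as a sequence of
bands, according to whether `|X| < 1` and whether `|Y| < 1`, and have the stated symmetries. -/
structure IsOmegaPartition (γ τ : ℂ) (X Y : ℂ → OnePoint ℂ) (Ω : ℤ → Set ℂ) : Prop where
  disjoint : Pairwise (fun r s => Disjoint (Ω r) (Ω s))
  cover : ⋃ s, Ω s = Set.univ
  simplyConnected : ∀ s, SimplyConnectedSpace (Ω s)
  -- Only consecutive bands touch; they are separated by the lines `|X| = 1` and `|Y| = 1`,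
  -- alternately.
  closure_disjoint : ∀ r s : ℤ, r + 1 < s → Disjoint (closure (Ω r)) (closure (Ω s))
  lines_X : ⋃ s : ℤ, closure (Ω (2 * s)) ∩ closure (Ω (2 * s + 1)) = {z | modulus (X z) = 1}
  lines_Y : ⋃ s : ℤ, closure (Ω (2 * s - 1)) ∩ closure (Ω (2 * s)) = {z | modulus (Y z) = 1}
  Y_lt : ⋃ s : ℤ, Ω (4 * s) ∪ Ω (4 * s + 1) = {z | modulus (Y z) < 1}
  Y_ge : ⋃ s : ℤ, Ω (4 * s - 2) ∪ Ω (4 * s - 1) = {z | 1 ≤ modulus (Y z)}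
  X_lt : ⋃ s : ℤ, Ω (4 * s - 1) ∪ Ω (4 * s) = {z | modulus (X z) < 1}
  X_ge : ⋃ s : ℤ, Ω (4 * s + 1) ∪ Ω (4 * s + 2) = {z | 1 ≤ modulus (X z)}
  add_pi : ∀ s, (fun z : ℂ => (Real.pi : ℂ) + z) '' Ω s = Ω s
  reflect_Y : ∀ s : ℤ,
    (fun z : ℂ => (s : ℂ) * Real.pi * τ + γ - z) '' (Ω (2 * s) ∪ Ω (2 * s + 1)) =
      Ω (2 * s) ∪ Ω (2 * s + 1)
  line_Y : ∀ s : ℤ, Set.range (fun r : ℝ => ((s : ℂ) * Real.pi * τ + γ) / 2 + (r : ℂ)) ⊆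
    Ω (2 * s) ∪ Ω (2 * s + 1)
  reflect_X : ∀ s : ℤ,
    (fun z : ℂ => (s : ℂ) * Real.pi * τ - γ - z) '' (Ω (2 * s) ∪ Ω (2 * s - 1)) =
      Ω (2 * s) ∪ Ω (2 * s - 1)
  line_X : ∀ s : ℤ, Set.range (fun r : ℝ => ((s : ℂ) * Real.pi * τ - γ) / 2 + (r : ℂ)) ⊆
    Ω (2 * s) ∪ Ω (2 * s - 1)

end

end AModel

open scoped Topology

namespace AModel

noncomputable section

/-! Write γ = ig and πτ = iT with g, T real. The algebra rests on one rigidity principle,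
`exists_eq_const_mul`: two entire functions with the same multipliers under π and iT are
proportional as soon as the zeros of one are simple and are zeros of the other, because the quotient
is entire and bounded. It gives a product formula for ϑ in the complementary nome (`exists_th_eq`),
hence the zeros of ϑ, and the identities `thPair_three_term` and `thPair_four_term`. These say that
the quadratic K(X(z), ·) has the roots Y(z) and Y(-γ-z) (`Fits.kernel_factor`). As X is onto the
sphere and X(-γ-z) = X(z), the pair (X, Y) covers the whole curve.

Choice of parameters: for fixed T, eliminating c from the two equations for ac³ and c² leaves a
condition on g/T with exactly one solution in (1/4, 1/3), continuous in T. The reason is that the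
normalised modulus `mu` increases with the height on [0, T/2] (`mu_lt`), which the product formula
shows factor by factor. At π/2 and at π/2 + iT/2 one has X = Y, with positive values `lowX` <
`highX`, so S(x,x) takes the value 1/t at both. The ratio of these two values is close to 1 for
small T and unbounded for large T, while S(1,1) = a + 4; the intermediate value theorem in T
therefore produces any prescribed 1/t > a + 4 (`exists_fits_thConst`).

Bands: on the real line Y is the conjugate of X, so a value x of modulus r gives 1/t = S(x, x̄) ≤
S(r,r), and r stays away from 1. Since X(0) = 0, this forces |X| < 1 on the real line; similarly |X|
> 1 on the line at height T/2. Reflection and the maximum principle extend this to the strips [-g,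
0] and [T/2-g, T/2] of heights. Between them, on [0, T/2-g], the monotonicity of `mu` makes |X|
cross 1 exactly once on each vertical line, so that |X| = 1 is there the graph of a continuous
function η (`Fits.exists_graph`). Translates and reflections of this graph are all the curves |X| =
1 and |Y| = 1, and they cut out the bands. -/

/-- The theta function with imaginary quasi-period `I * T`, that is `τ = I * T / π`. -/
def th (T : ℝ) (z : ℂ) : ℂ := theta z (Complex.I * T / Real.pi)

/-! ### The theta series and its quasi-periods -/

lemma pi_ne_zero' : (Real.pi : ℂ) ≠ 0 := by exact_mod_cast Real.pi_ne_zero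

lemma th_eq_tsum (T : ℝ) (z : ℂ) : th T z = ∑' n : ℕ, (-1 : ℂ) ^ n *
    Complex.exp (-T * ((n : ℂ) + 1 / 2) ^ 2) *
    (Complex.exp ((2 * (n : ℂ) + 1) * Complex.I * z) -
      Complex.exp (-((2 * (n : ℂ) + 1) * Complex.I * z))) := by
  unfold th theta
  congr! 6 with n
  field_simp [pi_ne_zero']
  simp

lemma tau_im_pos {T : ℝ} (hT : 0 < T) : 0 < (Complex.I * T / Real.pi : ℂ).im := by
  have : (Complex.I * T / Real.pi : ℂ) = ((T / Real.pi : ℝ) : ℂ) * Complex.I := by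
    push_cast; ring
  rw [this]
  simp only [Complex.mul_I_im, Complex.ofReal_re]
  exact div_pos hT Real.pi_pos

/-- The two-sided Jacobi series is folded by pairing the indices n and -(n+1), whose coefficients
agree up to sign once the square is completed. -/
lemma hasSum_th {T : ℝ} (hT : 0 < T) (z : ℂ) : HasSum (fun n : ℕ => (-1 : ℂ) ^ n *
    Complex.exp (-T * ((n : ℂ) + 1 / 2) ^ 2) *
    (Complex.exp ((2 * (n : ℂ) + 1) * Complex.I * z) -
      Complex.exp (-((2 * (n : ℂ) + 1) * Complex.I * z))))
    (Complex.exp (-T / 4 + Complex.I * z) *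
      jacobiTheta₂ (z / Real.pi + 1 / 2 + Complex.I * T / Real.pi / 2)
        (Complex.I * T / Real.pi)) := by
  have h := ((hasSum_jacobiTheta₂_term (z / Real.pi + 1 / 2 + Complex.I * T / Real.pi / 2)
    (tau_im_pos hT)).mul_left (Complex.exp (-T / 4 + Complex.I * z))).nat_add_neg_add_one
  refine h.congr_fun fun n => ?_
  rw [mul_sub, jacobiTheta₂_term, jacobiTheta₂_term, ← Complex.exp_add, ← Complex.exp_add,
    ← Complex.exp_pi_mul_I, ← Complex.exp_nat_mul, ← Complex.exp_add, ← Complex.exp_add,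
    ← Complex.exp_add, sub_eq_add_neg]
  have hpi := pi_ne_zero'
  congr 1
  · congr 1
    push_cast
    field_simp
    ring_nf
    simp only [Complex.I_sq]
    ring
  · rw [← neg_one_mul, ← Complex.exp_pi_mul_I, ← Complex.exp_add,
      Complex.exp_eq_exp_iff_exists_int]
    refine ⟨n + 1, ?_⟩
    push_cast
    field_simp
    ring_nf
    simp only [Complex.I_sq]
    ring

lemma th_eq_jacobiTheta₂ {T : ℝ} (hT : 0 < T) (z : ℂ) : th T z =
    Complex.exp (-T / 4 + Complex.I * z) *
      jacobiTheta₂ (z / Real.pi + 1 / 2 + Complex.I * T / Real.pi / 2)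
        (Complex.I * T / Real.pi) := by
  rw [th_eq_tsum, (hasSum_th hT z).tsum_eq]

lemma th_neg (T : ℝ) (z : ℂ) : th T (-z) = -th T z := by
  rw [th_eq_tsum, th_eq_tsum, ← tsum_neg]
  congr! 2 with n
  simp only [mul_neg, neg_neg]
  ring

lemma th_zero (T : ℝ) : th T 0 = 0 := by
  simp [th_eq_tsum]

lemma differentiable_th {T : ℝ} (hT : 0 < T) : Differentiable ℂ (th T) := by
  intro z
  rw [show th T = fun z => _ from funext (th_eq_jacobiTheta₂ hT)]
  refine DifferentiableAt.mul (by fun_prop) ?_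
  exact (differentiableAt_jacobiTheta₂_fst _ (tau_im_pos hT)).comp z (by fun_prop)

lemma continuousAt_th {T : ℝ} (hT : 0 < T) (z : ℂ) :
    ContinuousAt (fun p : ℝ × ℂ => th p.1 p.2) (T, z) := by
  have h : (fun p : ℝ × ℂ => th p.1 p.2) =ᶠ[𝓝 (T, z)] fun p : ℝ × ℂ =>
      Complex.exp (-p.1 / 4 + Complex.I * p.2) *
      jacobiTheta₂ (p.2 / Real.pi + 1 / 2 + Complex.I * p.1 / Real.pi / 2)
        (Complex.I * p.1 / Real.pi) := by
    filter_upwards [(isOpen_Ioi.preimage continuous_fst).mem_nhds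
      (show (T, z) ∈ Prod.fst ⁻¹' Set.Ioi (0 : ℝ) from hT)] with p hp
    exact th_eq_jacobiTheta₂ hp p.2
  refine ContinuousAt.congr ?_ h.symm
  refine ContinuousAt.mul (by fun_prop) ?_
  exact (continuousAt_jacobiTheta₂ (z / Real.pi + 1 / 2 + Complex.I * T / Real.pi / 2)
    (tau_im_pos hT)).comp
    (f := fun p : ℝ × ℂ => (p.2 / Real.pi + 1 / 2 + Complex.I * p.1 / Real.pi / 2,
        Complex.I * p.1 / Real.pi)) (x := (T, z)) (by fun_prop)

lemma th_add_pi (T : ℝ) (z : ℂ) : th T (z + Real.pi) = -th T z := by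
  rw [th_eq_tsum, th_eq_tsum, ← tsum_neg]
  congr! 2 with n
  have h1 : Complex.exp ((2 * (n : ℂ) + 1) * Complex.I * (z + Real.pi)) =
      -Complex.exp ((2 * (n : ℂ) + 1) * Complex.I * z) := by
    rw [show (2 * (n : ℂ) + 1) * Complex.I * (z + Real.pi) =
      (2 * (n : ℂ) + 1) * Complex.I * z + Real.pi * Complex.I + n * (2 * Real.pi * Complex.I) by
        ring, Complex.exp_add, Complex.exp_add, Complex.exp_nat_mul_two_pi_mul_I,
        Complex.exp_pi_mul_I]
    ring
  rw [Complex.exp_neg, Complex.exp_neg, h1, inv_neg]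
  ring

lemma th_add_I_mul {T : ℝ} (hT : 0 < T) (z : ℂ) :
    th T (z + Complex.I * T) = -Complex.exp (T - 2 * Complex.I * z) * th T z := by
  rw [th_eq_jacobiTheta₂ hT, th_eq_jacobiTheta₂ hT,
    show (z + Complex.I * T) / Real.pi + 1 / 2 + Complex.I * T / Real.pi / 2 =
      (z / Real.pi + 1 / 2 + Complex.I * T / Real.pi / 2) + Complex.I * T / Real.pi by ring,
    jacobiTheta₂_add_left', ← mul_assoc, ← mul_assoc, ← Complex.exp_add]
  congr 1
  have hpi := pi_ne_zero'
  rw [show -(T : ℂ) / 4 + Complex.I * (z + Complex.I * T) + -Real.pi * Complex.I *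
      (Complex.I * T / Real.pi + 2 * (z / Real.pi + 1 / 2 + Complex.I * T / Real.pi / 2)) =
      (T - 2 * Complex.I * z) + (-T / 4 + Complex.I * z) - Real.pi * Complex.I by
    field_simp
    ring_nf
    simp only [Complex.I_sq]
    ring, Complex.exp_sub, Complex.exp_add, Complex.exp_pi_mul_I]
  ring

/-- The coefficients are real because τ is imaginary, and conjugation exchanges the two exponentials
of each term. -/
lemma th_conj (T : ℝ) (z : ℂ) :
    th T ((starRingEnd ℂ) z) = -(starRingEnd ℂ) (th T z) := by
  rw [th_eq_tsum, th_eq_tsum, Complex.conj_tsum, ← tsum_neg]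
  congr! 2 with n
  simp only [map_mul, map_sub, map_pow, map_neg, map_one, ← Complex.exp_conj, map_add, map_div₀,
    map_ofNat, Complex.conj_ofReal, Complex.conj_I, Complex.conj_natCast]
  ring_nf

/-! ### Rigidity of quasi-periodic entire functions -/

lemma bounded_of_periodic {T : ℝ} (hT : 0 < T) {h : ℂ → ℂ} (hc : Continuous h)
    (h₁ : ∀ z, h (z + Real.pi) = h z) (h₂ : ∀ z, h (z + Complex.I * T) = h z) :
    Bornology.IsBounded (Set.range h) := by
  have hK : IsCompact ((fun p : ℝ × ℝ => ((p.1 * Real.pi + p.2 * (Complex.I * T) : ℂ))) ''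
      (Set.Icc (0 : ℝ) 1 ×ˢ Set.Icc (0 : ℝ) 1)) :=
    (isCompact_Icc.prod isCompact_Icc).image (by fun_prop)
  refine (hK.image hc).isBounded.subset ?_
  rintro _ ⟨z, rfl⟩
  have p₁ : Function.Periodic h (Real.pi : ℂ) := h₁
  have p₂ : Function.Periodic h (Complex.I * T) := h₂
  refine ⟨z - (⌊z.re / Real.pi⌋ : ℤ) * (Real.pi : ℂ) - (⌊z.im / T⌋ : ℤ) * (Complex.I * T),
    ⟨(Int.fract (z.re / Real.pi), Int.fract (z.im / T)),
      ⟨⟨Int.fract_nonneg _, (Int.fract_lt_one _).le⟩,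
        ⟨Int.fract_nonneg _, (Int.fract_lt_one _).le⟩⟩, ?_⟩, ?_⟩
  · apply Complex.ext
    · simp
      rw [← Int.self_sub_floor, sub_mul, div_mul_cancel₀ _ Real.pi_ne_zero]
    · simp
      rw [← Int.self_sub_floor, sub_mul, div_mul_cancel₀ _ hT.ne']
  · rw [p₂.sub_int_mul_eq, p₁.sub_int_mul_eq]

lemma eventually_ne_zero_of_simple {G : ℂ → ℂ} (hG : Differentiable ℂ G) {z : ℂ}
    (hz : G z = 0 → deriv G z ≠ 0) : ∀ᶠ w in 𝓝[≠] z, G w ≠ 0 := by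
  by_cases h : G z = 0
  · exact (hG z).hasDerivAt.eventually_ne (hz h)
  · exact ((hG z).continuousAt.eventually_ne h).filter_mono nhdsWithin_le_nhds

/-- Two entire functions with the same multipliers for the lattice are proportional if the second
has only simple zeros and these are zeros of the first. -/
lemma exists_eq_const_mul {T : ℝ} (hT : 0 < T) {F G : ℂ → ℂ} (hF : Differentiable ℂ F)
    (hG : Differentiable ℂ G) (hG0 : ∀ z, G z = 0 → deriv G z ≠ 0)
    (hFG : ∀ z, G z = 0 → F z = 0) (m₁ m₂ : ℂ → ℂ) (hm₁ : ∀ z, m₁ z ≠ 0) (hm₂ : ∀ z, m₂ z ≠ 0)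
    (hF₁ : ∀ z, F (z + Real.pi) = m₁ z * F z) (hG₁ : ∀ z, G (z + Real.pi) = m₁ z * G z)
    (hF₂ : ∀ z, F (z + Complex.I * T) = m₂ z * F z)
    (hG₂ : ∀ z, G (z + Complex.I * T) = m₂ z * G z) : ∃ k : ℂ, ∀ z, F z = k * G z := by
  classical
  -- At a zero of G, which is simple, the quotient is given its limit F'/G'.
  let h : ℂ → ℂ := fun z => if G z = 0 then deriv F z / deriv G z else F z / G z
  have hd : Differentiable ℂ h := by
    intro z₀
    by_cases hz : G z₀ = 0
    -- Near a common zero F/G is the quotient of the two difference quotients, whose denominator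
    -- does not vanish there.
    · have dF : DifferentiableAt ℂ (dslope F z₀) z₀ :=
        ((Complex.differentiableOn_dslope (s := Set.univ) Filter.univ_mem).2
          hF.differentiableOn).differentiableAt Filter.univ_mem
      have dG : DifferentiableAt ℂ (dslope G z₀) z₀ :=
        ((Complex.differentiableOn_dslope (s := Set.univ) Filter.univ_mem).2
          hG.differentiableOn).differentiableAt Filter.univ_mem
      have hne : dslope G z₀ z₀ ≠ 0 := by rw [dslope_same]; exact hG0 z₀ hz
      refine (dF.div dG hne).congr_of_eventuallyEq ?_
      have h1 := eventually_nhdsWithin_iff.1 (eventually_ne_zero_of_simple hG (hG0 z₀))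
      filter_upwards [h1] with w hw
      by_cases hwz : w = z₀
      · subst hwz
        simp [h, hz]
      · have hs : w - z₀ ≠ 0 := sub_ne_zero.2 hwz
        simp only [h, if_neg (hw hwz), Pi.div_apply, dslope_of_ne _ hwz, slope_def_field, hz,
          hFG z₀ hz, sub_zero]
        field_simp
    · refine ((hF z₀).div (hG z₀) hz).congr_of_eventuallyEq ?_
      filter_upwards [(hG z₀).continuousAt.eventually_ne hz] with w hw
      simp [h, hw]
  have hper : ∀ (ω : ℂ) (m : ℂ → ℂ), (∀ z, m z ≠ 0) → (∀ z, F (z + ω) = m z * F z) →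
      (∀ z, G (z + ω) = m z * G z) → ∀ z, h (z + ω) = h z := by
    intro ω m hm hFω hGω z
    -- The multipliers cancel off the zeros of G; these are isolated, so continuity covers them.
    have h1 : ∀ᶠ w in 𝓝[≠] z, h (w + ω) = h w := by
      filter_upwards [eventually_ne_zero_of_simple hG (hG0 z)] with w hw
      have : G (w + ω) ≠ 0 := by rw [hGω]; exact mul_ne_zero (hm w) hw
      simp only [h, if_neg hw, if_neg this]
      rw [hFω, hGω, mul_div_mul_left _ _ (hm w)]
    have c1 : Filter.Tendsto (fun w => h (w + ω)) (𝓝[≠] z) (𝓝 (h (z + ω))) :=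
      ((hd.continuous.comp (continuous_id.add continuous_const)).tendsto z).mono_left
        nhdsWithin_le_nhds
    have c2 : Filter.Tendsto h (𝓝[≠] z) (𝓝 (h z)) :=
      (hd.continuous.tendsto z).mono_left nhdsWithin_le_nhds
    exact tendsto_nhds_unique (c1.congr' h1) c2
  have hb := bounded_of_periodic hT hd.continuous (hper _ m₁ hm₁ hF₁ hG₁)
    (hper _ m₂ hm₂ hF₂ hG₂)
  refine ⟨h 0, fun z => ?_⟩
  by_cases hz : G z = 0
  · rw [hz, hFG z hz, mul_zero]
  · rw [← hd.apply_eq_apply_of_bounded hb z 0]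
    simp only [h, if_neg hz]
    field_simp

/-! ### The product formula in the complementary nome -/

/-- The product `∏ (1 - r ^ n u)` over `n ≥ 0`. -/
def poch (r : ℝ) (u : ℂ) : ℂ := ∏' n : ℕ, (1 - (r : ℂ) ^ n * u)

lemma summable_norm_poch {r : ℝ} (h0 : 0 < r) (h1 : r < 1) (u : ℂ) :
    Summable fun n : ℕ => ‖-((r : ℂ) ^ n * u)‖ := by
  have : (fun n : ℕ => ‖-((r : ℂ) ^ n * u)‖) = fun n : ℕ => r ^ n * ‖u‖ := by
    ext n
    simp [abs_of_pos h0]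
  rw [this]
  exact (summable_geometric_of_lt_one h0.le h1).mul_right _

lemma multipliable_poch {r : ℝ} (h0 : 0 < r) (h1 : r < 1) (u : ℂ) :
    Multipliable fun n : ℕ => (1 - (r : ℂ) ^ n * u) := by
  simpa only [sub_eq_add_neg] using
    multipliable_one_add_of_summable (summable_norm_poch h0 h1 u)

lemma differentiable_poch {r : ℝ} (h0 : 0 < r) (h1 : r < 1) : Differentiable ℂ (poch r) := by
  have hp : HasProdLocallyUniformlyOn (fun (n : ℕ) (u : ℂ) => 1 + -((r : ℂ) ^ n * u))
      (fun u => ∏' n : ℕ, (1 + -((r : ℂ) ^ n * u))) Set.univ := by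
    apply hasProdLocallyUniformlyOn_of_forall_compact isOpen_univ
    intro K _ hcK
    obtain ⟨R, hR⟩ := hcK.isBounded.exists_norm_le
    refine ((summable_geometric_of_lt_one h0.le h1).mul_right R).hasProdUniformlyOn_nat_one_add
      hcK (.of_forall fun n x hx => ?_) (fun _ => by fun_prop)
    simpa [abs_of_pos h0] using mul_le_mul_of_nonneg_left (hR x hx) (pow_nonneg h0.le n)
  have := hp.differentiableOn
    (.of_forall fun _ => by simpa [Finset.prod_fn] using
      DifferentiableOn.finsetProd (fun _ _ => by fun_prop)) isOpen_univ
  rw [← differentiableOn_univ]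
  simpa only [poch, sub_eq_add_neg] using! this

lemma poch_eq {r : ℝ} (h0 : 0 < r) (h1 : r < 1) (u : ℂ) :
    poch r u = (1 - u) * poch r (r * u) := by
  have hm := multipliable_poch h0 h1 (r * u)
  have he : (fun n : ℕ => (1 - (r : ℂ) ^ n * (r * u))) = fun n : ℕ => 1 - (r : ℂ) ^ (n + 1) * u := by
    ext n; ring
  rw [poch, tprod_eq_zero_mul' (by rw [← he]; exact hm), poch, he]
  simp

lemma poch_ne_zero {r : ℝ} (h0 : 0 < r) (h1 : r < 1) {u : ℂ}
    (hu : ∀ n : ℕ, (r : ℂ) ^ n * u ≠ 1) : poch r u ≠ 0 := by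
  have := tprod_one_add_ne_zero_of_summable (f := fun n : ℕ => -((r : ℂ) ^ n * u))
    (fun n => by
      rw [← sub_eq_add_neg]
      exact sub_ne_zero.2 (hu n).symm) (summable_norm_poch h0 h1 u)
  simpa only [poch, sub_eq_add_neg] using! this

lemma norm_one_sub_sq (s : ℝ) (u : ℂ) :
    ‖1 - (s : ℂ) * u‖ ^ 2 = 1 - 2 * s * u.re + s ^ 2 * ‖u‖ ^ 2 := by
  rw [← Complex.normSq_eq_norm_sq, ← Complex.normSq_eq_norm_sq, Complex.normSq_apply,
    Complex.normSq_apply]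
  simp
  ring

/-- On a circle about 0 each factor |1 - rⁿu| decreases as Re u grows. -/
lemma norm_poch_le {r : ℝ} (h0 : 0 < r) (h1 : r < 1) {u v : ℂ} (huv : ‖u‖ = ‖v‖)
    (hre : v.re ≤ u.re) : ‖poch r u‖ ≤ ‖poch r v‖ := by
  have hu := (multipliable_poch h0 h1 u).hasProd.norm
  have hv := (multipliable_poch h0 h1 v).hasProd.norm
  refine le_of_tendsto_of_tendsto' hu hv fun s => Finset.prod_le_prod
    (fun _ _ => norm_nonneg _) fun n _ => ?_
  refine le_of_sq_le_sq ?_ (norm_nonneg _)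
  have e : ((r : ℂ) ^ n) = ((r ^ n : ℝ) : ℂ) := by push_cast; rfl
  rw [e, norm_one_sub_sq, norm_one_sub_sq, huv]
  have : 0 ≤ r ^ n := pow_nonneg h0.le n
  nlinarith

/-- Strictness comes from the first factor, provided that the remaining product at v is not 0. If it
were, v would be a positive real, the point of largest real part on its circle. -/
lemma norm_poch_lt {r : ℝ} (h0 : 0 < r) (h1 : r < 1) {u v : ℂ} (huv : ‖u‖ = ‖v‖)
    (hre : v.re < u.re) : ‖poch r u‖ < ‖poch r v‖ := by
  have hv : poch r (r * v) ≠ 0 := by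
    refine poch_ne_zero h0 h1 fun n hn => ?_
    have hv' : v = (((r ^ (n + 1))⁻¹ : ℝ) : ℂ) := by
      push_cast
      refine eq_inv_of_mul_eq_one_left ?_
      rw [← hn]
      ring
    have h2 : ‖v‖ = v.re := by
      rw [hv', Complex.ofReal_re, Complex.norm_real, Real.norm_of_nonneg (by positivity)]
    linarith [Complex.re_le_norm u]
  rw [poch_eq h0 h1 u, poch_eq h0 h1 v, norm_mul, norm_mul]
  have h2 : ‖poch r (r * u)‖ ≤ ‖poch r (r * v)‖ := by
    refine norm_poch_le h0 h1 (by rw [norm_mul, norm_mul, huv]) ?_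
    simpa using mul_le_mul_of_nonneg_left hre.le h0.le
  have h3 : ‖1 - u‖ < ‖1 - v‖ := by
    refine lt_of_pow_lt_pow_left₀ 2 (norm_nonneg _) ?_
    have := norm_one_sub_sq 1 u
    have := norm_one_sub_sq 1 v
    simp only [Complex.ofReal_one, one_mul] at *
    rw [huv] at *
    nlinarith
  calc _ ≤ ‖1 - u‖ * ‖poch r (r * v)‖ := by gcongr
    _ < _ := by
      have := norm_pos_iff.2 hv
      gcongr

/-- The period lattice `π ℤ + I T ℤ`. -/
def InLattice (T : ℝ) (z : ℂ) : Prop := ∃ m n : ℤ, z = m * (Real.pi : ℂ) + n * (Complex.I * T)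

/-- The ratio of the product expansion of the theta function in the complementary nome. -/
def dualRatio (T : ℝ) : ℝ := Real.exp (-(2 * Real.pi ^ 2 / T))

lemma dualRatio_pos (T : ℝ) : 0 < dualRatio T := Real.exp_pos _

lemma dualRatio_lt_one {T : ℝ} (hT : 0 < T) : dualRatio T < 1 := by
  rw [dualRatio, Real.exp_lt_one_iff, neg_lt_zero]
  have := Real.pi_pos
  positivity

/-- The product in the complementary nome to which the theta function is proportional. -/
def thProd (T : ℝ) (z : ℂ) : ℂ :=
  Complex.exp (-z ^ 2 / T + Real.pi * z / T) *
    (poch (dualRatio T) (Complex.exp (-(2 * Real.pi * z / T))) *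
      poch (dualRatio T) (dualRatio T * Complex.exp (2 * Real.pi * z / T)))

lemma differentiable_thProd {T : ℝ} (hT : 0 < T) : Differentiable ℂ (thProd T) := by
  have hp := differentiable_poch (dualRatio_pos T) (dualRatio_lt_one hT)
  unfold thProd
  refine Differentiable.mul (by fun_prop) (Differentiable.mul (hp.comp ?_) (hp.comp ?_)) <;>
    fun_prop

lemma thProd_eq {T : ℝ} (hT : 0 < T) (z : ℂ) : thProd T z =
    (1 - Complex.exp (-(2 * Real.pi * z / T))) * (Complex.exp (-z ^ 2 / T + Real.pi * z / T) *
    (poch (dualRatio T) (dualRatio T * Complex.exp (-(2 * Real.pi * z / T))) *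
      poch (dualRatio T) (dualRatio T * Complex.exp (2 * Real.pi * z / T)))) := by
  rw [thProd, poch_eq (dualRatio_pos T) (dualRatio_lt_one hT)
    (Complex.exp (-(2 * Real.pi * z / T)))]
  ring

/-- The translation divides e^{2πz/T} by `dualRatio T`, so one product loses its first factor and
the other gains one; the Gaussian prefactor absorbs the quotient of the two up to sign. -/
lemma thProd_add_pi {T : ℝ} (hT : 0 < T) (z : ℂ) : thProd T (z + Real.pi) = -thProd T z := by
  have hT' : (T : ℂ) ≠ 0 := by exact_mod_cast hT.ne'
  rw [thProd_eq hT z, thProd]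
  have e1 : Complex.exp (-(2 * Real.pi * (z + Real.pi) / T)) =
      dualRatio T * Complex.exp (-(2 * Real.pi * z / T)) := by
    rw [dualRatio, Complex.ofReal_exp, ← Complex.exp_add]
    congr 1; push_cast; field_simp; ring
  have e2 : (dualRatio T : ℂ) * Complex.exp (2 * Real.pi * (z + Real.pi) / T) =
      Complex.exp (2 * Real.pi * z / T) := by
    rw [dualRatio, Complex.ofReal_exp, ← Complex.exp_add]
    congr 1; push_cast; field_simp; ring
  have e3 : Complex.exp (-(z + Real.pi) ^ 2 / T + Real.pi * (z + Real.pi) / T) =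
      Complex.exp (-z ^ 2 / T + Real.pi * z / T) * Complex.exp (-(2 * Real.pi * z / T)) := by
    rw [← Complex.exp_add]
    congr 1; field_simp; ring
  rw [e1, e2, e3, poch_eq (dualRatio_pos T) (dualRatio_lt_one hT)
    (Complex.exp (2 * Real.pi * z / T))]
  have e4 : Complex.exp (-(2 * Real.pi * z / T)) * Complex.exp (2 * Real.pi * z / T) = 1 := by
    rw [← Complex.exp_add]; simp
  linear_combination (-Complex.exp (-z ^ 2 / T + Real.pi * z / T) *
    (poch (dualRatio T) (dualRatio T * Complex.exp (-(2 * Real.pi * z / T))) *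
      poch (dualRatio T) (dualRatio T * Complex.exp (2 * Real.pi * z / T)))) * e4

lemma thProd_add_I_mul {T : ℝ} (hT : 0 < T) (z : ℂ) :
    thProd T (z + Complex.I * T) = -Complex.exp (T - 2 * Complex.I * z) * thProd T z := by
  have hT' : (T : ℂ) ≠ 0 := by exact_mod_cast hT.ne'
  rw [thProd, thProd]
  have e1 : Complex.exp (-(2 * Real.pi * (z + Complex.I * T) / T)) =
      Complex.exp (-(2 * Real.pi * z / T)) := by
    rw [Complex.exp_eq_exp_iff_exists_int]
    exact ⟨-1, by push_cast; field_simp; ring⟩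
  have e2 : Complex.exp (2 * Real.pi * (z + Complex.I * T) / T) =
      Complex.exp (2 * Real.pi * z / T) := by
    rw [Complex.exp_eq_exp_iff_exists_int]
    exact ⟨1, by push_cast; field_simp⟩
  have e3 : Complex.exp (-(z + Complex.I * T) ^ 2 / T + Real.pi * (z + Complex.I * T) / T) =
      -Complex.exp (T - 2 * Complex.I * z) * Complex.exp (-z ^ 2 / T + Real.pi * z / T) := by
    rw [show -(z + Complex.I * T) ^ 2 / T + Real.pi * (z + Complex.I * T) / T =
      Real.pi * Complex.I + (T - 2 * Complex.I * z) + (-z ^ 2 / T + Real.pi * z / T) by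
        field_simp; ring_nf; simp only [Complex.I_sq]; ring,
      Complex.exp_add, Complex.exp_add, Complex.exp_pi_mul_I]
    ring
  rw [e1, e2, e3]
  ring

lemma inLattice_of_thProd_eq_zero {T : ℝ} (hT : 0 < T) {z : ℂ} (hz : thProd T z = 0) :
    InLattice T z := by
  have hT' : (T : ℂ) ≠ 0 := by exact_mod_cast hT.ne'
  have hpi := pi_ne_zero'
  by_contra hL
  have key : ∀ (m : ℤ) (w : ℂ), Complex.exp w = 1 →
      (w = -(2 * Real.pi ^ 2 / T) * m + 2 * Real.pi * z / T ∨
        w = -(2 * Real.pi ^ 2 / T) * m - 2 * Real.pi * z / T) → False := by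
    intro m w hw h
    obtain ⟨n, hn⟩ := Complex.exp_eq_one_iff.1 hw
    apply hL
    rcases h with h | h
    · refine ⟨m, n, ?_⟩
      rw [hn] at h
      field_simp at h
      linear_combination -h
    · refine ⟨-m, -n, ?_⟩
      rw [hn] at h
      field_simp at h
      push_cast
      linear_combination h
  have e : ∀ n : ℕ, ((dualRatio T : ℂ)) ^ n = Complex.exp (-(2 * Real.pi ^ 2 / T) * n) := by
    intro n
    rw [dualRatio, Complex.ofReal_exp, ← Complex.exp_nat_mul]
    congr 1; push_cast; ring
  refine mul_ne_zero (Complex.exp_ne_zero _) (mul_ne_zero ?_ ?_) hz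
  · refine poch_ne_zero (dualRatio_pos T) (dualRatio_lt_one hT) fun n hn => ?_
    rw [e, ← Complex.exp_add] at hn
    exact key n _ hn (Or.inr (by push_cast; ring))
  · refine poch_ne_zero (dualRatio_pos T) (dualRatio_lt_one hT) fun n hn => ?_
    rw [← mul_assoc, ← pow_succ, e, ← Complex.exp_add] at hn
    exact key (n + 1) _ hn (Or.inl (by push_cast; ring))

lemma th_eq_zero_of_inLattice {T : ℝ} (hT : 0 < T) {z : ℂ} (hz : InLattice T z) :
    th T z = 0 := by
  obtain ⟨m, n, rfl⟩ := hz
  have p₁ : Function.Periodic (fun z => th T z = 0) (Real.pi : ℂ) := fun z => by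
    simp [th_add_pi]
  have p₂ : Function.Periodic (fun z => th T z = 0) (Complex.I * T) := fun z => by
    simp [th_add_I_mul hT, Complex.exp_ne_zero]
  have h1 := p₂.int_mul n (m * (Real.pi : ℂ))
  have h2 := p₁.int_mul m 0
  simp only [zero_add] at h1 h2
  rw [h1, h2]
  exact th_zero T

lemma deriv_add_period {G m : ℂ → ℂ} {ω z : ℂ} (hG : Differentiable ℂ G)
    (hm : Differentiable ℂ m) (h : ∀ z, G (z + ω) = m z * G z) (hz : G z = 0) :
    deriv G (z + ω) = m z * deriv G z := by
  have h1 : deriv (fun w => G (w + ω)) z = deriv G (z + ω) := deriv_comp_add_const ..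
  rw [← h1, show (fun w => G (w + ω)) = fun w => m w * G w from funext h,
    deriv_fun_mul (hm z) (hG z), hz]
  ring

/-- The quasi-periods reduce the claim to the point 0, where 1 - e^{-2πz/T} vanishes simply and the
other factors do not vanish. -/
lemma deriv_thProd_ne_zero {T : ℝ} (hT : 0 < T) {z : ℂ} (hz : thProd T z = 0) :
    deriv (thProd T) z ≠ 0 := by
  have hT' : (T : ℂ) ≠ 0 := by exact_mod_cast hT.ne'
  have hG := differentiable_thProd hT
  have step : ∀ (ω : ℂ) (m : ℂ → ℂ), Differentiable ℂ m → (∀ z, m z ≠ 0) →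
      (∀ z, thProd T (z + ω) = m z * thProd T z) →
      Function.Periodic (fun z => thProd T z = 0 ∧ deriv (thProd T) z ≠ 0) ω := by
    intro ω m hm hm0 h z
    simp only [h, mul_eq_zero, hm0, false_or, eq_iff_iff]
    refine and_congr_right fun hz => ?_
    rw [deriv_add_period hG hm h hz]
    simp [hm0]
  have p₁ := step Real.pi (fun _ => -1) (by fun_prop) (by simp)
    (fun z => by rw [thProd_add_pi hT]; ring)
  have p₂ := step (Complex.I * T) (fun z => -Complex.exp (T - 2 * Complex.I * z)) (by fun_prop)
    (by simp [Complex.exp_ne_zero]) (thProd_add_I_mul hT)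
  obtain ⟨m, n, rfl⟩ := inLattice_of_thProd_eq_zero hT hz
  have h1 := p₂.int_mul n (m * (Real.pi : ℂ))
  have h2 := p₁.int_mul m 0
  simp only [zero_add] at h1 h2
  suffices h : thProd T 0 = 0 ∧ deriv (thProd T) 0 ≠ 0 by
    rw [← h2, ← h1] at h
    exact h.2
  refine ⟨by simp [thProd_eq hT], ?_⟩
  have hp := differentiable_poch (dualRatio_pos T) (dualRatio_lt_one hT)
  have hA : Differentiable ℂ fun z : ℂ => Complex.exp (-z ^ 2 / T + Real.pi * z / T) *
      (poch (dualRatio T) (dualRatio T * Complex.exp (-(2 * Real.pi * z / T))) *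
      poch (dualRatio T) (dualRatio T * Complex.exp (2 * Real.pi * z / T))) := by
    refine Differentiable.mul (by fun_prop) (Differentiable.mul (hp.comp ?_) (hp.comp ?_)) <;>
      fun_prop
  have hu : HasDerivAt (fun z : ℂ => 1 - Complex.exp (-(2 * Real.pi * z / T)))
      (2 * Real.pi / T) 0 := by
    have h3 : HasDerivAt (fun z : ℂ => -(2 * Real.pi * z / T)) (-(2 * Real.pi / T)) 0 := by
      simpa using! (((hasDerivAt_id (0 : ℂ)).const_mul (2 * (Real.pi : ℂ))).div_const (T : ℂ)).neg
    simpa using h3.cexp.const_sub 1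
  rw [show thProd T = _ from funext (thProd_eq hT), (hu.fun_mul (hA 0).hasDerivAt).deriv]
  have hr : poch (dualRatio T) (dualRatio T) ≠ 0 := by
    refine poch_ne_zero (dualRatio_pos T) (dualRatio_lt_one hT) fun n hn => ?_
    rw [← pow_succ] at hn
    have h4 : dualRatio T ^ (n + 1) = 1 := by exact_mod_cast hn
    exact (pow_lt_one₀ (dualRatio_pos T).le (dualRatio_lt_one hT) n.succ_ne_zero).ne h4
  simp [hr, hT.ne', Real.pi_ne_zero]

/-- On the line Re z = π/2 the alternating signs cancel and ϑ is i times a series of positive terms.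
All explicit estimates are made on this line. -/
lemma hasSum_th_pi_div_two {T : ℝ} (hT : 0 < T) (y : ℝ) : HasSum (fun n : ℕ =>
    Real.exp (-T * ((n : ℝ) + 1 / 2) ^ 2) *
      (Real.exp ((2 * n + 1) * y) + Real.exp (-((2 * n + 1) * y))))
    (th T (Real.pi / 2 + Complex.I * y)).im ∧ (th T (Real.pi / 2 + Complex.I * y)).re = 0 := by
  have h := hasSum_th hT (Real.pi / 2 + Complex.I * y)
  rw [← th_eq_jacobiTheta₂ hT] at h
  have h' : HasSum (fun n : ℕ => Complex.I * ((Real.exp (-T * ((n : ℝ) + 1 / 2) ^ 2) *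
      (Real.exp ((2 * n + 1) * y) + Real.exp (-((2 * n + 1) * y))) : ℝ) : ℂ))
      (th T (Real.pi / 2 + Complex.I * y)) := by
    refine h.congr_fun fun n => ?_
    have e1 : Complex.exp ((2 * (n : ℂ) + 1) * Complex.I * (Real.pi / 2 + Complex.I * y)) =
        (-1) ^ n * Complex.I * Complex.exp (-((2 * n + 1) * y)) := by
      rw [show (2 * (n : ℂ) + 1) * Complex.I * (Real.pi / 2 + Complex.I * y) =
        n * (Real.pi * Complex.I) + Real.pi / 2 * Complex.I + (-((2 * n + 1) * y)) by
          ring_nf; simp only [Complex.I_sq]; ring, Complex.exp_add, Complex.exp_add,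
          Complex.exp_nat_mul, Complex.exp_pi_mul_I, Complex.exp_pi_div_two_mul_I]
    rw [Complex.exp_neg ((2 * (n : ℂ) + 1) * Complex.I * (Real.pi / 2 + Complex.I * y)), e1]
    push_cast
    rw [mul_inv, mul_inv, ← Complex.exp_neg, Complex.inv_I, neg_neg, ← inv_pow]
    have : ((-1 : ℂ)) ^ n * (-1) ^ n = 1 := by rw [← mul_pow]; simp
    rw [show ((-1 : ℂ))⁻¹ = -1 by norm_num]
    linear_combination (-(Complex.I * Complex.exp (-T * ((n : ℂ) + 1 / 2) ^ 2) *
      (Complex.exp ((2 * n + 1) * y) + Complex.exp (-((2 * n + 1) * y))))) * this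
  constructor
  · simpa only [Complex.I_mul_im, Complex.ofReal_re] using Complex.hasSum_im h'
  · have h3 := Complex.hasSum_re h'
    simp only [Complex.I_mul_re, Complex.ofReal_im, neg_zero] at h3
    exact h3.unique hasSum_zero

lemma th_pi_div_two_im_pos {T : ℝ} (hT : 0 < T) (y : ℝ) :
    0 < (th T (Real.pi / 2 + Complex.I * y)).im := by
  have h := (hasSum_th_pi_div_two hT y).1
  rw [← h.tsum_eq]
  exact h.summable.tsum_pos (fun n => by positivity) 0 (by positivity)

/-- Jacobi's imaginary transformation, with the constant left undetermined; it is nonzero because ϑ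
does not vanish at π/2. -/
lemma exists_th_eq {T : ℝ} (hT : 0 < T) : ∃ C : ℂ, C ≠ 0 ∧ ∀ z, th T z = C * thProd T z := by
  obtain ⟨C, hC⟩ := exists_eq_const_mul hT (differentiable_th hT) (differentiable_thProd hT)
    (fun z => deriv_thProd_ne_zero hT)
    (fun z hz => th_eq_zero_of_inLattice hT (inLattice_of_thProd_eq_zero hT hz))
    (fun _ => -1) (fun z => -Complex.exp (T - 2 * Complex.I * z)) (by simp)
    (by simp [Complex.exp_ne_zero]) (fun z => by rw [th_add_pi]; ring)
    (fun z => by rw [thProd_add_pi hT]; ring) (th_add_I_mul hT) (thProd_add_I_mul hT)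
  refine ⟨C, ?_, hC⟩
  rintro rfl
  have h := th_pi_div_two_im_pos hT 0
  rw [hC] at h
  simp at h

lemma th_eq_zero_iff {T : ℝ} (hT : 0 < T) {z : ℂ} : th T z = 0 ↔ InLattice T z := by
  refine ⟨fun h => ?_, th_eq_zero_of_inLattice hT⟩
  obtain ⟨C, hC, h'⟩ := exists_th_eq hT
  rw [h', mul_eq_zero] at h
  exact inLattice_of_thProd_eq_zero hT (h.resolve_left hC)

lemma deriv_th_ne_zero {T : ℝ} (hT : 0 < T) {z : ℂ} (hz : th T z = 0) : deriv (th T) z ≠ 0 := by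
  obtain ⟨C, hC, h'⟩ := exists_th_eq hT
  rw [h', mul_eq_zero] at hz
  rw [show th T = fun z => C * thProd T z from funext h', deriv_const_mul _
    (differentiable_thProd hT z)]
  exact mul_ne_zero hC (deriv_thProd_ne_zero hT (hz.resolve_left hC))

/-! ### The normalised modulus and its monotonicity -/

/-- The modulus of the theta function, normalised so as to be periodic in `y`. -/
def mu (T x y : ℝ) : ℝ := ‖th T (x + Complex.I * y)‖ * Real.exp (-(y ^ 2 / T))

lemma mu_nonneg (T x y : ℝ) : 0 ≤ mu T x y := by unfold mu; positivity

lemma norm_th_eq_mu (T x y : ℝ) :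
    ‖th T (x + Complex.I * y)‖ = mu T x y * Real.exp (y ^ 2 / T) := by
  rw [mu, mul_assoc, ← Real.exp_add]
  simp

lemma mu_neg (T x y : ℝ) : mu T x (-y) = mu T x y := by
  have : (x + Complex.I * (-y : ℝ) : ℂ) = (starRingEnd ℂ) (x + Complex.I * y) := by
    simp
  rw [mu, mu, this, th_conj, norm_neg, RCLike.norm_conj]
  simp

lemma mu_add {T : ℝ} (hT : 0 < T) (x y : ℝ) : mu T x (y + T) = mu T x y := by
  have : (x + Complex.I * (y + T : ℝ) : ℂ) = (x + Complex.I * y) + Complex.I * T := by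
    push_cast; ring
  rw [mu, mu, this, th_add_I_mul hT, norm_mul, norm_neg, Complex.norm_exp]
  have h1 : ((T : ℂ) - 2 * Complex.I * (x + Complex.I * y)).re = T + 2 * y := by
    simp
  rw [h1, mul_right_comm, ← Real.exp_add, mul_comm]
  congr 2
  field_simp
  ring

lemma mu_sub {T : ℝ} (hT : 0 < T) (x y : ℝ) : mu T x (T - y) = mu T x y := by
  rw [← mu_neg T x y, ← mu_add hT x (-y), neg_add_eq_sub]

/-- The normalisation removes the only factor e^{y²/T} from the prefactor of the product. In the two
products the arguments keep their modulus as y varies, and their real parts are positive multiples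
of cos(2πy/T), which decreases on [0, T/2]. -/
lemma mu_lt {T : ℝ} (hT : 0 < T) (x : ℝ) {y y' : ℝ} (h0 : 0 ≤ y) (h1 : y < y')
    (h2 : y' ≤ T / 2) : mu T x y < mu T x y' := by
  obtain ⟨C, hC, h⟩ := exists_th_eq hT
  have hT' : (T : ℂ) ≠ 0 := by exact_mod_cast hT.ne'
  have key : ∀ y : ℝ, mu T x y = ‖C‖ * Real.exp (-x ^ 2 / T + Real.pi * x / T) *
      (‖poch (dualRatio T) (Complex.exp (-(2 * Real.pi * (x + Complex.I * y) / T)))‖ *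
      ‖poch (dualRatio T)
        (dualRatio T * Complex.exp (2 * Real.pi * (x + Complex.I * y) / T))‖) := by
    intro y
    rw [mu, h, thProd, norm_mul, norm_mul, norm_mul, Complex.norm_exp]
    have e : (-(x + Complex.I * y : ℂ) ^ 2 / T + Real.pi * (x + Complex.I * y) / T).re =
        (-x ^ 2 / T + Real.pi * x / T) + y ^ 2 / T := by
      rw [show (-(x + Complex.I * y : ℂ) ^ 2 / T + Real.pi * (x + Complex.I * y) / T) =
        (((-x ^ 2 / T + Real.pi * x / T) + y ^ 2 / T : ℝ) : ℂ) +
          ((-2 * x * y / T + Real.pi * y / T : ℝ) : ℂ) * Complex.I by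
          push_cast; ring_nf; simp only [Complex.I_sq]; ring]
      simp [-Complex.ofReal_add, -Complex.ofReal_div, -Complex.ofReal_mul]
    rw [e, Real.exp_add, Real.exp_neg]
    have := Real.exp_ne_zero (y ^ 2 / T)
    field_simp
  have ex1 : ∀ y : ℝ, Complex.exp (-(2 * Real.pi * (x + Complex.I * y) / T)) =
      Complex.exp (((-(2 * Real.pi * x / T) : ℝ) : ℂ) +
        ((-(2 * Real.pi * y / T) : ℝ) : ℂ) * Complex.I) := by
    intro y; congr 1; push_cast; ring
  have ex2 : ∀ y : ℝ, Complex.exp (2 * Real.pi * (x + Complex.I * y) / T) =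
      Complex.exp ((((2 * Real.pi * x / T) : ℝ) : ℂ) +
        (((2 * Real.pi * y / T) : ℝ) : ℂ) * Complex.I) := by
    intro y; congr 1; push_cast; ring
  have hcos : Real.cos (2 * Real.pi * y' / T) < Real.cos (2 * Real.pi * y / T) := by
    have := Real.pi_pos
    apply Real.cos_lt_cos_of_nonneg_of_le_pi
    · positivity
    · rw [div_le_iff₀ hT]; nlinarith
    · gcongr
  have n1 : ∀ s y : ℝ, ‖Complex.exp ((s : ℂ) + (y : ℂ) * Complex.I)‖ = Real.exp s := by
    intro s y; rw [Complex.norm_exp]; simp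
  have r1 : ∀ s y : ℝ, (Complex.exp ((s : ℂ) + (y : ℂ) * Complex.I)).re =
      Real.exp s * Real.cos y := by
    intro s y; rw [Complex.exp_re]; simp
  have hr := dualRatio_pos T
  rw [key, key]
  have hC' : 0 < ‖C‖ * Real.exp (-x ^ 2 / T + Real.pi * x / T) := by positivity
  refine mul_lt_mul_of_pos_left ?_ hC'
  refine mul_lt_mul'' ?_ ?_ (norm_nonneg _) (norm_nonneg _)
  · apply norm_poch_lt hr (dualRatio_lt_one hT)
    · rw [ex1, ex1, n1, n1]
    · rw [ex1, ex1, r1, r1, Real.cos_neg, Real.cos_neg]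
      gcongr
  · apply norm_poch_lt hr (dualRatio_lt_one hT)
    · rw [ex2, ex2, norm_mul, norm_mul, n1, n1]
    · rw [ex2, ex2, Complex.re_ofReal_mul, Complex.re_ofReal_mul, r1, r1]
      gcongr

lemma mu_le {T : ℝ} (hT : 0 < T) (x : ℝ) {y y' : ℝ} (h0 : 0 ≤ y) (h1 : y ≤ y')
    (h2 : y' ≤ T / 2) : mu T x y ≤ mu T x y' := by
  rcases h1.eq_or_lt with rfl | h
  · rfl
  · exact (mu_lt hT x h0 h h2).le

lemma mu_lt_of_half_le {T : ℝ} (hT : 0 < T) (x : ℝ) {y y' : ℝ} (h0 : T / 2 ≤ y) (h1 : y < y')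
    (h2 : y' ≤ T) : mu T x y' < mu T x y := by
  rw [← mu_sub hT x y, ← mu_sub hT x y']
  exact mu_lt hT x (by linarith) (by linarith) (by linarith)

lemma mu_pos {T : ℝ} (hT : 0 < T) (x : ℝ) {y : ℝ} (h0 : 0 < y) (h1 : y < T) : 0 < mu T x y := by
  rcases le_total y (T / 2) with h | h
  · exact (mu_nonneg T x 0).trans_lt (mu_lt hT x le_rfl h0 h)
  · exact (mu_nonneg T x T).trans_lt (mu_lt_of_half_le hT x h h1 le_rfl)

/-! ### Products of theta functions and their addition formulas -/

lemma InLattice.sub {T : ℝ} {z w : ℂ} (hz : InLattice T z) (hw : InLattice T w) :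
    InLattice T (z - w) := by
  obtain ⟨m, n, rfl⟩ := hz
  obtain ⟨m', n', rfl⟩ := hw
  exact ⟨m - m', n - n', by push_cast; ring⟩

lemma InLattice.neg {T : ℝ} {z : ℂ} (hz : InLattice T z) : InLattice T (-z) := by
  obtain ⟨m, n, rfl⟩ := hz
  exact ⟨-m, -n, by push_cast; ring⟩

lemma eq_zero_of_inLattice_sub {T : ℝ} {F m₁ m₂ : ℂ → ℂ} (hm₁ : ∀ z, m₁ z ≠ 0)
    (hm₂ : ∀ z, m₂ z ≠ 0) (hF₁ : ∀ z, F (z + Real.pi) = m₁ z * F z)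
    (hF₂ : ∀ z, F (z + Complex.I * T) = m₂ z * F z) {z w : ℂ} (hw : F w = 0)
    (hz : InLattice T (z - w)) : F z = 0 := by
  obtain ⟨m, n, hz⟩ := hz
  obtain rfl : z = w + m * Real.pi + n * (Complex.I * T) := by linear_combination hz
  have p₁ : Function.Periodic (fun z => F z = 0) (Real.pi : ℂ) := fun z => by
    simp [hF₁, hm₁]
  have p₂ : Function.Periodic (fun z => F z = 0) (Complex.I * T) := fun z => by
    simp [hF₂, hm₂]
  have h1 := p₂.int_mul n (w + m * (Real.pi : ℂ))
  have h2 := p₁.int_mul m w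
  exact (h1.trans h2).mpr hw

/-- The product `ϑ(z + a) ϑ(z + b)`. -/
def thPair (T : ℝ) (a b z : ℂ) : ℂ := th T (z + a) * th T (z + b)

lemma differentiable_thPair {T : ℝ} (hT : 0 < T) (a b : ℂ) :
    Differentiable ℂ (thPair T a b) := by
  have h := differentiable_th hT
  unfold thPair
  exact (h.comp (differentiable_id.add_const a)).mul (h.comp (differentiable_id.add_const b))

lemma thPair_add_pi (T : ℝ) (a b z : ℂ) : thPair T a b (z + Real.pi) = thPair T a b z := by
  rw [thPair, thPair, add_right_comm, th_add_pi, add_right_comm, th_add_pi]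
  ring

lemma thPair_add_I_mul {T : ℝ} (hT : 0 < T) {a b s : ℂ} (hs : a + b = s) (z : ℂ) :
    thPair T a b (z + Complex.I * T) =
      Complex.exp (2 * T - 4 * Complex.I * z - 2 * Complex.I * s) * thPair T a b z := by
  rw [thPair, thPair, add_right_comm, th_add_I_mul hT, add_right_comm, th_add_I_mul hT]
  rw [show (2 * T - 4 * Complex.I * z - 2 * Complex.I * s) = (T - 2 * Complex.I * (z + a)) +
    (T - 2 * Complex.I * (z + b)) by rw [← hs]; ring, Complex.exp_add]
  ring

lemma thPair_mul_add_I_mul {T : ℝ} (hT : 0 < T) {a b c d s : ℂ} (hs : a + b + (c + d) = s)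
    (z : ℂ) : thPair T a b (z + Complex.I * T) * thPair T c d (z + Complex.I * T) =
      Complex.exp (4 * T - 8 * Complex.I * z - 2 * Complex.I * s) *
        (thPair T a b z * thPair T c d z) := by
  rw [thPair_add_I_mul hT rfl, thPair_add_I_mul hT rfl,
    show (4 * T - 8 * Complex.I * z - 2 * Complex.I * s) =
      (2 * T - 4 * Complex.I * z - 2 * Complex.I * (a + b)) +
      (2 * T - 4 * Complex.I * z - 2 * Complex.I * (c + d)) by rw [← hs]; ring, Complex.exp_add]
  ring

lemma deriv_mul_ne_zero {F G : ℂ → ℂ} (hF : Differentiable ℂ F) (hG : Differentiable ℂ G)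
    (hF0 : ∀ z, F z = 0 → deriv F z ≠ 0) (hG0 : ∀ z, G z = 0 → deriv G z ≠ 0)
    (hFG : ∀ z, F z = 0 → G z ≠ 0) (z : ℂ) (hz : F z * G z = 0) :
    deriv (fun w => F w * G w) z ≠ 0 := by
  rw [deriv_fun_mul (hF z) (hG z)]
  rcases mul_eq_zero.1 hz with h | h
  · rw [h, zero_mul, add_zero]
    exact mul_ne_zero (hF0 z h) (hFG z h)
  · have h' : F z ≠ 0 := fun h' => hFG z h' h
    rw [h, mul_zero, zero_add]
    exact mul_ne_zero h' (hG0 z h)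

lemma deriv_th_add_ne_zero {T : ℝ} (hT : 0 < T) (a z : ℂ) (hz : th T (z + a) = 0) :
    deriv (fun z => th T (z + a)) z ≠ 0 := by
  rw [deriv_comp_add_const]
  exact deriv_th_ne_zero hT hz

lemma th_add_ne_zero {T : ℝ} (hT : 0 < T) {a b z : ℂ} (hab : ¬ InLattice T (a - b))
    (hz : th T (z + a) = 0) : th T (z + b) ≠ 0 := fun h => hab <| by
  have := ((th_eq_zero_iff hT).1 hz).sub ((th_eq_zero_iff hT).1 h)
  rwa [add_sub_add_left_eq_sub] at this

lemma deriv_thPair_ne_zero {T : ℝ} (hT : 0 < T) {a b : ℂ} (hab : ¬ InLattice T (a - b)) (z : ℂ)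
    (hz : thPair T a b z = 0) : deriv (thPair T a b) z ≠ 0 := by
  have h := differentiable_th hT
  exact deriv_mul_ne_zero (h.comp (differentiable_id.add_const a))
    (h.comp (differentiable_id.add_const b)) (deriv_th_add_ne_zero hT a)
    (deriv_th_add_ne_zero hT b) (fun z hz => th_add_ne_zero hT hab hz) z hz

lemma thPair_ne_zero {T : ℝ} (hT : 0 < T) {a b c d z : ℂ} (hac : ¬ InLattice T (a - c))
    (had : ¬ InLattice T (a - d)) (hbc : ¬ InLattice T (b - c)) (hbd : ¬ InLattice T (b - d))
    (hz : thPair T a b z = 0) : thPair T c d z ≠ 0 := by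
  rcases mul_eq_zero.1 hz with h | h
  · exact mul_ne_zero (th_add_ne_zero hT hac h) (th_add_ne_zero hT had h)
  · exact mul_ne_zero (th_add_ne_zero hT hbc h) (th_add_ne_zero hT hbd h)

lemma inLattice_of_thPair_eq_zero {T : ℝ} (hT : 0 < T) {a b z : ℂ} (hz : thPair T a b z = 0) :
    InLattice T (z - -a) ∨ InLattice T (z - -b) := by
  rcases mul_eq_zero.1 hz with h | h
  · exact Or.inl (by simpa using (th_eq_zero_iff hT).1 h)
  · exact Or.inr (by simpa using (th_eq_zero_iff hT).1 h)

/-- The three-term relation `ϑ(z-2γ)ϑ(z+3γ) = c² ϑ(z-γ)ϑ(z+2γ) + A ϑ(z)ϑ(z+γ)`. -/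
lemma thPair_three_term {T : ℝ} (hT : 0 < T) {γ : ℂ} (h1 : ¬ InLattice T γ)
    (h2 : ¬ InLattice T (2 * γ)) (z : ℂ) :
    thPair T (-2 * γ) (3 * γ) z =
      th T (3 * γ) / th T γ * thPair T (-γ) (2 * γ) z +
        -(th T (4 * γ) / th T (2 * γ)) * thPair T 0 γ z := by
  have n1 : th T γ ≠ 0 := fun h => h1 ((th_eq_zero_iff hT).1 h)
  have n2 : th T (2 * γ) ≠ 0 := fun h => h2 ((th_eq_zero_iff hT).1 h)
  set F : ℂ → ℂ := fun z => thPair T (-2 * γ) (3 * γ) z -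
    th T (3 * γ) / th T γ * thPair T (-γ) (2 * γ) z with hF
  have hF₁ : ∀ z, F (z + Real.pi) = 1 * F z := fun z => by
    simp only [hF, thPair_add_pi, one_mul]
  have hF₂ : ∀ z, F (z + Complex.I * T) =
      Complex.exp (2 * T - 4 * Complex.I * z - 2 * Complex.I * γ) * F z := fun z => by
    simp only [hF]
    rw [thPair_add_I_mul hT (show -2 * γ + 3 * γ = γ by ring),
      thPair_add_I_mul hT (show -γ + 2 * γ = γ by ring)]
    ring
  -- The coefficient ϑ(3γ)/ϑ(γ) makes F vanish at 0 and at -γ, which up to the lattice are the zeros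
  -- of ϑ(z)ϑ(z+γ).
  have z0 : F 0 = 0 := by
    simp only [hF, thPair, zero_add, neg_mul, th_neg]
    field_simp
    ring
  have z1 : F (-γ) = 0 := by
    simp only [hF, thPair]
    rw [show -γ + -2 * γ = -(3 * γ) by ring, show -γ + 3 * γ = 2 * γ by ring,
      show -γ + -γ = -(2 * γ) by ring, show -γ + 2 * γ = γ by ring, th_neg, th_neg]
    field_simp
    ring
  obtain ⟨k, hk⟩ := exists_eq_const_mul (F := F) hT
    (((differentiable_thPair hT (-2 * γ) (3 * γ)).sub
      ((differentiable_thPair hT (-γ) (2 * γ)).const_mul _)) : Differentiable ℂ F)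
    (differentiable_thPair hT 0 γ)
    (deriv_thPair_ne_zero hT (by simpa using fun h => h1 (by simpa using InLattice.neg h)))
    (fun z hz => by
      rcases inLattice_of_thPair_eq_zero hT hz with h | h
      · exact eq_zero_of_inLattice_sub (by simp) (fun _ => Complex.exp_ne_zero _) hF₁ hF₂
          (by simpa using z0) h
      · exact eq_zero_of_inLattice_sub (by simp) (fun _ => Complex.exp_ne_zero _) hF₁ hF₂ z1 h)
    (fun _ => 1) _ (by simp) (fun _ => Complex.exp_ne_zero _) hF₁
    (fun z => by rw [thPair_add_pi, one_mul]) hF₂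
    (fun z => thPair_add_I_mul hT (by ring) z)
  -- At z = γ the term with ϑ(z-γ) disappears, which isolates the constant.
  have hk' : k = -(th T (4 * γ) / th T (2 * γ)) := by
    have := hk γ
    simp only [hF, thPair] at this
    rw [show γ + -2 * γ = -γ by ring, show γ + 3 * γ = 4 * γ by ring, add_neg_cancel, th_zero,
      add_zero, show γ + γ = 2 * γ by ring, th_neg] at this
    rw [← neg_div, eq_div_iff n2]
    apply mul_right_cancel₀ n1
    linear_combination -this
  rw [← hk']
  linear_combination hk z

lemma deriv_th_neg (T : ℝ) (z : ℂ) : deriv (th T) (-z) = deriv (th T) z := by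
  have h1 : deriv (fun w => th T (-w)) z = -deriv (th T) (-z) := deriv_comp_neg ..
  rw [show (fun w => th T (-w)) = fun w => -th T w from funext (th_neg T), deriv.fun_neg] at h1
  linear_combination h1

/-- The value of `1/t`, times `c`, in terms of theta constants. -/
def thConst (T : ℝ) (γ : ℂ) : ℂ :=
  4 * (deriv (th T) γ * th T (2 * γ) / (deriv (th T) 0 * th T γ)) -
    2 * (deriv (th T) (2 * γ) / deriv (th T) 0)

/-- In every product the four shifts add up to 2γ, so all multipliers agree. The left side vanishes
at 0 and γ, and its invariance under z ↦ -γ-z gives the zeros -γ and -2γ; modulo the lattice these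
are the zeros of the right side, all simple. The identity is what the mixed coefficient of the
kernel requires. -/
lemma thPair_four_term {T : ℝ} (hT : 0 < T) {γ : ℂ} (h1 : ¬ InLattice T γ)
    (h2 : ¬ InLattice T (2 * γ)) (h3 : ¬ InLattice T (3 * γ)) (z : ℂ) :
    th T (3 * γ) / th T γ * (thPair T 0 γ z * thPair T 0 γ z) +
      thPair T (-γ) (2 * γ) z * thPair T (-γ) (2 * γ) z +
      thPair T 0 (3 * γ) z * thPair T 0 (-γ) z +
      thPair T γ (-2 * γ) z * thPair T γ (2 * γ) z =
      thConst T γ * (thPair T 0 γ z * thPair T (-γ) (2 * γ) z) := by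
  have n1 : th T γ ≠ 0 := fun h => h1 ((th_eq_zero_iff hT).1 h)
  have n2 : th T (2 * γ) ≠ 0 := fun h => h2 ((th_eq_zero_iff hT).1 h)
  have n0 : deriv (th T) 0 ≠ 0 := deriv_th_ne_zero hT (th_zero T)
  set F : ℂ → ℂ := fun z => th T (3 * γ) / th T γ * (thPair T 0 γ z * thPair T 0 γ z) +
      thPair T (-γ) (2 * γ) z * thPair T (-γ) (2 * γ) z +
      thPair T 0 (3 * γ) z * thPair T 0 (-γ) z +
      thPair T γ (-2 * γ) z * thPair T γ (2 * γ) z with hF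
  set G : ℂ → ℂ := fun z => thPair T 0 γ z * thPair T (-γ) (2 * γ) z with hG
  have hFd : Differentiable ℂ F := by
    have := fun a b => differentiable_thPair hT a b
    simp only [hF]
    fun_prop (disch := assumption)
  have hF₁ : ∀ z, F (z + Real.pi) = 1 * F z := fun z => by
    simp only [hF, thPair_add_pi, one_mul]
  have hF₂ : ∀ z, F (z + Complex.I * T) =
      Complex.exp (4 * T - 8 * Complex.I * z - 2 * Complex.I * (2 * γ)) * F z := fun z => by
    simp only [hF]
    rw [thPair_mul_add_I_mul hT (show 0 + γ + (0 + γ) = 2 * γ by ring),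
      thPair_mul_add_I_mul hT (show -γ + 2 * γ + (-γ + 2 * γ) = 2 * γ by ring),
      thPair_mul_add_I_mul hT (show 0 + 3 * γ + (0 + -γ) = 2 * γ by ring),
      thPair_mul_add_I_mul hT (show γ + -2 * γ + (γ + 2 * γ) = 2 * γ by ring)]
    ring
  have hrefl : ∀ z, F (-γ - z) = F z := fun z => by
    have key : ∀ a b : ℂ, thPair T a b (-γ - z) = thPair T (γ - a) (γ - b) z := fun a b => by
      rw [thPair, thPair, show -γ - z + a = -(z + (γ - a)) by ring,
        show -γ - z + b = -(z + (γ - b)) by ring, th_neg, th_neg]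
      ring
    simp only [hF, key]
    simp only [thPair]
    ring_nf
  have z0 : F 0 = 0 := by
    simp only [hF, thPair, zero_add, th_zero, neg_mul, th_neg]
    ring
  have z1 : F γ = 0 := by
    simp only [hF, thPair]
    rw [add_neg_cancel, th_zero, add_zero, show γ + -2 * γ = -γ by ring, th_neg,
      show γ + γ = 2 * γ by ring, show γ + 2 * γ = 3 * γ by ring]
    field_simp
    ring
  have sub' : ∀ w : ℂ, ¬ InLattice T w → ¬ InLattice T (-w) := fun w hw h =>
    hw (by simpa using h.neg)
  obtain ⟨k, hk⟩ := exists_eq_const_mul (G := G) hT hFd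
    (((differentiable_thPair hT 0 γ).mul (differentiable_thPair hT (-γ) (2 * γ))) :
      Differentiable ℂ G)
    (deriv_mul_ne_zero (differentiable_thPair hT 0 γ) (differentiable_thPair hT (-γ) (2 * γ))
      (deriv_thPair_ne_zero hT (by simpa using sub' _ h1))
      (deriv_thPair_ne_zero hT (by
        rw [show -γ - 2 * γ = -(3 * γ) by ring]; exact sub' _ h3))
      (fun z hz => thPair_ne_zero hT (by simpa using h1) (by simpa using sub' _ h2)
        (by rwa [sub_neg_eq_add, ← two_mul])
        (by rw [show γ - 2 * γ = -γ by ring]; exact sub' _ h1) hz))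
    (fun z hz => by
      have main := fun w (hw : F w = 0) (h : InLattice T (z - w)) => eq_zero_of_inLattice_sub
        (m₁ := fun _ => 1) (by simp) (fun _ => Complex.exp_ne_zero _) hF₁ hF₂ hw h
      rcases mul_eq_zero.1 hz with hz | hz <;>
        rcases inLattice_of_thPair_eq_zero hT hz with h | h
      · exact main _ (by simpa using z0) h
      · exact main _ (by rw [← hrefl]; simpa using z0) h
      · exact main _ (by simpa using z1) h
      · exact main _ (by rw [← hrefl, show -γ - -(2 * γ) = γ by ring]; exact z1) h)
    (fun _ => 1) _ (by simp) (fun _ => Complex.exp_ne_zero _) hF₁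
    (fun z => by simp only [hG, thPair_add_pi, one_mul]) hF₂
    (fun z => thPair_mul_add_I_mul hT (by ring) z)
  -- Both sides vanish at 0, so the constant is read off from their derivatives there.
  have hd : ∀ a : ℂ, HasDerivAt (fun z => th T (z + a)) (deriv (th T) a) 0 := fun a => by
    have := (differentiable_th hT (0 + a)).hasDerivAt.comp_add_const 0 a
    simpa using this
  have hp : ∀ a b : ℂ, HasDerivAt (thPair T a b)
      (deriv (th T) a * th T b + th T a * deriv (th T) b) 0 := fun a b => by
    simpa [thPair] using! (hd a).fun_mul (hd b)
  have hv : ∀ a b : ℂ, thPair T a b 0 = th T a * th T b := fun a b => by simp [thPair]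
  have dF := ((((((hp 0 γ).fun_mul (hp 0 γ)).const_mul (th T (3 * γ) / th T γ)).fun_add
    ((hp (-γ) (2 * γ)).fun_mul (hp (-γ) (2 * γ)))).fun_add
    ((hp 0 (3 * γ)).fun_mul (hp 0 (-γ)))).fun_add
    ((hp γ (-2 * γ)).fun_mul (hp γ (2 * γ))) : HasDerivAt F _ 0)
  have dG := ((hp 0 γ).fun_mul (hp (-γ) (2 * γ))).const_mul k
  have heq := dF.unique ((show F = fun z => k * G z from funext hk) ▸ dG)
  have hk' : k = thConst T γ := by
    rw [thConst]
    simp only [hv, th_zero, th_neg, neg_mul, deriv_th_neg] at heq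
    field_simp
    have n3 : th T γ * th T (2 * γ) ≠ 0 := mul_ne_zero n1 n2
    apply mul_right_cancel₀ n3
    linear_combination heq
  rw [← hk']
  exact hk z

/-! ### Values on the imaginary axis and the conditions on the parameters -/

lemma th_I_mul_im (T y : ℝ) : (th T (Complex.I * y)).im = 0 := by
  have h := th_conj T (Complex.I * y)
  rw [map_mul, Complex.conj_I, Complex.conj_ofReal, neg_mul, th_neg, neg_inj] at h
  exact Complex.conj_eq_iff_im.1 h.symm

/-- The real values of the theta function on the imaginary axis. -/
def sig (T y : ℝ) : ℝ := (th T (Complex.I * y)).re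

lemma th_I_mul (T y : ℝ) : th T (Complex.I * y) = sig T y :=
  Complex.ext (by simp [sig]) (by simp [th_I_mul_im])

lemma abs_sig (T y : ℝ) : |sig T y| = mu T 0 y * Real.exp (y ^ 2 / T) := by
  rw [← norm_th_eq_mu, Complex.ofReal_zero, zero_add, th_I_mul, Complex.norm_real,
    Real.norm_eq_abs]

lemma sig_ne_zero {T : ℝ} (hT : 0 < T) {y : ℝ} (h0 : 0 < y) (h1 : y < T) : sig T y ≠ 0 := by
  rw [← abs_pos, abs_sig]
  have := mu_pos hT 0 h0 h1
  positivity

lemma not_inLattice_I_mul {T : ℝ} (hT : 0 < T) {y : ℝ} (h0 : 0 < y) (h1 : y < T) :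
    ¬ InLattice T (Complex.I * y) := by
  rw [← th_eq_zero_iff hT, th_I_mul]
  exact_mod_cast sig_ne_zero hT h0 h1

lemma sig_add {T : ℝ} (hT : 0 < T) (y : ℝ) :
    sig T (y + T) = -Real.exp (T + 2 * y) * sig T y := by
  have h := th_add_I_mul hT (Complex.I * y)
  rw [← mul_add, ← Complex.ofReal_add, th_I_mul, th_I_mul,
    show (T - 2 * Complex.I * (Complex.I * y) : ℂ) = ((T + 2 * y : ℝ) : ℂ) by
      push_cast; ring_nf; simp only [Complex.I_sq]; ring] at h
  exact_mod_cast h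

lemma continuous_sig {T : ℝ} (hT : 0 < T) : Continuous (sig T) := by
  have := (differentiable_th hT).continuous
  unfold sig
  fun_prop

lemma sig_mul_pos {T : ℝ} (hT : 0 < T) {y y' : ℝ} (h0 : 0 < y) (h1 : y < T) (h0' : 0 < y')
    (h1' : y' < T) : 0 < sig T y * sig T y' := by
  by_contra h
  have hneg : sig T y * sig T y' < 0 :=
    lt_of_le_of_ne (not_lt.1 h) (mul_ne_zero (sig_ne_zero hT h0 h1) (sig_ne_zero hT h0' h1'))
  have h2 := intermediate_value_uIcc (continuous_sig hT).continuousOn (a := y) (b := y')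
  have h3 : (0 : ℝ) ∈ Set.uIcc (sig T y) (sig T y') := by
    rw [Set.mem_uIcc]
    rcases mul_neg_iff.1 hneg with h | h
    · exact Or.inr ⟨h.2.le, h.1.le⟩
    · exact Or.inl ⟨h.1.le, h.2.le⟩
  obtain ⟨w, hw, hw0⟩ := h2 h3
  have hw' := Set.mem_Icc.1 hw
  exact sig_ne_zero hT (lt_of_lt_of_le (lt_min h0 h0') hw'.1)
    (lt_of_le_of_lt hw'.2 (max_lt h1 h1')) hw0

/-- The parameters `T = Im (π τ)`, `g = Im γ` and `c` fit the weight `a`. -/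
structure Fits (a T g c : ℝ) : Prop where
  a_pos : 0 < a
  T_pos : 0 < T
  lt_g : T / 4 < g
  g_lt : g < T / 3
  c_pos : 0 < c
  c_sq : (c : ℂ) ^ 2 = th T (3 * (Complex.I * g)) / th T (Complex.I * g)
  a_mul : (a : ℂ) * (c : ℂ) ^ 3 =
    -(th T (4 * (Complex.I * g)) / th T (2 * (Complex.I * g)))

/-- The factor by which `‖X‖` differs from a quotient of values of `mu`. -/
def kap (T g : ℝ) : ℝ := Real.sqrt (mu T 0 (3 * g) / mu T 0 g)

lemma kap_pos {T g : ℝ} (hT : 0 < T) (h1 : T / 4 < g) (h2 : g < T / 3) : 0 < kap T g := by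
  have := mu_pos hT 0 (y := 3 * g) (by linarith) (by linarith)
  have := mu_pos hT 0 (y := g) (by linarith) (by linarith)
  exact Real.sqrt_pos.2 (by positivity)

/-- Squaring the equation for ac³ and cubing the one for c² eliminates c. The Gaussian weights
cancel too, since 2·4² + 3·1² = 3·3² + 2·2², so the condition can be stated with `mu`. The range of
g fixes the signs: 3g lies below T, and 4g lies between T and 2T, where ϑ has the opposite sign on
the imaginary axis. -/
lemma exists_fits {a T g : ℝ} (ha : 0 < a) (hT : 0 < T) (h1 : T / 4 < g) (h2 : g < T / 3)
    (h : mu T 0 (4 * g) ^ 2 * mu T 0 g ^ 3 = a ^ 2 * (mu T 0 (3 * g) ^ 3 * mu T 0 (2 * g) ^ 2)) :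
    Fits a T g (kap T g * Real.exp (4 * g ^ 2 / T)) := by
  have m1 := mu_pos hT 0 (y := g) (by linarith) (by linarith)
  have m2 := mu_pos hT 0 (y := 2 * g) (by linarith) (by linarith)
  have m3 := mu_pos hT 0 (y := 3 * g) (by linarith) (by linarith)
  have k := kap_pos hT h1 h2
  have m4 : 0 < mu T 0 (4 * g) := by
    rw [show 4 * g = (4 * g - T) + T by ring, mu_add hT]
    exact mu_pos hT 0 (by linarith) (by linarith)
  have hquot : ∀ y y' : ℝ, 0 < sig T y * sig T y' → sig T y / sig T y' =
      mu T 0 y / mu T 0 y' * Real.exp ((y ^ 2 - y' ^ 2) / T) := by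
    intro y y' hp
    have h3 : 0 < sig T y / sig T y' := by
      rcases mul_pos_iff.1 hp with h | h
      · exact div_pos h.1 h.2
      · exact div_pos_of_neg_of_neg h.1 h.2
    rw [← abs_of_pos h3, abs_div, abs_sig, abs_sig, sub_div, Real.exp_sub]
    field_simp
  have c_sq : (kap T g * Real.exp (4 * g ^ 2 / T)) ^ 2 = sig T (3 * g) / sig T g := by
    rw [hquot _ _ (sig_mul_pos hT (by linarith) (by linarith) (by linarith) (by linarith)),
      mul_pow, kap, Real.sq_sqrt (by positivity), ← Real.exp_nat_mul]
    congr 2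
    push_cast
    ring
  refine ⟨ha, hT, h1, h2, by positivity, ?_, ?_⟩
  · rw [show (3 * (Complex.I * g) : ℂ) = Complex.I * (3 * g : ℝ) by push_cast; ring, th_I_mul,
      th_I_mul]
    exact_mod_cast c_sq
  · rw [show (4 * (Complex.I * g) : ℂ) = Complex.I * (4 * g : ℝ) by push_cast; ring,
      show (2 * (Complex.I * g) : ℂ) = Complex.I * (2 * g : ℝ) by push_cast; ring, th_I_mul,
      th_I_mul]
    have hs : -(sig T (4 * g) / sig T (2 * g)) =
        mu T 0 (4 * g) / mu T 0 (2 * g) * Real.exp ((12 * g ^ 2) / T) := by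
      have h5 := sig_add hT (4 * g - T)
      rw [sub_add_cancel] at h5
      have h3 : 0 < -(sig T (4 * g) / sig T (2 * g)) := by
        have h4 := sig_mul_pos hT (y := 4 * g - T) (y' := 2 * g) (by linarith) (by linarith)
          (by linarith) (by linarith)
        have h6 : 0 < sig T (4 * g - T) / sig T (2 * g) := by
          rcases mul_pos_iff.1 h4 with h | h
          · exact div_pos h.1 h.2
          · exact div_pos_of_neg_of_neg h.1 h.2
        rw [h5, neg_mul, neg_div, neg_neg, mul_div_assoc]
        positivity
      rw [← abs_of_pos h3, abs_neg, abs_div, abs_sig, abs_sig,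
        show 12 * g ^ 2 / T = (4 * g) ^ 2 / T - (2 * g) ^ 2 / T by ring, Real.exp_sub]
      field_simp
    have main : a * (kap T g * Real.exp (4 * g ^ 2 / T)) ^ 3 =
        -(sig T (4 * g) / sig T (2 * g)) := by
      rw [hs, mul_pow, ← Real.exp_nat_mul,
        show ((3 : ℕ) : ℝ) * (4 * g ^ 2 / T) = 12 * g ^ 2 / T by push_cast; ring, ← mul_assoc]
      congr 1
      have hk2 : kap T g ^ 2 = mu T 0 (3 * g) / mu T 0 g := Real.sq_sqrt (by positivity)
      refine (sq_eq_sq₀ (by positivity) (by positivity)).1 ?_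
      rw [mul_pow, ← pow_mul, show 3 * 2 = 2 * 3 by norm_num, pow_mul, hk2, div_pow, div_pow,
        mul_div_assoc', div_eq_div_iff (by positivity) (by positivity)]
      linear_combination -h
    exact_mod_cast main

/-! ### Factorisation of the kernel -/

section
variable {a T g c : ℝ}

/-- The numerator of `X`. -/
def numX (T g c : ℝ) (z : ℂ) : ℂ := c * thPair T 0 (Complex.I * g) z

/-- The denominator of `X`. -/
def denX (T g : ℝ) (z : ℂ) : ℂ := thPair T (-(Complex.I * g)) (2 * (Complex.I * g)) z

lemma Fits.g_pos (h : Fits a T g c) : 0 < g := by linarith [h.T_pos, h.lt_g]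

lemma Fits.not_inLattice (h : Fits a T g c) : ¬ InLattice T (Complex.I * g) :=
  not_inLattice_I_mul h.T_pos h.g_pos (by linarith [h.T_pos, h.g_lt])

lemma Fits.not_inLattice_two (h : Fits a T g c) : ¬ InLattice T (2 * (Complex.I * g)) := by
  rw [show (2 * (Complex.I * g) : ℂ) = Complex.I * (2 * g : ℝ) by push_cast; ring]
  exact not_inLattice_I_mul h.T_pos (by linarith [h.g_pos]) (by linarith [h.T_pos, h.g_lt])

lemma Fits.not_inLattice_three (h : Fits a T g c) : ¬ InLattice T (3 * (Complex.I * g)) := by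
  rw [show (3 * (Complex.I * g) : ℂ) = Complex.I * (3 * g : ℝ) by push_cast; ring]
  exact not_inLattice_I_mul h.T_pos (by linarith [h.g_pos]) (by linarith [h.T_pos, h.g_lt])

lemma denX_ne_zero_of_numX_eq_zero (h : Fits a T g c) {z : ℂ} (hz : numX T g c z = 0) :
    denX T g z ≠ 0 := by
  have hc : (c : ℂ) ≠ 0 := by exact_mod_cast h.c_pos.ne'
  have hn : ∀ w, ¬ InLattice T w → ¬ InLattice T (-w) := fun w hw h' =>
    hw (by simpa using h'.neg)
  refine thPair_ne_zero h.T_pos ?_ ?_ ?_ ?_ ((mul_eq_zero.1 hz).resolve_left hc)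
  · simpa using h.not_inLattice
  · simpa using hn _ h.not_inLattice_two
  · rw [sub_neg_eq_add, ← two_mul]; exact h.not_inLattice_two
  · rw [show Complex.I * g - 2 * (Complex.I * g) = -(Complex.I * g) by ring]
    exact hn _ h.not_inLattice

/-- The kernel, as a quadratic form in `(y₀, y₁)` over the point `X(z)`, splits into linear
factors that vanish at `Y(z) = X(-z)` and at `Y(-γ - z) = X(z + γ)`. -/
lemma Fits.kernel_factor (h : Fits a T g c) (z y₀ y₁ : ℂ) :
    thConst T (Complex.I * g) * (numX T g c z * denX T g z * y₀ * y₁) -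
      c * (numX T g c z ^ 2 * y₀ * y₁ + numX T g c z * denX T g z * y₀ ^ 2 +
        denX T g z ^ 2 * y₀ * y₁ + numX T g c z * denX T g z * y₁ ^ 2 +
        a * numX T g c z ^ 2 * y₀ ^ 2) =
    -((y₀ * denX T g (-z) - y₁ * numX T g c (-z)) *
      (y₀ * denX T g (z + Complex.I * g) - y₁ * numX T g c (z + Complex.I * g))) := by
  have e3 := thPair_three_term h.T_pos h.not_inLattice h.not_inLattice_two z
  have e4 := thPair_four_term h.T_pos h.not_inLattice h.not_inLattice_two
    h.not_inLattice_three z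
  rw [← h.c_sq, ← h.a_mul] at e3
  rw [← h.c_sq] at e4
  have n1 : numX T g c (-z) = c * (th T z * th T (z + -(Complex.I * g))) := by
    rw [numX, thPair, show -z + Complex.I * g = -(z + -(Complex.I * g)) by ring, add_zero,
      th_neg, th_neg]
    ring
  have n2 : denX T g (-z) =
      th T (z + Complex.I * g) * th T (z + -2 * (Complex.I * g)) := by
    rw [denX, thPair, show -z + -(Complex.I * g) = -(z + Complex.I * g) by ring,
      show -z + 2 * (Complex.I * g) = -(z + -2 * (Complex.I * g)) by ring, th_neg, th_neg]
    ring
  have n3 : numX T g c (z + Complex.I * g) =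
      c * (th T (z + Complex.I * g) * th T (z + 2 * (Complex.I * g))) := by
    rw [numX, thPair, add_zero, show z + Complex.I * g + Complex.I * g =
      z + 2 * (Complex.I * g) by ring]
  have n4 : denX T g (z + Complex.I * g) = th T z * th T (z + 3 * (Complex.I * g)) := by
    rw [denX, thPair, add_neg_cancel_right, show z + Complex.I * g + 2 * (Complex.I * g) =
      z + 3 * (Complex.I * g) by ring]
  rw [n1, n2, n3, n4, numX, denX]
  simp only [thPair, add_zero] at e3 e4 ⊢
  -- The coefficient of y₀² is the three-term relation and that of y₀y₁ the four-term relation; the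
  -- coefficients of y₁² agree identically.
  linear_combination (y₀ ^ 2 * th T z * th T (z + Complex.I * g)) * e3 - c * y₀ * y₁ * e4

/-- Where X(z) = Y(z) = x, one factor of the kernel vanishes at the point (x, x). What remains is
1/t = S(x,x) multiplied by c, with `thConst` in the role of c/t. -/
lemma Fits.eval_diagonal (h : Fits a T g c) {z x : ℂ} (hx : x ≠ 0)
    (hz : numX T g c z = x * denX T g z) (hz' : numX T g c (-z) = x * denX T g (-z)) :
    thConst T (Complex.I * g) = c * (2 * x + 2 / x + a * x ^ 2) := by
  have hd : denX T g z ≠ 0 := fun h0 => denX_ne_zero_of_numX_eq_zero h (by rw [hz, h0, mul_zero]) h0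
  have hf := h.kernel_factor z (numX T g c z) (denX T g z)
  have h0 : numX T g c z * denX T g (-z) - denX T g z * numX T g c (-z) = 0 := by
    rw [hz, hz']; ring
  rw [h0, zero_mul, neg_zero, hz] at hf
  have hd4 : x ^ 2 * denX T g z ^ 4 ≠ 0 := by positivity
  apply mul_right_cancel₀ hd4
  rw [div_eq_mul_inv]
  linear_combination hf - 2 * c * x * denX T g z ^ 4 * mul_inv_cancel₀ hx

end

/-! ### Continuous dependence on parameters -/

lemma continuousAt_mu {T : ℝ} (hT : 0 < T) (x y : ℝ) :
    ContinuousAt (fun p : ℝ × ℝ × ℝ => mu p.1 p.2.1 p.2.2) (T, x, y) := by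
  unfold mu
  refine ContinuousAt.mul (ContinuousAt.norm ?_) ?_
  · exact (continuousAt_th hT (x + Complex.I * y)).comp
      (f := fun p : ℝ × ℝ × ℝ => (p.1, (p.2.1 + Complex.I * p.2.2 : ℂ))) (x := (T, x, y))
      (by fun_prop)
  · exact Real.continuous_exp.continuousAt.comp
      ((ContinuousAt.div (by fun_prop) (by fun_prop) hT.ne').neg)

lemma continuousAt_mu_comp {X : Type*} [TopologicalSpace X] {f g h : X → ℝ} {p : X}
    (hf : ContinuousAt f p) (hg : ContinuousAt g p) (hh : ContinuousAt h p) (h0 : 0 < f p) :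
    ContinuousAt (fun q => mu (f q) (g q) (h q)) p :=
  (continuousAt_mu h0 (g p) (h p)).comp (f := fun q => (f q, g q, h q)) (x := p)
    (hf.prodMk (hg.prodMk hh))

/-- The zeros of a continuous family of strictly increasing functions depend continuously on the
parameter. -/
lemma exists_continuous_zero {X : Type*} [TopologicalSpace X] (F : X → ℝ → ℝ) {p q : ℝ}
    (hpq : p < q) (h₁ : ∀ y, Continuous fun x => F x y) (h₂ : ∀ x, Continuous (F x))
    (hp : ∀ x, F x p < 0) (hq : ∀ x, 0 < F x q) (hm : ∀ x, StrictMonoOn (F x) (Set.Icc p q)) :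
    ∃ η : X → ℝ, Continuous η ∧ ∀ x, η x ∈ Set.Ioo p q ∧ F x (η x) = 0 := by
  have hex : ∀ x, ∃ y ∈ Set.Ioo p q, F x y = 0 := fun x => by
    obtain ⟨y, hy, h0⟩ := intermediate_value_Ioo hpq.le (h₂ x).continuousOn
      (show (0 : ℝ) ∈ Set.Ioo (F x p) (F x q) from ⟨hp x, hq x⟩)
    exact ⟨y, hy, h0⟩
  choose η hη h0 using hex
  refine ⟨η, continuous_iff_continuousAt.2 fun x => ?_, fun x => ⟨hη x, h0 x⟩⟩
  have hIcc : ∀ x, η x ∈ Set.Icc p q := fun x => Set.Ioo_subset_Icc_self (hη x)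
  refine tendsto_order.2 ⟨fun l hl => ?_, fun u hu => ?_⟩
  -- The test value is moved into [p, q], since monotonicity is known only there.
  · have hl' : max l p ∈ Set.Icc p q := ⟨le_max_right _ _, max_le (hl.le.trans (hη x).2.le) hpq.le⟩
    have hneg : F x (max l p) < 0 := by
      rw [← h0 x]
      exact hm x hl' (hIcc x) (max_lt hl (hη x).1)
    filter_upwards [(h₁ (max l p)).continuousAt.eventually_lt_const hneg] with w hw
    by_contra hcon
    have := (hm w).monotoneOn (hIcc w) hl' ((not_lt.1 hcon).trans (le_max_left _ _))
    rw [h0 w] at this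
    linarith
  · have hu' : min u q ∈ Set.Icc p q := ⟨le_min ((hη x).1.le.trans hu.le) hpq.le, min_le_right _ _⟩
    have hpos : 0 < F x (min u q) := by
      rw [← h0 x]
      exact hm x (hIcc x) hu' (lt_min hu (hη x).2)
    filter_upwards [(h₁ (min u q)).continuousAt.eventually_const_lt hpos] with w hw
    by_contra hcon
    have := (hm w).monotoneOn hu' (hIcc w) ((min_le_left _ _).trans (not_lt.1 hcon))
    rw [h0 w] at this
    linarith

/-! ### The two points where X = Y on the line Re z = π/2 -/

section
variable {a T g c : ℝ}

lemma Fits.c_eq (h : Fits a T g c) : c = kap T g * Real.exp (4 * g ^ 2 / T) := by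
  have h1 : c ^ 2 = sig T (3 * g) / sig T g := by
    have := h.c_sq
    rw [show (3 * (Complex.I * g) : ℂ) = Complex.I * (3 * g : ℝ) by push_cast; ring, th_I_mul,
      th_I_mul] at this
    exact_mod_cast this
  have hT := h.T_pos
  have m1 := mu_pos hT 0 (y := g) (by linarith [h.lt_g]) (by linarith [h.g_lt])
  have hk0 := kap_pos hT h.lt_g h.g_lt
  refine (sq_eq_sq₀ h.c_pos.le (mul_nonneg hk0.le (Real.exp_pos _).le)).1 ?_
  have hk : kap T g ^ 2 = mu T 0 (3 * g) / mu T 0 g :=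
    Real.sq_sqrt (div_nonneg (mu_nonneg _ _ _) (mu_nonneg _ _ _))
  rw [← abs_of_nonneg (sq_nonneg c), h1, abs_div, abs_sig, abs_sig, mul_pow (kap T g), hk,
    ← Real.exp_nat_mul,
    show (((2 : ℕ) : ℝ)) * (4 * g ^ 2 / T) = (3 * g) ^ 2 / T - g ^ 2 / T by push_cast; ring,
    Real.exp_sub]
  field_simp

lemma mu_pi_div_two_pos (hT : 0 < T) (y : ℝ) : 0 < mu T (Real.pi / 2) y := by
  have h := th_pi_div_two_im_pos hT y
  unfold mu
  have : th T ((Real.pi / 2 : ℝ) + Complex.I * y) ≠ 0 := fun h0 => by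
    push_cast at h0
    rw [h0] at h
    simp at h
  positivity

lemma th_pi_div_two (hT : 0 < T) (y : ℝ) : th T (Real.pi / 2 + Complex.I * y) =
    Complex.I * (mu T (Real.pi / 2) y * Real.exp (y ^ 2 / T) : ℝ) := by
  have h := th_pi_div_two_im_pos hT y
  have h' := (hasSum_th_pi_div_two hT y).2
  have e : th T (Real.pi / 2 + Complex.I * y) =
      Complex.I * ((th T (Real.pi / 2 + Complex.I * y)).im : ℂ) :=
    Complex.ext (by simp [h']) (by simp)
  have e2 := norm_th_eq_mu T (Real.pi / 2) y
  push_cast at e2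
  rw [← e2, e, norm_mul, Complex.norm_I, one_mul, Complex.norm_real, Real.norm_of_nonneg h.le]

lemma numX_add_pi (z : ℂ) : numX T g c (z + Real.pi) = numX T g c z := by
  rw [numX, thPair_add_pi, numX]

lemma denX_add_pi (z : ℂ) : denX T g (z + Real.pi) = denX T g z := by
  rw [denX, thPair_add_pi, denX]

lemma numX_add_I_mul (hT : 0 < T) (z : ℂ) : numX T g c (z + Complex.I * T) =
    Complex.exp (2 * T - 4 * Complex.I * z - 2 * Complex.I * (Complex.I * g)) * numX T g c z := by
  rw [numX, thPair_add_I_mul hT (zero_add _), numX]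
  ring

lemma denX_add_I_mul (hT : 0 < T) (z : ℂ) : denX T g (z + Complex.I * T) =
    Complex.exp (2 * T - 4 * Complex.I * z - 2 * Complex.I * (Complex.I * g)) * denX T g z := by
  rw [denX, thPair_add_I_mul hT (show -(Complex.I * g) + 2 * (Complex.I * g) = Complex.I * g by
    ring), denX]

/-- The value of `X` at `π / 2`. -/
def lowX (T g : ℝ) : ℝ := kap T g * mu T (Real.pi / 2) 0 / mu T (Real.pi / 2) (2 * g)

/-- The value of `X` at `π / 2 + I T / 2`. -/
def highX (T g : ℝ) : ℝ :=
  kap T g * mu T (Real.pi / 2) (T / 2) / mu T (Real.pi / 2) (2 * g - T / 2)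

/-- The step polynomial on the diagonal. -/
def diag (a x : ℝ) : ℝ := 2 * x + 2 / x + a * x ^ 2

/-- On this line every ϑ is i times a positive number, so X is positive. The exponents balance
because 4g² + y² + (y+g)² = (y-g)² + (y+2g)². -/
lemma Fits.numX_pi_div_two (h : Fits a T g c) (y : ℝ) :
    numX T g c (Real.pi / 2 + Complex.I * y) =
      ((kap T g * (mu T (Real.pi / 2) y * mu T (Real.pi / 2) (y + g)) /
        (mu T (Real.pi / 2) (y - g) * mu T (Real.pi / 2) (y + 2 * g)) : ℝ) : ℂ) *
        denX T g (Real.pi / 2 + Complex.I * y) := by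
  have hT := h.T_pos
  have p1 := mu_pi_div_two_pos hT (y - g)
  have p2 := mu_pi_div_two_pos hT (y + 2 * g)
  rw [numX, denX, thPair, thPair, add_zero,
    show (Real.pi / 2 + Complex.I * y + Complex.I * g : ℂ) =
      Real.pi / 2 + Complex.I * (y + g : ℝ) by push_cast; ring,
    show (Real.pi / 2 + Complex.I * y + -(Complex.I * g) : ℂ) =
      Real.pi / 2 + Complex.I * (y - g : ℝ) by push_cast; ring,
    show (Real.pi / 2 + Complex.I * y + 2 * (Complex.I * g) : ℂ) =
      Real.pi / 2 + Complex.I * (y + 2 * g : ℝ) by push_cast; ring,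
    th_pi_div_two hT, th_pi_div_two hT, th_pi_div_two hT, th_pi_div_two hT]
  have hre : c * ((mu T (Real.pi / 2) y * Real.exp (y ^ 2 / T)) *
      (mu T (Real.pi / 2) (y + g) * Real.exp ((y + g) ^ 2 / T))) =
      kap T g * (mu T (Real.pi / 2) y * mu T (Real.pi / 2) (y + g)) /
        (mu T (Real.pi / 2) (y - g) * mu T (Real.pi / 2) (y + 2 * g)) *
      ((mu T (Real.pi / 2) (y - g) * Real.exp ((y - g) ^ 2 / T)) *
      (mu T (Real.pi / 2) (y + 2 * g) * Real.exp ((y + 2 * g) ^ 2 / T))) := by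
    have e : Real.exp (4 * g ^ 2 / T) * (Real.exp (y ^ 2 / T) * Real.exp ((y + g) ^ 2 / T)) =
        Real.exp ((y - g) ^ 2 / T) * Real.exp ((y + 2 * g) ^ 2 / T) := by
      rw [← Real.exp_add, ← Real.exp_add, ← Real.exp_add]
      congr 1; ring
    rw [h.c_eq, div_mul_eq_mul_div, eq_div_iff (by positivity)]
    linear_combination (kap T g * (mu T (Real.pi / 2) y * mu T (Real.pi / 2) (y + g)) *
      (mu T (Real.pi / 2) (y - g) * mu T (Real.pi / 2) (y + 2 * g))) * e
  have hre' := congrArg (fun r : ℝ => (r : ℂ)) hre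
  simp only [Complex.ofReal_mul] at hre' ⊢
  linear_combination (Complex.I ^ 2) * hre'

lemma Fits.lowX_pos (h : Fits a T g c) : 0 < lowX T g := by
  have := kap_pos h.T_pos h.lt_g h.g_lt
  have := mu_pi_div_two_pos h.T_pos
  exact div_pos (mul_pos ‹_› (this _)) (this _)

lemma Fits.highX_pos (h : Fits a T g c) : 0 < highX T g := by
  have := kap_pos h.T_pos h.lt_g h.g_lt
  have := mu_pi_div_two_pos h.T_pos
  exact div_pos (mul_pos ‹_› (this _)) (this _)

lemma Fits.numX_low (h : Fits a T g c) :
    numX T g c (Real.pi / 2) = lowX T g * denX T g (Real.pi / 2) := by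
  have h1 := h.numX_pi_div_two 0
  have := (mu_pi_div_two_pos h.T_pos g).ne'
  rw [show kap T g * (mu T (Real.pi / 2) 0 * mu T (Real.pi / 2) (0 + g)) /
        (mu T (Real.pi / 2) (0 - g) * mu T (Real.pi / 2) (0 + 2 * g)) = lowX T g by
      rw [zero_sub, zero_add, zero_add, mu_neg, lowX, ← mul_assoc,
        mul_comm (mu T (Real.pi / 2) g) (mu T (Real.pi / 2) (2 * g)), mul_div_mul_right _ _ this]]
    at h1
  simpa using h1

lemma Fits.numX_high (h : Fits a T g c) :
    numX T g c (Real.pi / 2 + Complex.I * (T / 2)) =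
      highX T g * denX T g (Real.pi / 2 + Complex.I * (T / 2)) := by
  have h1 := h.numX_pi_div_two (T / 2)
  have := (mu_pi_div_two_pos h.T_pos (T / 2 + g)).ne'
  rw [show kap T g * (mu T (Real.pi / 2) (T / 2) * mu T (Real.pi / 2) (T / 2 + g)) /
        (mu T (Real.pi / 2) (T / 2 - g) * mu T (Real.pi / 2) (T / 2 + 2 * g)) = highX T g by
      rw [← mu_sub h.T_pos _ (T / 2 - g), ← mu_sub h.T_pos _ (T / 2 + 2 * g), ← mu_neg,
        show T - (T / 2 - g) = T / 2 + g by ring,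
        show T - (T / 2 + 2 * g) = -(2 * g - T / 2) by ring, mu_neg, mu_neg,
        mul_comm (mu T (Real.pi / 2) (T / 2 + g)), highX, ← mul_assoc,
        mul_div_mul_right _ _ this]]
    at h1
  push_cast at h1
  exact h1

/-- The points π/2 and -π/2 differ by a period, so X and Y agree at π/2. -/
lemma Fits.thConst_low (h : Fits a T g c) :
    thConst T (Complex.I * g) = (c * diag a (lowX T g) : ℝ) := by
  have hx : (lowX T g : ℂ) ≠ 0 := by exact_mod_cast h.lowX_pos.ne'
  have h1 := h.eval_diagonal hx h.numX_low (by
    rw [← numX_add_pi, ← denX_add_pi, show -(Real.pi / 2 : ℂ) + Real.pi = Real.pi / 2 by ring]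
    exact h.numX_low)
  rw [h1, diag]
  push_cast
  ring

lemma Fits.thConst_high (h : Fits a T g c) :
    thConst T (Complex.I * g) = (c * diag a (highX T g) : ℝ) := by
  have hx : (highX T g : ℂ) ≠ 0 := by exact_mod_cast h.highX_pos.ne'
  have h1 := h.eval_diagonal hx h.numX_high (by
    have h2 := h.numX_high
    -- This point differs from its negative by π + iT, so X and Y agree here as well.
    rw [show (Real.pi / 2 + Complex.I * (T / 2) : ℂ) =
      -(Real.pi / 2 + Complex.I * (T / 2)) + Real.pi + Complex.I * T by ring,
      numX_add_I_mul h.T_pos, denX_add_I_mul h.T_pos, numX_add_pi, denX_add_pi] at h2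
    apply mul_left_cancel₀ (Complex.exp_ne_zero _)
    rw [h2]
    ring)
  rw [h1, diag]
  push_cast
  ring

lemma Fits.diag_eq (h : Fits a T g c) : diag a (lowX T g) = diag a (highX T g) := by
  have h1 := h.thConst_low.symm.trans h.thConst_high
  exact mul_left_cancel₀ h.c_pos.ne' (by exact_mod_cast h1)

/-- On the line Re z = π/2 the function `mu` is smallest at height 0 and largest at T/2, which
places `kap` strictly between the two values. -/
lemma Fits.lowX_lt_highX (h : Fits a T g c) : lowX T g < highX T g := by
  have hT := h.T_pos
  have k := kap_pos hT h.lt_g h.g_lt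
  have p := mu_pi_div_two_pos hT
  have h1 : mu T (Real.pi / 2) 0 < mu T (Real.pi / 2) (2 * g) := by
    rw [← mu_sub hT _ (2 * g)]
    exact mu_lt hT _ le_rfl (by linarith [h.g_lt]) (by linarith [h.lt_g])
  have h2 : mu T (Real.pi / 2) (2 * g - T / 2) < mu T (Real.pi / 2) (T / 2) :=
    mu_lt hT _ (by linarith [h.lt_g]) (by linarith [h.g_lt]) le_rfl
  calc lowX T g < kap T g := by
        rw [lowX, div_lt_iff₀ (p _)]
        gcongr
    _ < highX T g := by
        rw [highX, lt_div_iff₀ (p _)]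
        gcongr

end

/-! ### Estimates for small and for large T -/

lemma mu_pi_div_two_hasSum {T : ℝ} (hT : 0 < T) (y : ℝ) : HasSum (fun n : ℕ =>
    Real.exp (-T * ((n : ℝ) + 1 / 2) ^ 2) *
      (Real.exp ((2 * n + 1) * y) + Real.exp (-((2 * n + 1) * y))) * Real.exp (-(y ^ 2 / T)))
    (mu T (Real.pi / 2) y) := by
  have h := (hasSum_th_pi_div_two hT y).1.mul_right (Real.exp (-(y ^ 2 / T)))
  have e : (th T (Real.pi / 2 + Complex.I * y)).im * Real.exp (-(y ^ 2 / T)) =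
      mu T (Real.pi / 2) y := by
    rw [th_pi_div_two hT, Complex.I_mul_im, Complex.ofReal_re, mul_assoc, ← Real.exp_add]
    simp
  rwa [e] at h

lemma mu_pi_div_two_zero_hasSum {T : ℝ} (hT : 0 < T) :
    HasSum (fun n : ℕ => 2 * Real.exp (-T * ((n : ℝ) + 1 / 2) ^ 2)) (mu T (Real.pi / 2) 0) := by
  refine (mu_pi_div_two_hasSum hT 0).congr_fun fun n => ?_
  simp only [mul_zero, neg_zero, Real.exp_zero, zero_pow two_ne_zero, zero_div]
  ring

/-- With the squares completed, the series at height T/2 has the terms e^{-Tn²} + e^{-T(n+1)²}. Each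
exceeds the term 2e^{-T(n+1/2)²} at height 0 by at most e^{-Tn²} - e^{-T(n+1)²}, and these
differences telescope to 1. -/
lemma mu_half_le {T : ℝ} (hT : 0 < T) :
    mu T (Real.pi / 2) (T / 2) ≤ mu T (Real.pi / 2) 0 + 1 := by
  have h1 := mu_pi_div_two_hasSum hT (T / 2)
  have h2 := mu_pi_div_two_zero_hasSum hT
  have h3 : HasSum (fun n : ℕ => Real.exp (-T * (n : ℝ) ^ 2) -
      Real.exp (-T * ((n + 1 : ℕ) : ℝ) ^ 2)) 1 := by
    have hlim : Filter.Tendsto (fun n : ℕ => Real.exp (-T * (n : ℝ) ^ 2)) Filter.atTop (𝓝 0) := by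
      refine Real.tendsto_exp_atBot.comp ?_
      refine Filter.Tendsto.const_mul_atTop_of_neg (by linarith) ?_
      exact (Filter.tendsto_pow_atTop two_ne_zero).comp tendsto_natCast_atTop_atTop
    rw [hasSum_iff_tendsto_nat_of_nonneg]
    · simp_rw [Finset.sum_range_sub']
      simpa using hlim.const_sub 1
    · intro n
      rw [sub_nonneg, Real.exp_le_exp]
      push_cast
      have : (0 : ℝ) ≤ n := n.cast_nonneg
      nlinarith
  refine hasSum_le (fun n => ?_) h1 (h2.add h3)
  have hn : (0 : ℝ) ≤ n := n.cast_nonneg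
  have e1 : Real.exp (-T * ((n : ℝ) + 1 / 2) ^ 2) *
      (Real.exp ((2 * n + 1) * (T / 2)) + Real.exp (-((2 * n + 1) * (T / 2)))) *
      Real.exp (-((T / 2) ^ 2 / T)) =
      Real.exp (-T * (n : ℝ) ^ 2) + Real.exp (-T * ((n + 1 : ℕ) : ℝ) ^ 2) := by
    rw [mul_add, add_mul, ← Real.exp_add, ← Real.exp_add, ← Real.exp_add, ← Real.exp_add]
    congr 2
    · field_simp; ring
    · push_cast; field_simp; ring
  have e2 : Real.exp (-T * ((n + 1 : ℕ) : ℝ) ^ 2) ≤ Real.exp (-T * ((n : ℝ) + 1 / 2) ^ 2) := by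
    rw [Real.exp_le_exp]
    push_cast
    nlinarith
  rw [e1]
  linarith

/-- For T = 1/N² the first N terms of the series at height 0 are at least 1/2 each, so the additive
error 1 of `mu_half_le` becomes relatively small. -/
lemma exists_mu_half_le {ε : ℝ} (hε : 0 < ε) : ∃ T : ℝ, 0 < T ∧
    mu T (Real.pi / 2) (T / 2) ≤ (1 + ε) * mu T (Real.pi / 2) 0 := by
  obtain ⟨N, hN⟩ := exists_nat_gt (max (2 / ε) 1)
  have hN1 : (1 : ℝ) < N := (le_max_right _ _).trans_lt hN
  have hN2 : 2 / ε < N := (le_max_left _ _).trans_lt hN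
  have hN0 : (0 : ℝ) < N := by linarith
  refine ⟨1 / (N : ℝ) ^ 2, by positivity, ?_⟩
  set T : ℝ := 1 / (N : ℝ) ^ 2 with hTdef
  have hT : 0 < T := by positivity
  have h1 := mu_half_le hT
  have h2 := mu_pi_div_two_zero_hasSum hT
  have h3 : (N : ℝ) / 2 ≤ mu T (Real.pi / 2) 0 := by
    have h4 := sum_le_hasSum (Finset.range N) (fun n _ => by positivity) h2
    refine le_trans ?_ h4
    have h5 : ∀ n ∈ Finset.range N, (1 / 2 : ℝ) ≤ 2 * Real.exp (-T * ((n : ℝ) + 1 / 2) ^ 2) := by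
      intro n hn
      have hn' : ((n : ℝ) + 1) ≤ N := by exact_mod_cast Finset.mem_range.1 hn
      have hn0 : (0 : ℝ) ≤ n := n.cast_nonneg
      have h6 : -1 ≤ -T * ((n : ℝ) + 1 / 2) ^ 2 := by
        rw [hTdef, neg_mul, neg_le_neg_iff, one_div_mul_eq_div, div_le_one (by positivity)]
        gcongr
        linarith
      have h7 := Real.exp_le_exp.2 h6
      have h8 : (1 / 4 : ℝ) ≤ Real.exp (-1) := by
        rw [Real.exp_neg, one_div]
        gcongr
        linarith [Real.exp_one_lt_d9]
      linarith
    have := Finset.card_nsmul_le_sum _ _ _ h5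
    simp only [Finset.card_range, nsmul_eq_mul] at this
    linarith
  have h4 : 1 ≤ ε * mu T (Real.pi / 2) 0 := by
    rw [div_lt_iff₀ hε] at hN2
    nlinarith
  linarith

/-- The term n = 0 alone contributes e^{-T/4 + 2T/9} at height T/3, while at height 0 a geometric
series of ratio 1/2 bounds the whole sum by 4e^{-T/4}. -/
lemma le_mu_third {T : ℝ} (hT : 1 ≤ T) :
    Real.exp (2 * T / 9) / 4 * mu T (Real.pi / 2) 0 ≤ mu T (Real.pi / 2) (T / 3) := by
  have hT0 : 0 < T := by linarith
  have h1 := mu_pi_div_two_hasSum hT0 (T / 3)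
  have h2 := mu_pi_div_two_zero_hasSum hT0
  have h3 : mu T (Real.pi / 2) 0 ≤ 4 * Real.exp (-T / 4) := by
    have hg := (hasSum_geometric_of_lt_one (r := 1 / 2) (by norm_num) (by norm_num)).mul_left
      (2 * Real.exp (-T / 4))
    refine (hasSum_le (fun n => ?_) h2 hg).trans (by norm_num; linarith)
    have hn : (0 : ℝ) ≤ n := n.cast_nonneg
    have e : Real.exp (-T * ((n : ℝ) + 1 / 2) ^ 2) ≤ Real.exp (-T / 4) * Real.exp (-1) ^ n := by
      rw [← Real.exp_nat_mul, ← Real.exp_add, Real.exp_le_exp]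
      nlinarith [mul_nonneg hn (sub_nonneg.2 hT), mul_nonneg (mul_nonneg hn hn) hT0.le]
    have e2 : Real.exp (-1) ^ n ≤ (1 / 2 : ℝ) ^ n := by
      gcongr
      rw [Real.exp_neg, one_div]
      gcongr
      linarith [Real.exp_one_gt_d9]
    have e3 := mul_le_mul_of_nonneg_left e2 (Real.exp_pos (-T / 4)).le
    linarith
  have h4 : Real.exp (-T / 4) * Real.exp (2 * T / 9) ≤ mu T (Real.pi / 2) (T / 3) := by
    refine le_trans ?_ (le_hasSum h1 0 fun n _ => by positivity)
    simp only [Nat.cast_zero, mul_zero, zero_add]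
    rw [mul_add, add_mul, ← Real.exp_add, ← Real.exp_add, ← Real.exp_add]
    rw [show -T * (1 / 2) ^ 2 + 1 * (T / 3) + -((T / 3) ^ 2 / T) = -T / 4 + 2 * T / 9 by
      field_simp; ring]
    exact le_add_of_nonneg_right (by positivity)
  have := mul_le_mul_of_nonneg_left h3 (Real.exp_pos (2 * T / 9)).le
  linarith

/-! ### The step polynomial on the positive diagonal -/

/-- The left side is a cubic in x with the roots x₁ and x₂, and comparing coefficients gives the
third factor; `hv` is the comparison of constant terms. -/
lemma mul_diag_sub {a x₁ x₂ x : ℝ} (h₁ : 0 < x₁) (h₂ : x₁ < x₂) (hx : 0 < x)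
    (h : diag a x₁ = diag a x₂) :
    x * (diag a x - diag a x₁) = (x - x₁) * (x - x₂) * (a * x + 2 + a * (x₁ + x₂)) := by
  have h₃ : 0 < x₂ := h₁.trans h₂
  have hv : x₁ * x₂ * (2 + a * (x₁ + x₂)) = 2 := by
    unfold diag at h
    field_simp at h
    have h4 : x₂ - x₁ ≠ 0 := by linarith
    apply mul_left_cancel₀ h4
    linear_combination -h
  have hE : diag a x₁ * x₁ = 2 * x₁ ^ 2 + 2 + a * x₁ ^ 3 := by
    unfold diag; field_simp
  have hX : x * diag a x = 2 * x ^ 2 + 2 + a * x ^ 3 := by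
    unfold diag; field_simp
  apply mul_left_cancel₀ h₁.ne'
  linear_combination x₁ * hX - x * hE + (x - x₁) * hv

/-- For x > 0 the third factor of `mul_diag_sub` is positive, so the sign is that of (x - x₁)(x -
x₂). -/
lemma mem_Ioo_of_diag_lt {a x₁ x₂ x : ℝ} (ha : 0 < a) (h₁ : 0 < x₁) (h₂ : x₁ < x₂) (hx : 0 < x)
    (h : diag a x₁ = diag a x₂) (hlt : diag a x < diag a x₁) : x₁ < x ∧ x < x₂ := by
  have h3 := mul_diag_sub h₁ h₂ hx h
  have h4 : (x - x₁) * (x - x₂) * (a * x + 2 + a * (x₁ + x₂)) < 0 := by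
    rw [← h3]; exact mul_neg_of_pos_of_neg hx (by linarith)
  have h5 : 0 < a * x + 2 + a * (x₁ + x₂) := by
    have : 0 < x₂ := h₁.trans h₂
    positivity
  have h6 : (x - x₁) * (x - x₂) < 0 := by
    by_contra hc
    exact absurd (mul_nonneg (not_lt.1 hc) h5.le) (not_le.2 h4)
  constructor <;> nlinarith

/-- The value at 1 is a + 4. This is the only way in which t < 1/(a+4) enters the estimates on |X|.
-/
lemma exists_diag_lt {a E : ℝ} (hE : a + 4 < E) :
    ∃ δ : ℝ, 0 < δ ∧ δ < 1 ∧ ∀ x, 1 - δ ≤ x → x ≤ 1 + δ → diag a x < E := by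
  have hc : ContinuousAt (diag a) 1 := by
    unfold diag
    exact ContinuousAt.add (ContinuousAt.add (by fun_prop)
      (ContinuousAt.div (by fun_prop) (by fun_prop) one_ne_zero)) (by fun_prop)
  have h1 : diag a 1 < E := by unfold diag; linarith
  obtain ⟨ε, hε, h⟩ := Metric.eventually_nhds_iff.1 (hc.eventually_lt_const h1)
  refine ⟨min (ε / 2) (1 / 2), by positivity, (min_le_right _ _).trans_lt (by norm_num),
    fun x hx hx' => h ?_⟩
  rw [Real.dist_eq, abs_lt]
  have := min_le_left (ε / 2) (1 / 2)
  constructor <;> linarith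

section
variable {a T g c : ℝ}

/-- Both values of X are within a factor 1 + ε of `kap`, since the values of `mu` that occur lie
between those at heights 0 and T/2. -/
lemma Fits.highX_le (h : Fits a T g c) {ε : ℝ}
    (hε : mu T (Real.pi / 2) (T / 2) ≤ (1 + ε) * mu T (Real.pi / 2) 0) :
    highX T g ≤ (1 + ε) ^ 2 * lowX T g := by
  have hT := h.T_pos
  have k := kap_pos hT h.lt_g h.g_lt
  have p := mu_pi_div_two_pos hT
  have e0 : 0 < 1 + ε := pos_of_mul_pos_left ((p _).trans_le hε) (p _).le
  have h1 : mu T (Real.pi / 2) (2 * g) ≤ mu T (Real.pi / 2) (T / 2) := by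
    rw [← mu_sub hT _ (2 * g)]
    exact mu_le hT _ (by linarith [h.g_lt]) (by linarith [h.lt_g]) le_rfl
  have h2 : mu T (Real.pi / 2) 0 ≤ mu T (Real.pi / 2) (2 * g - T / 2) :=
    mu_le hT _ le_rfl (by linarith [h.lt_g]) (by linarith [h.g_lt])
  have h3 : highX T g ≤ (1 + ε) * kap T g := by
    rw [highX, div_le_iff₀ (p _)]
    calc _ ≤ kap T g * ((1 + ε) * mu T (Real.pi / 2) 0) := by gcongr
      _ ≤ kap T g * ((1 + ε) * mu T (Real.pi / 2) (2 * g - T / 2)) := by gcongr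
      _ = _ := by ring
  have h4 : kap T g ≤ (1 + ε) * lowX T g := by
    rw [lowX, mul_div_assoc', le_div_iff₀ (p _)]
    calc _ ≤ kap T g * ((1 + ε) * mu T (Real.pi / 2) 0) := by gcongr; exact h1.trans hε
      _ = _ := by ring
  calc _ ≤ (1 + ε) * kap T g := h3
    _ ≤ (1 + ε) * ((1 + ε) * lowX T g) := by gcongr
    _ = _ := by ring

/-- `kap` is at most `highX`, and `lowX` is much smaller than `kap`: T - 2g lies between T/3 and
T/2, so the denominator of `lowX` is at least the value of `mu` at T/3. -/
lemma Fits.le_highX (h : Fits a T g c) (h1 : 1 ≤ T) :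
    Real.exp (2 * T / 9) / 4 * lowX T g ≤ highX T g := by
  have hT := h.T_pos
  have k := kap_pos hT h.lt_g h.g_lt
  have p := mu_pi_div_two_pos hT
  have h2 : mu T (Real.pi / 2) (2 * g - T / 2) ≤ mu T (Real.pi / 2) (T / 2) :=
    mu_le hT _ (by linarith [h.lt_g]) (by linarith [h.g_lt]) le_rfl
  have h3 : kap T g ≤ highX T g := by
    rw [highX, le_div_iff₀ (p _)]
    gcongr
  refine le_trans ?_ h3
  have h4 : mu T (Real.pi / 2) (T / 3) ≤ mu T (Real.pi / 2) (2 * g) := by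
    rw [← mu_sub hT _ (2 * g)]
    exact mu_le hT _ (by linarith) (by linarith [h.g_lt]) (by linarith [h.lt_g])
  rw [lowX, mul_div_assoc', div_le_iff₀ (p _)]
  calc _ = kap T g * (Real.exp (2 * T / 9) / 4 * mu T (Real.pi / 2) 0) := by ring
    _ ≤ _ := by
      gcongr
      exact (le_mu_third h1).trans h4

end

/-! ### Choice of the parameters -/

/-- Vanishes where the ratio `ρ` of the two parameters fits the weight `a`. -/
def fitGap (a T ρ : ℝ) : ℝ := mu T 0 (4 * (ρ * T)) ^ 2 * mu T 0 (ρ * T) ^ 3 -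
  a ^ 2 * (mu T 0 (3 * (ρ * T)) ^ 3 * mu T 0 (2 * (ρ * T)) ^ 2)

lemma mu_zero_zero (T : ℝ) : mu T 0 0 = 0 := by simp [mu, th_zero]

/-- As ρ runs from 1/4 to 1/3, ρ and 4ρ - 1 stay in the half period where `mu` increases, 2ρ and 3ρ
in the half where it decreases. -/
lemma fitGap_strictMonoOn {a T : ℝ} (ha : 0 < a) (hT : 0 < T) :
    StrictMonoOn (fitGap a T) (Set.Icc (1 / 4) (1 / 3)) := by
  intro r hr s hs hrs
  have hr1 := hr.1
  have hs2 := hs.2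
  have e : ∀ u : ℝ, mu T 0 (4 * (u * T)) = mu T 0 ((4 * u - 1) * T) := fun u => by
    rw [show 4 * (u * T) = (4 * u - 1) * T + T by ring, mu_add hT]
  have m4 : mu T 0 (4 * (r * T)) < mu T 0 (4 * (s * T)) := by
    rw [e, e]
    exact mu_lt hT 0 (mul_nonneg (by linarith) hT.le) (by gcongr) (by nlinarith)
  have m1 : mu T 0 (r * T) < mu T 0 (s * T) :=
    mu_lt hT 0 (mul_nonneg (by linarith) hT.le) (by gcongr) (by nlinarith)
  have m3 : mu T 0 (3 * (s * T)) < mu T 0 (3 * (r * T)) :=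
    mu_lt_of_half_le hT 0 (by nlinarith) (by gcongr) (by nlinarith)
  have m2 : mu T 0 (2 * (s * T)) < mu T 0 (2 * (r * T)) :=
    mu_lt_of_half_le hT 0 (by nlinarith) (by gcongr) (by nlinarith)
  have n := mu_nonneg T 0
  have h1 : mu T 0 (4 * (r * T)) ^ 2 * mu T 0 (r * T) ^ 3 <
      mu T 0 (4 * (s * T)) ^ 2 * mu T 0 (s * T) ^ 3 :=
    mul_lt_mul'' (pow_lt_pow_left₀ m4 (n _) two_ne_zero) (pow_lt_pow_left₀ m1 (n _) three_ne_zero)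
      (pow_nonneg (n _) _) (pow_nonneg (n _) _)
  have h2 : a ^ 2 * (mu T 0 (3 * (s * T)) ^ 3 * mu T 0 (2 * (s * T)) ^ 2) ≤
      a ^ 2 * (mu T 0 (3 * (r * T)) ^ 3 * mu T 0 (2 * (r * T)) ^ 2) := by
    have := n (3 * (s * T))
    have := n (2 * (s * T))
    have := n (3 * (r * T))
    gcongr
  unfold fitGap
  linarith

/-- The parameters can be chosen to fit any weight `a > 0` and any `t < 1 / (a + 4)`. -/
lemma exists_fits_thConst {a E : ℝ} (ha : 0 < a) (hE : a + 4 < E) :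
    ∃ T g c : ℝ, Fits a T g c ∧ thConst T (Complex.I * g) = (c * E : ℝ) ∧
      diag a (lowX T g) = E := by
  -- The sign change: at ρ = 1/4 the factor at height 4ρT = T vanishes, and at ρ = 1/3 the factor at
  -- height 3ρT = T.
  obtain ⟨r, hrc, hr⟩ := exists_continuous_zero (X := Set.Ioi (0 : ℝ))
    (fun T ρ => fitGap a T ρ) (p := 1 / 4) (q := 1 / 3) (by norm_num)
    (fun ρ => continuous_iff_continuousAt.2 fun T => by
      have h : ∀ k : ℝ, ContinuousAt (fun T : Set.Ioi (0 : ℝ) => mu T 0 (k * (ρ * T))) T :=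
        fun k => continuousAt_mu_comp (by fun_prop) (by fun_prop) (by fun_prop) T.2
      have h1 : ContinuousAt (fun T : Set.Ioi (0 : ℝ) => mu T 0 (ρ * T)) T :=
        continuousAt_mu_comp (by fun_prop) (by fun_prop) (by fun_prop) T.2
      exact (((h 4).pow 2).mul (h1.pow 3)).sub
        (continuousAt_const.mul (((h 3).pow 3).mul ((h 2).pow 2))))
    (fun T => continuous_iff_continuousAt.2 fun ρ => by
      have h : ∀ k : ℝ, ContinuousAt (fun ρ : ℝ => mu T 0 (k * (ρ * T))) ρ :=
        fun k => continuousAt_mu_comp (by fun_prop) (by fun_prop) (by fun_prop) T.2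
      have h1 : ContinuousAt (fun ρ : ℝ => mu T 0 (ρ * T)) ρ :=
        continuousAt_mu_comp (by fun_prop) (by fun_prop) (by fun_prop) T.2
      exact (((h 4).pow 2).mul (h1.pow 3)).sub
        (continuousAt_const.mul (((h 3).pow 3).mul ((h 2).pow 2))))
    (fun T => by
      have hT : (0 : ℝ) < T := T.2
      have h3 := mu_pos hT 0 (y := 3 * (1 / 4 * T)) (by linarith) (by linarith)
      have h2 := mu_pos hT 0 (y := 2 * (1 / 4 * T)) (by linarith) (by linarith)
      have h4 : mu T 0 (4 * (1 / 4 * T)) = 0 := by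
        rw [show 4 * (1 / 4 * (T : ℝ)) = 0 + T by ring, mu_add hT, mu_zero_zero]
      simp only [fitGap, h4]
      have : 0 < a ^ 2 * (mu T 0 (3 * (1 / 4 * T)) ^ 3 * mu T 0 (2 * (1 / 4 * T)) ^ 2) := by
        positivity
      linarith)
    (fun T => by
      have hT : (0 : ℝ) < T := T.2
      have h1 := mu_pos hT 0 (y := 1 / 3 * T) (by linarith) (by linarith)
      have h4 : 0 < mu T 0 (4 * (1 / 3 * T)) := by
        rw [show 4 * (1 / 3 * (T : ℝ)) = T / 3 + T by ring, mu_add hT]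
        exact mu_pos hT 0 (by linarith) (by linarith)
      have h3 : mu T 0 (3 * (1 / 3 * T)) = 0 := by
        rw [show 3 * (1 / 3 * (T : ℝ)) = 0 + T by ring, mu_add hT, mu_zero_zero]
      simp only [fitGap, h3]
      have : 0 < mu T 0 (4 * (1 / 3 * T)) ^ 2 * mu T 0 (1 / 3 * T) ^ 3 := by positivity
      linarith)
    (fun T => fitGap_strictMonoOn ha T.2)
  have hfit : ∀ T : Set.Ioi (0 : ℝ), Fits a T (r T * T)
      (kap T (r T * T) * Real.exp (4 * (r T * T) ^ 2 / T)) := fun T => by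
    have hT : (0 : ℝ) < T := T.2
    have h1 := (hr T).1.1
    have h2 := (hr T).1.2
    refine exists_fits ha hT (by nlinarith) (by nlinarith) ?_
    have := (hr T).2
    unfold fitGap at this
    linarith
  have hcont : Continuous fun T : Set.Ioi (0 : ℝ) => diag a (lowX T (r T * T)) := by
    refine continuous_iff_continuousAt.2 fun T => ?_
    have hT : (0 : ℝ) < T := T.2
    have hrT := hrc.continuousAt (x := T)
    have hf := hfit T
    have h : ∀ x k : ℝ, ContinuousAt (fun T : Set.Ioi (0 : ℝ) => mu T x (k * (r T * T))) T :=
      fun x k => continuousAt_mu_comp (by fun_prop) (by fun_prop) (by fun_prop) T.2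
    have h1 : ContinuousAt (fun T : Set.Ioi (0 : ℝ) => mu T 0 (r T * T)) T := by
      simpa using h 0 1
    have h0 : ContinuousAt (fun T : Set.Ioi (0 : ℝ) => mu T (Real.pi / 2) 0) T := by
      simpa using h (Real.pi / 2) 0
    have m1 := mu_pos hT 0 hf.g_pos (by linarith [hf.g_lt])
    have hk : ContinuousAt (fun T : Set.Ioi (0 : ℝ) => kap T (r T * T)) T :=
      ((h 0 3).div h1 m1.ne').sqrt
    have hl : ContinuousAt (fun T : Set.Ioi (0 : ℝ) => lowX T (r T * T)) T :=
      (hk.mul h0).div (h (Real.pi / 2) 2) (mu_pi_div_two_pos hT _).ne'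
    exact ((continuousAt_const.mul hl).add (continuousAt_const.div hl hf.lowX_pos.ne')).add
      (continuousAt_const.mul (hl.pow 2))
  -- Otherwise `lowX` < 1 - δ and 1 + δ < `highX` for every T. A ratio of at most (1 + δ/2)²
  -- contradicts this, because (1 + δ/2)²(1 - δ) ≤ 1.
  have hlow : ∃ T : Set.Ioi (0 : ℝ), diag a (lowX T (r T * T)) ≤ E := by
    by_contra! hcon
    obtain ⟨δ, hδ, hδ1, hδE⟩ := exists_diag_lt hE
    obtain ⟨T, hT, hTε⟩ := exists_mu_half_le (ε := δ / 2) (by positivity)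
    have hf := hfit ⟨T, hT⟩
    have hc := hcon ⟨T, hT⟩
    have h1 := mem_Ioo_of_diag_lt ha hf.lowX_pos hf.lowX_lt_highX (x := 1 - δ) (by linarith)
      hf.diag_eq ((hδE _ le_rfl (by linarith)).trans hc)
    have h2 := mem_Ioo_of_diag_lt ha hf.lowX_pos hf.lowX_lt_highX (x := 1 + δ) (by linarith)
      hf.diag_eq ((hδE _ (by linarith) le_rfl).trans hc)
    have h3 := hf.highX_le hTε
    have h4 : (1 + δ / 2) ^ 2 * lowX T (r ⟨T, hT⟩ * T) ≤ (1 + δ / 2) ^ 2 * (1 - δ) := by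
      gcongr
      exact h1.1.le
    have h5 := h2.2
    simp only at h3 h5
    have h6 : (1 + δ / 2) ^ 2 * (1 - δ) ≤ 1 := by nlinarith [sq_nonneg δ, pow_pos hδ 3]
    linarith
  -- Otherwise 2/E < `lowX` and `highX` < E/2 for every T, which keeps the ratio below E²/4.
  have hhigh : ∃ T : Set.Ioi (0 : ℝ), E ≤ diag a (lowX T (r T * T)) := by
    by_contra! hcon
    have hE0 : 0 < E := by linarith
    -- With this T one has exp(2T/9) ≥ E² + 1, so the ratio is at least (E² + 1)/4.
    set T : ℝ := 1 + 9 / 2 * E ^ 2 with hTdef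
    have hT : 0 < T := by positivity
    have hT1 : 1 ≤ T := by rw [hTdef]; nlinarith [sq_nonneg E]
    have hf := hfit ⟨T, hT⟩
    have hc := hcon ⟨T, hT⟩
    have hc' := hf.diag_eq ▸ hc
    have h3 := hf.le_highX hT1
    have hl := hf.lowX_pos
    have hh := hf.highX_pos
    simp only [diag] at hc hc' h3 hl hh
    set x := lowX T (r ⟨T, hT⟩ * T)
    set y := highX T (r ⟨T, hT⟩ * T)
    have h4 : 2 / x < E := by
      have : 0 < a * x ^ 2 := by positivity
      linarith
    have h5 : 2 * y < E := by
      have : 0 < a * y ^ 2 := by positivity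
      have : 0 < 2 / y := by positivity
      linarith
    rw [div_lt_iff₀ hl] at h4
    have h6 : E ^ 2 + 1 ≤ Real.exp (2 * T / 9) := by
      refine le_trans ?_ (Real.add_one_le_exp _)
      rw [hTdef]
      linarith
    have h7 : (E ^ 2 + 1) / 4 * x ≤ y := le_trans (by gcongr) h3
    nlinarith
  have hpc : PreconnectedSpace (Set.Ioi (0 : ℝ)) :=
    Subtype.preconnectedSpace isPreconnected_Ioi
  obtain ⟨T, hT⟩ := mem_range_of_exists_le_of_exists_ge hcont hlow hhigh
  exact ⟨T, r T * T, _, hfit T, by rw [(hfit T).thConst_low]; simp only at hT; rw [hT], hT⟩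

/-! ### Quotients as maps to the Riemann sphere -/

/-- The point of `ℂ ∪ {∞}` with homogeneous coordinates `[n : d]`. -/
def toP (n d : ℂ) : OnePoint ℂ :=
  open Classical in if d = 0 then OnePoint.infty else ((n / d : ℂ) : OnePoint ℂ)

lemma toP_of_eq {n d : ℂ} (h : d = 0) : toP n d = OnePoint.infty := if_pos h

lemma toP_of_ne {n d : ℂ} (h : d ≠ 0) : toP n d = ((n / d : ℂ) : OnePoint ℂ) := if_neg h

lemma toP_mul {k : ℂ} (hk : k ≠ 0) (n d : ℂ) : toP (k * n) (k * d) = toP n d := by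
  by_cases h : d = 0
  · rw [toP_of_eq h, toP_of_eq (by rw [h, mul_zero])]
  · rw [toP_of_ne h, toP_of_ne (mul_ne_zero hk h), mul_div_mul_left _ _ hk]

lemma toP_eq_infty_iff {n d : ℂ} : toP n d = OnePoint.infty ↔ d = 0 := by
  by_cases h : d = 0
  · exact ⟨fun _ => h, fun h => toP_of_eq h⟩
  · simp [toP_of_ne h, h]

lemma finPart_toP (n d : ℂ) : finPart (toP n d) = n / d := by
  by_cases h : d = 0
  · rw [toP_of_eq h, h, div_zero]; rfl
  · rw [toP_of_ne h]; rfl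

lemma homCoord_infty : homCoord OnePoint.infty = (1, 0) := rfl

lemma homCoord_coe (x : ℂ) : homCoord (x : OnePoint ℂ) = (x, 1) := rfl

lemma exists_homCoord_toP {n d : ℂ} (h : n = 0 → d ≠ 0) : ∃ k : ℂ, k ≠ 0 ∧
    n = k * (homCoord (toP n d)).1 ∧ d = k * (homCoord (toP n d)).2 := by
  by_cases hd : d = 0
  · refine ⟨n, fun hn => h hn hd, ?_, ?_⟩ <;> rw [toP_of_eq hd, homCoord_infty] <;> simp [hd]
  · refine ⟨d, hd, ?_, ?_⟩ <;> simp [toP_of_ne hd, homCoord_coe, mul_div_cancel₀ _ hd]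

lemma eq_toP {p : OnePoint ℂ} {n d : ℂ} (h : n = 0 → d ≠ 0)
    (hp : (homCoord p).1 * d = (homCoord p).2 * n) : p = toP n d := by
  induction p using OnePoint.rec with
  | infty =>
    rw [homCoord_infty] at hp
    exact (toP_of_eq (by simpa using hp)).symm
  | coe x =>
    rw [homCoord_coe] at hp
    simp only [one_mul] at hp
    have hd : d ≠ 0 := fun hd => h (by rw [← hp, hd, mul_zero]) hd
    rw [toP_of_ne hd, ← hp, mul_div_cancel_right₀ _ hd]

lemma kernelForm_mul (a t k l x₀ x₁ y₀ y₁ : ℂ) :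
    kernelForm a t (k * x₀) (k * x₁) (l * y₀) (l * y₁) =
      k ^ 2 * l ^ 2 * kernelForm a t x₀ x₁ y₀ y₁ := by
  unfold kernelForm
  ring

lemma kernelExt_toP_eq_zero_iff {a t n d : ℂ} {q : OnePoint ℂ} (h : n = 0 → d ≠ 0) :
    kernelExt a t (toP n d) q = 0 ↔
      kernelForm a t n d (homCoord q).1 (homCoord q).2 = 0 := by
  obtain ⟨k, hk, h1, h2⟩ := exists_homCoord_toP h
  have := kernelForm_mul a t k 1 (homCoord (toP n d)).1 (homCoord (toP n d)).2
    (homCoord q).1 (homCoord q).2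
  rw [one_mul, one_mul, ← h1, ← h2] at this
  rw [kernelExt, this]
  simp [hk]

/-- At a zero of d the numerator is nonzero, so for every R the inequality R|d| < |n| persists
nearby; this is convergence to ∞. -/
lemma continuous_toP {n d : ℂ → ℂ} (hn : Continuous n) (hd : Continuous d)
    (h : ∀ z, n z = 0 → d z ≠ 0) : Continuous fun z => toP (n z) (d z) := by
  refine continuous_iff_continuousAt.2 fun z => ?_
  by_cases hz : d z = 0
  · have hnz : n z ≠ 0 := fun h0 => h z h0 hz
    rw [ContinuousAt, toP_of_eq hz, OnePoint.hasBasis_nhds_infty.tendsto_right_iff]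
    rintro K ⟨_, hK⟩
    obtain ⟨R, hR⟩ := hK.isBounded.exists_norm_le
    have h1 : R * ‖d z‖ < ‖n z‖ := by rw [hz, norm_zero, mul_zero]; exact norm_pos_iff.2 hnz
    filter_upwards [((hd.norm.const_mul R).continuousAt.eventually_lt hn.norm.continuousAt h1)]
      with w hw
    by_cases hdw : d w = 0
    · rw [toP_of_eq hdw]
      exact Or.inr rfl
    · rw [toP_of_ne hdw]
      refine Or.inl ⟨_, fun hmem => ?_, rfl⟩
      have := hR _ hmem
      rw [norm_div, div_le_iff₀ (norm_pos_iff.2 hdw)] at this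
      linarith
  · refine ContinuousAt.congr (f := fun z => ((n z / d z : ℂ) : OnePoint ℂ)) ?_ ?_
    · exact OnePoint.continuous_coe.continuousAt.comp (hn.continuousAt.div hd.continuousAt hz)
    · filter_upwards [hd.continuousAt.eventually_ne hz] with w hw
      rw [toP_of_ne hw]

lemma isMeromorphic_toP {n d : ℂ → ℂ} (hn : Differentiable ℂ n) (hd : Differentiable ℂ d)
    (hd0 : ∀ z, d z = 0 → deriv d z ≠ 0) (h : ∀ z, n z = 0 → d z ≠ 0) :
    IsMeromorphic fun z => toP (n z) (d z) := by
  refine ⟨fun z => ?_, continuous_toP hn.continuous hd.continuous h, fun z => ?_⟩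
  · simp only [finPart_toP]
    exact (hn.analyticAt z).meromorphicAt.div (hd.analyticAt z).meromorphicAt
  · filter_upwards [eventually_ne_zero_of_simple hd (hd0 z)] with w hw
    rwa [ne_eq, toP_eq_infty_iff]

open Classical in
lemma meromorphicOrderAt_of_simple {n : ℂ → ℂ} (hn : Differentiable ℂ n)
    (hn0 : ∀ z, n z = 0 → deriv n z ≠ 0) (z : ℂ) :
    meromorphicOrderAt n z = ((if n z = 0 then 1 else 0 : ℤ) : WithTop ℤ) := by
  rw [(hn.analyticAt z).meromorphicOrderAt_eq]
  by_cases h : n z = 0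
  · rw [(hn.analyticAt z).analyticOrderAt_eq_one_of_zero_deriv_ne_zero h (hn0 z h), if_pos h]
    rfl
  · rw [(hn.analyticAt z).analyticOrderAt_eq_zero.2 h, if_neg h]
    rfl

open Classical in
lemma orderAt_toP {n d : ℂ → ℂ} (hn : Differentiable ℂ n) (hd : Differentiable ℂ d)
    (hn0 : ∀ z, n z = 0 → deriv n z ≠ 0) (hd0 : ∀ z, d z = 0 → deriv d z ≠ 0) (z : ℂ) :
    orderAt (fun z => toP (n z) (d z)) z =
      (if n z = 0 then 1 else 0) - (if d z = 0 then 1 else 0) := by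
  unfold orderAt
  simp only [finPart_toP]
  have h1 : meromorphicOrderAt (fun w => n w / d w) z =
      ((if n z = 0 then 1 else 0 : ℤ) : WithTop ℤ) - ((if d z = 0 then 1 else 0 : ℤ) : WithTop ℤ) := by
    rw [← meromorphicOrderAt_of_simple hn hn0, ← meromorphicOrderAt_of_simple hd hd0]
    exact meromorphicOrderAt_div (hn.analyticAt z).meromorphicAt (hd.analyticAt z).meromorphicAt
  rw [h1, ← WithTop.LinearOrderedAddCommGroup.coe_sub]
  rfl

/-! ### Counting roots and poles -/

/-- Each point has exactly one translate by the lattice in a fundamental domain. -/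
lemma exists_mem_fundDomain {T : ℝ} (hT : 0 < T) (zc w : ℂ) :
    ∃ z ∈ fundDomain (Complex.I * T / Real.pi) zc, InLattice T (z - w) ∧
      ∀ z' ∈ fundDomain (Complex.I * T / Real.pi) zc, InLattice T (z' - w) → z' = z := by
  have hpi := Real.pi_pos
  have hD : ∀ z, z ∈ fundDomain (Complex.I * T / Real.pi) zc ↔
      (z - zc).re / Real.pi ∈ Set.Ico (0 : ℝ) 1 ∧ (z - zc).im / T ∈ Set.Ico (0 : ℝ) 1 := by
    intro z
    have e : ∀ r s : ℝ, zc + r * Real.pi + s * Real.pi * (Complex.I * T / Real.pi) =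
        zc + ((r * Real.pi : ℝ) : ℂ) + ((s * T : ℝ) : ℂ) * Complex.I := fun r s => by
      push_cast
      field_simp [pi_ne_zero']
    constructor
    · rintro ⟨r, hr, s, hs, rfl⟩
      rw [e]
      simp only [Complex.sub_re, Complex.add_re, Complex.ofReal_re, Complex.mul_I_re,
        Complex.ofReal_im, Complex.sub_im, Complex.add_im, Complex.mul_I_im]
      have h1 : (zc.re + r * Real.pi + -0 - zc.re) / Real.pi = r := by field_simp; ring
      have h2 : (zc.im + 0 + s * T - zc.im) / T = s := by field_simp; ring
      rw [h1, h2]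
      exact ⟨hr, hs⟩
    · rintro ⟨h1, h2⟩
      refine ⟨_, h1, _, h2, ?_⟩
      rw [e, div_mul_cancel₀ _ hpi.ne', div_mul_cancel₀ _ hT.ne', add_assoc, Complex.re_add_im]
      ring
  refine ⟨w - (⌊(w - zc).re / Real.pi⌋ : ℤ) * (Real.pi : ℂ) -
    (⌊(w - zc).im / T⌋ : ℤ) * (Complex.I * T), ?_, ?_, ?_⟩
  · rw [hD]
    have h1 : ∀ m n : ℤ, (w - m * (Real.pi : ℂ) - n * (Complex.I * T) - zc).re / Real.pi =
        (w - zc).re / Real.pi - m := fun m n => by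
      simp
      field_simp
      ring
    have h2 : ∀ m n : ℤ, (w - m * (Real.pi : ℂ) - n * (Complex.I * T) - zc).im / T =
        (w - zc).im / T - n := fun m n => by
      simp
      field_simp
      ring
    rw [h1, h2, Int.self_sub_floor, Int.self_sub_floor]
    exact ⟨⟨Int.fract_nonneg _, Int.fract_lt_one _⟩, ⟨Int.fract_nonneg _, Int.fract_lt_one _⟩⟩
  · exact ⟨-⌊(w - zc).re / Real.pi⌋, -⌊(w - zc).im / T⌋, by push_cast; ring⟩
  · rintro z' hz' ⟨m, n, hmn⟩
    rw [hD] at hz'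
    obtain rfl : z' = w + (m * Real.pi + n * (Complex.I * T)) := by rw [← hmn]; ring
    have h1 : (w + (m * Real.pi + n * (Complex.I * T)) - zc).re / Real.pi =
        (w - zc).re / Real.pi + m := by
      simp
      field_simp
      ring
    have h2 : (w + (m * Real.pi + n * (Complex.I * T)) - zc).im / T =
        (w - zc).im / T + n := by
      simp
      field_simp
      ring
    rw [h1, h2] at hz'
    have e1 : ⌊(w - zc).re / Real.pi⌋ = -m := by
      rw [Int.floor_eq_iff]
      push_cast
      constructor <;> linarith [hz'.1.1, hz'.1.2]
    have e2 : ⌊(w - zc).im / T⌋ = -n := by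
      rw [Int.floor_eq_iff]
      push_cast
      constructor <;> linarith [hz'.2.1, hz'.2.2]
    rw [e1, e2]
    push_cast
    ring

open Classical in
-- The zeros form two distinct classes modulo the lattice, each with one representative in the
-- fundamental domain.
lemma finsum_thPair_zeros {T : ℝ} (hT : 0 < T) {a b : ℂ} (hab : ¬ InLattice T (a - b)) (zc : ℂ) :
    ∑ᶠ z ∈ fundDomain (Complex.I * T / Real.pi) zc,
      (if thPair T a b z = 0 then 1 else 0 : ℤ) = 2 := by
  obtain ⟨z₁, hz₁, h₁, u₁⟩ := exists_mem_fundDomain hT zc (-a)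
  obtain ⟨z₂, hz₂, h₂, u₂⟩ := exists_mem_fundDomain hT zc (-b)
  have hne : z₁ ≠ z₂ := by
    rintro rfl
    exact hab (by simpa using h₁.sub h₂)
  have e₁ : thPair T a b z₁ = 0 := by
    rw [thPair, (th_eq_zero_iff hT).2 (by simpa using h₁), zero_mul]
  have e₂ : thPair T a b z₂ = 0 := by
    rw [thPair, (th_eq_zero_iff (z := z₂ + b) hT).2 (by simpa using h₂), mul_zero]
  rw [finsum_mem_eq_sum_of_inter_support_eq (t := {z₁, z₂}), Finset.sum_pair hne, if_pos e₁,
    if_pos e₂]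
  · norm_num
  · ext z
    simp only [Set.mem_inter_iff, Function.mem_support, ne_eq, ite_eq_right_iff, one_ne_zero,
      imp_false, not_not, Finset.coe_insert, Finset.coe_singleton, Set.mem_insert_iff,
      Set.mem_singleton_iff]
    refine and_congr_left fun hz => ⟨fun hD => ?_, ?_⟩
    · rcases inLattice_of_thPair_eq_zero hT hz with h | h
      · exact Or.inl (u₁ z hD h)
      · exact Or.inr (u₂ z hD h)
    · rintro (rfl | rfl) <;> assumption

/-- The data of a quotient `k ϑ(z + a) ϑ(z + b) / (ϑ(z + c) ϑ(z + d))` in lowest terms. -/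
structure Reduced (T : ℝ) (k a b c d : ℂ) : Prop where
  pos : 0 < T
  ne : k ≠ 0
  ab : ¬ InLattice T (a - b)
  cd : ¬ InLattice T (c - d)
  ac : ¬ InLattice T (a - c)
  ad : ¬ InLattice T (a - d)
  bc : ¬ InLattice T (b - c)
  bd : ¬ InLattice T (b - d)

section
variable {T : ℝ} {k a b c d : ℂ}

lemma Reduced.denom_ne_zero (h : Reduced T k a b c d) (z : ℂ) (hz : k * thPair T a b z = 0) :
    thPair T c d z ≠ 0 :=
  thPair_ne_zero h.pos h.ac h.ad h.bc h.bd ((mul_eq_zero.1 hz).resolve_left h.ne)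

lemma Reduced.deriv_numer (h : Reduced T k a b c d) (z : ℂ) (hz : k * thPair T a b z = 0) :
    deriv (fun z => k * thPair T a b z) z ≠ 0 := by
  rw [deriv_const_mul _ (differentiable_thPair h.pos a b z)]
  exact mul_ne_zero h.ne
    (deriv_thPair_ne_zero h.pos h.ab z ((mul_eq_zero.1 hz).resolve_left h.ne))

lemma Reduced.isMeromorphic (h : Reduced T k a b c d) :
    IsMeromorphic fun z => toP (k * thPair T a b z) (thPair T c d z) :=
  isMeromorphic_toP ((differentiable_thPair h.pos a b).const_mul k)
    (differentiable_thPair h.pos c d) (deriv_thPair_ne_zero h.pos h.cd) h.denom_ne_zero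

open Classical in
lemma Reduced.orderAt_eq (h : Reduced T k a b c d) (z : ℂ) :
    orderAt (fun z => toP (k * thPair T a b z) (thPair T c d z)) z =
      (if thPair T a b z = 0 then 1 else 0) - (if thPair T c d z = 0 then 1 else 0) := by
  rw [orderAt_toP ((differentiable_thPair h.pos a b).const_mul k)
    (differentiable_thPair h.pos c d) h.deriv_numer (deriv_thPair_ne_zero h.pos h.cd)]
  simp only [mul_eq_zero, h.ne, false_or]

lemma Reduced.rootCount_eq (h : Reduced T k a b c d) (zc : ℂ) :
    rootCount (fun z => toP (k * thPair T a b z) (thPair T c d z))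
      (fundDomain (Complex.I * T / Real.pi) zc) = 2 := by
  classical
  rw [rootCount, ← finsum_thPair_zeros h.pos h.ab zc]
  refine finsum_mem_congr rfl fun z _ => ?_
  rw [h.orderAt_eq]
  by_cases h1 : thPair T a b z = 0
  · have h2 := h.denom_ne_zero z (by rw [h1, mul_zero])
    simp [h1, h2]
  · by_cases h2 : thPair T c d z = 0 <;> simp [h1, h2]

lemma Reduced.poleCount_eq (h : Reduced T k a b c d) (zc : ℂ) :
    poleCount (fun z => toP (k * thPair T a b z) (thPair T c d z))
      (fundDomain (Complex.I * T / Real.pi) zc) = 2 := by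
  classical
  rw [poleCount, ← finsum_thPair_zeros h.pos h.cd zc]
  refine finsum_mem_congr rfl fun z _ => ?_
  rw [h.orderAt_eq]
  by_cases h1 : thPair T a b z = 0
  · have h2 := h.denom_ne_zero z (by rw [h1, mul_zero])
    simp [h1, h2]
  · by_cases h2 : thPair T c d z = 0 <;> simp [h1, h2]

end

/-! ### X, Y and the kernel curve -/

section
variable {a T g c : ℝ}

lemma Xfun_eq_toP (z : ℂ) : Xfun c (Complex.I * g) (Complex.I * T / Real.pi) z =
    toP (numX T g c z) (denX T g z) := by
  rw [Xfun, toP, numX, denX, thPair, thPair, add_zero, ← sub_eq_add_neg]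
  rfl

lemma Yfun_eq_Xfun (c γ τ z : ℂ) : Yfun c γ τ z = Xfun c γ τ (-z) := by
  have hneg : ∀ w, theta (-w) τ = -theta w τ := fun w => by
    unfold theta
    rw [← tsum_neg]
    congr! 2 with n
    simp only [mul_neg, neg_neg]
    ring
  rw [Xfun, Yfun, show -z - γ = -(z + γ) by ring, show -z + 2 * γ = -(z - 2 * γ) by ring,
    show -z + γ = -(z - γ) by ring, hneg, hneg, hneg, hneg]
  simp only [neg_mul_neg]

lemma Yfun_eq_toP (z : ℂ) : Yfun c (Complex.I * g) (Complex.I * T / Real.pi) z =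
    toP (numX T g c (-z)) (denX T g (-z)) := by
  rw [Yfun_eq_Xfun, Xfun_eq_toP]

lemma numX_reflect (z : ℂ) : numX T g c (-(Complex.I * g) - z) = numX T g c z := by
  rw [numX, numX, thPair, thPair, show -(Complex.I * g) - z + 0 = -(z + Complex.I * g) by ring,
    show -(Complex.I * g) - z + Complex.I * g = -(z + 0) by ring, th_neg, th_neg]
  ring

lemma denX_reflect (z : ℂ) : denX T g (-(Complex.I * g) - z) = denX T g z := by
  rw [denX, denX, thPair, thPair,
    show -(Complex.I * g) - z + -(Complex.I * g) = -(z + 2 * (Complex.I * g)) by ring,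
    show -(Complex.I * g) - z + 2 * (Complex.I * g) = -(z + -(Complex.I * g)) by ring, th_neg,
    th_neg]
  ring

lemma th_neg_conj (T : ℝ) (z : ℂ) :
    th T (-(starRingEnd ℂ) z) = (starRingEnd ℂ) (th T z) := by
  rw [th_neg, th_conj, neg_neg]

lemma numX_neg_conj (z : ℂ) :
    numX T g c (-(starRingEnd ℂ) z) = (starRingEnd ℂ) (numX T g c z) := by
  rw [numX, numX, thPair, thPair, map_mul, map_mul, Complex.conj_ofReal, ← th_neg_conj,
    ← th_neg_conj]
  simp [add_comm]

lemma denX_neg_conj (z : ℂ) :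
    denX T g (-(starRingEnd ℂ) z) = (starRingEnd ℂ) (denX T g z) := by
  rw [denX, denX, thPair, thPair, map_mul, ← th_neg_conj, ← th_neg_conj]
  simp [add_comm, map_ofNat]

lemma Fits.reduced_X (h : Fits a T g c) :
    Reduced T c 0 (Complex.I * g) (-(Complex.I * g)) (2 * (Complex.I * g)) := by
  have hn : ∀ w, ¬ InLattice T w → ¬ InLattice T (-w) := fun w hw h' =>
    hw (by simpa using h'.neg)
  have h1 := h.not_inLattice
  have h2 := h.not_inLattice_two
  have h3 := h.not_inLattice_three
  refine ⟨h.T_pos, by exact_mod_cast h.c_pos.ne', ?_, ?_, ?_, ?_, ?_, ?_⟩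
  · simpa using hn _ h1
  · rw [show -(Complex.I * g) - 2 * (Complex.I * g) = -(3 * (Complex.I * g)) by ring]
    exact hn _ h3
  · simpa using h1
  · simpa using hn _ h2
  · rwa [sub_neg_eq_add, ← two_mul]
  · rw [show Complex.I * g - 2 * (Complex.I * g) = -(Complex.I * g) by ring]
    exact hn _ h1

lemma Fits.reduced_Y (h : Fits a T g c) :
    Reduced T c 0 (-(Complex.I * g)) (Complex.I * g) (-2 * (Complex.I * g)) := by
  have hn : ∀ w, ¬ InLattice T w → ¬ InLattice T (-w) := fun w hw h' =>
    hw (by simpa using h'.neg)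
  have h1 := h.not_inLattice
  have h2 := h.not_inLattice_two
  have h3 := h.not_inLattice_three
  refine ⟨h.T_pos, by exact_mod_cast h.c_pos.ne', ?_, ?_, ?_, ?_, ?_, ?_⟩
  · simpa using h1
  · rwa [show Complex.I * g - -2 * (Complex.I * g) = 3 * (Complex.I * g) by ring]
  · simpa using hn _ h1
  · simpa using h2
  · rw [show -(Complex.I * g) - Complex.I * g = -(2 * (Complex.I * g)) by ring]
    exact hn _ h2
  · rwa [show -(Complex.I * g) - -2 * (Complex.I * g) = Complex.I * g by ring]

lemma Xfun_funext : Xfun c (Complex.I * g) (Complex.I * T / Real.pi) =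
    fun z => toP (c * thPair T 0 (Complex.I * g) z)
      (thPair T (-(Complex.I * g)) (2 * (Complex.I * g)) z) :=
  funext Xfun_eq_toP

lemma Yfun_funext : Yfun c (Complex.I * g) (Complex.I * T / Real.pi) =
    fun z => toP (c * thPair T 0 (-(Complex.I * g)) z)
      (thPair T (Complex.I * g) (-2 * (Complex.I * g)) z) := by
  funext z
  rw [Yfun_eq_toP, numX, denX, thPair, thPair, thPair, thPair,
    show -z + Complex.I * g = -(z + -(Complex.I * g)) by ring, show -z + 0 = -(z + 0) by ring,
    show -z + -(Complex.I * g) = -(z + Complex.I * g) by ring,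
    show -z + 2 * (Complex.I * g) = -(z + -2 * (Complex.I * g)) by ring, th_neg, th_neg, th_neg,
    th_neg, neg_mul_neg, neg_mul_neg]

lemma differentiable_numX (hT : 0 < T) : Differentiable ℂ (numX T g c) :=
  (differentiable_thPair hT _ _).const_mul _

lemma differentiable_denX (hT : 0 < T) : Differentiable ℂ (denX T g) :=
  differentiable_thPair hT _ _

/-- If a finite x were omitted, `numX` - x `denX` would have no zeros, and `numX` would be a
constant multiple of it. The zero of `numX` at 0 makes the constant 0, so `numX` would vanish
identically, in particular at the pole γ. -/
lemma Fits.exists_X_eq (h : Fits a T g c) (p : OnePoint ℂ) :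
    ∃ z, toP (numX T g c z) (denX T g z) = p := by
  have hγ : denX T g (Complex.I * g) = 0 := by simp [denX, thPair, th_zero]
  induction p using OnePoint.rec with
  | infty => exact ⟨Complex.I * g, toP_of_eq hγ⟩
  | coe x =>
    by_contra! hcon
    have hG : ∀ z, numX T g c z - x * denX T g z ≠ 0 := fun z hz => by
      have hd : denX T g z ≠ 0 := fun hd => denX_ne_zero_of_numX_eq_zero h
        (by rw [hd] at hz; simpa using hz) hd
      apply hcon z
      rw [toP_of_ne hd, sub_eq_zero.1 hz, mul_div_cancel_right₀ _ hd]
    obtain ⟨k, hk⟩ := exists_eq_const_mul (F := numX T g c)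
      (G := fun z => numX T g c z - x * denX T g z) h.T_pos (differentiable_numX h.T_pos)
      ((differentiable_numX h.T_pos).sub ((differentiable_denX h.T_pos).const_mul x))
      (fun z hz => absurd hz (hG z)) (fun z hz => absurd hz (hG z)) (fun _ => 1) _ (by simp)
      (fun _ => Complex.exp_ne_zero _) (fun z => by rw [numX_add_pi, one_mul])
      (fun z => by rw [numX_add_pi, denX_add_pi, one_mul]) (numX_add_I_mul h.T_pos)
      (fun z => by rw [numX_add_I_mul h.T_pos, denX_add_I_mul h.T_pos]; ring)
    have h0 : k = 0 := by
      have := hk 0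
      rw [show numX T g c 0 = 0 by simp [numX, thPair, th_zero], zero_eq_mul] at this
      exact this.resolve_right (by
        have h' := hG 0
        rwa [show numX T g c 0 = 0 by simp [numX, thPair, th_zero]] at h')
    exact denX_ne_zero_of_numX_eq_zero h (by rw [hk, h0, zero_mul]) hγ

lemma Fits.kernelForm_eq {t : ℝ} (h : Fits a T g c) (ht : t ≠ 0)
    (hE : thConst T (Complex.I * g) = (c * (1 / t) : ℝ)) (z y₀ y₁ : ℂ) :
    kernelForm a t (numX T g c z) (denX T g z) y₀ y₁ =
      -(t / c) * ((y₀ * denX T g (-z) - y₁ * numX T g c (-z)) *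
      (y₀ * denX T g (z + Complex.I * g) - y₁ * numX T g c (z + Complex.I * g))) := by
  have ht' : (t : ℂ) ≠ 0 := by exact_mod_cast ht
  have hc' : (c : ℂ) ≠ 0 := by exact_mod_cast h.c_pos.ne'
  have hf := h.kernel_factor z y₀ y₁
  rw [hE] at hf
  rw [neg_mul, ← mul_neg, ← hf, kernelForm]
  push_cast
  field_simp

lemma Fits.kernelExt_eq_zero {t : ℝ} (h : Fits a T g c) (ht : t ≠ 0)
    (hE : thConst T (Complex.I * g) = (c * (1 / t) : ℝ)) (z : ℂ) :
    kernelExt a t (toP (numX T g c z) (denX T g z)) (toP (numX T g c (-z)) (denX T g (-z))) = 0 := by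
  rw [kernelExt_toP_eq_zero_iff (denX_ne_zero_of_numX_eq_zero h), h.kernelForm_eq ht hE]
  obtain ⟨k, hk, h1, h2⟩ := exists_homCoord_toP (n := numX T g c (-z)) (d := denX T g (-z))
    (denX_ne_zero_of_numX_eq_zero h)
  set p := homCoord (toP (numX T g c (-z)) (denX T g (-z)))
  rw [show p.1 * denX T g (-z) - p.2 * numX T g c (-z) = 0 by rw [h1, h2]; ring]
  ring

/-- Over p = X(z) the second coordinate is Y(z) or Y(-γ-z), and -γ-z has the same image p under X.
-/
lemma Fits.kernelCurve_eq {t : ℝ} (h : Fits a T g c) (ht : t ≠ 0)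
    (hE : thConst T (Complex.I * g) = (c * (1 / t) : ℝ)) :
    kernelCurve a t = Set.range fun z =>
      (toP (numX T g c z) (denX T g z), toP (numX T g c (-z)) (denX T g (-z))) := by
  have hc' : (c : ℂ) ≠ 0 := by exact_mod_cast h.c_pos.ne'
  have ht' : (t : ℂ) ≠ 0 := by exact_mod_cast ht
  ext ⟨p, q⟩
  constructor
  · intro hpq
    obtain ⟨z, rfl⟩ := h.exists_X_eq p
    have hpq' : kernelExt a t _ _ = 0 := hpq
    rw [kernelExt_toP_eq_zero_iff (denX_ne_zero_of_numX_eq_zero h), h.kernelForm_eq ht hE,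
      mul_eq_zero, mul_eq_zero] at hpq'
    rcases hpq'.resolve_left (neg_ne_zero.2 (div_ne_zero ht' hc')) with h1 | h1
    · exact ⟨z, Prod.ext rfl
        (eq_toP (denX_ne_zero_of_numX_eq_zero h) (sub_eq_zero.1 h1)).symm⟩
    · refine ⟨-(Complex.I * g) - z, Prod.ext ?_ ?_⟩
      · simp only [numX_reflect, denX_reflect]
      · simp only [show -(-(Complex.I * g) - z) = z + Complex.I * g by ring]
        exact (eq_toP (denX_ne_zero_of_numX_eq_zero h) (sub_eq_zero.1 h1)).symm
  · rintro ⟨z, hz⟩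
    rw [← hz]
    exact h.kernelExt_eq_zero ht hE z

lemma modulus_toP_lt_one {n d : ℂ} : modulus (toP n d) < 1 ↔ ‖n‖ < ‖d‖ := by
  by_cases hd : d = 0
  · rw [toP_of_eq hd, hd, norm_zero]
    exact iff_of_false (not_lt.2 le_top) (not_lt.2 (norm_nonneg _))
  · rw [toP_of_ne hd]
    change ‖n / d‖ₑ < 1 ↔ _
    rw [enorm_eq_nnnorm, ← ENNReal.coe_one, ENNReal.coe_lt_coe, ← NNReal.coe_lt_coe, coe_nnnorm,
      norm_div, NNReal.coe_one, div_lt_one (norm_pos_iff.2 hd)]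

lemma modulus_toP_eq_one {n d : ℂ} (h : n = 0 → d ≠ 0) : modulus (toP n d) = 1 ↔ ‖n‖ = ‖d‖ := by
  by_cases hd : d = 0
  · have hn : ‖n‖ ≠ 0 := norm_ne_zero_iff.2 fun hn => h hn hd
    rw [toP_of_eq hd, hd, norm_zero]
    exact iff_of_false ENNReal.top_ne_one hn
  · rw [toP_of_ne hd]
    change ‖n / d‖ₑ = 1 ↔ _
    rw [enorm_eq_nnnorm, ← ENNReal.coe_one, ENNReal.coe_inj, ← NNReal.coe_inj, coe_nnnorm,
      norm_div, NNReal.coe_one, div_eq_one_iff_eq (norm_ne_zero_iff.2 hd)]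

end

/-! ### The size of X on horizontal strips -/

/-- A maximum principle for periodic functions on a horizontal strip. -/
lemma norm_le_of_strip {f : ℂ → ℂ} {p q C : ℝ} (hpq : p < q)
    (hf : ∀ z : ℂ, p ≤ z.im → z.im ≤ q → DifferentiableAt ℂ f z)
    (hper : ∀ z, f (z + Real.pi) = f z) (hp : ∀ z : ℂ, z.im = p → ‖f z‖ ≤ C)
    (hq : ∀ z : ℂ, z.im = q → ‖f z‖ ≤ C) {z : ℂ} (hzp : p ≤ z.im) (hzq : z.im ≤ q) :
    ‖f z‖ ≤ C := by
  have hclos : closure (Complex.im ⁻¹' Set.Ioo p q) ⊆ Complex.im ⁻¹' Set.Icc p q :=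
    closure_minimal (Set.preimage_mono Set.Ioo_subset_Icc_self)
      (isClosed_Icc.preimage Complex.continuous_im)
  have hK : IsCompact (Set.Icc (0 : ℝ) Real.pi ×ℂ Set.Icc p q) :=
    isCompact_Icc.reProdIm isCompact_Icc
  have hcont : ContinuousOn f (Set.Icc (0 : ℝ) Real.pi ×ℂ Set.Icc p q) := fun w hw =>
    (hf w hw.2.1 hw.2.2).continuousAt.continuousWithinAt
  obtain ⟨M, hM⟩ := hK.exists_bound_of_continuousOn hcont
  have hbound : ∀ w : ℂ, p ≤ w.im → w.im ≤ q → ‖f w‖ ≤ M := fun w h1 h2 => by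
    have hpf : Function.Periodic f (Real.pi : ℂ) := hper
    rw [← hpf.sub_int_mul_eq ⌊w.re / Real.pi⌋]
    refine hM _ ⟨?_, ?_⟩
    · have e : (w - (⌊w.re / Real.pi⌋ : ℤ) * (Real.pi : ℂ)).re =
          Int.fract (w.re / Real.pi) * Real.pi := by
        rw [← Int.self_sub_floor, sub_mul, div_mul_cancel₀ _ Real.pi_ne_zero]
        simp
      rw [Set.mem_preimage, e]
      have := Real.pi_pos
      exact ⟨mul_nonneg (Int.fract_nonneg _) this.le,
        mul_le_of_le_one_left this.le (Int.fract_lt_one _).le⟩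
    · simpa using ⟨h1, h2⟩
  refine PhragmenLindelof.horizontal_strip (f := f) (a := p) (b := q) (C := C) ?_ ?_ hp hq hzp hzq
  · refine ⟨fun w hw => (hf w hw.1.le hw.2.le).differentiableWithinAt, fun w hw => ?_⟩
    exact (hf w (hclos hw).1 (hclos hw).2).continuousAt.continuousWithinAt
  -- Periodicity and compactness bound f on the strip, so the growth condition holds with exponent
  -- 0.
  · refine ⟨0, div_pos Real.pi_pos (sub_pos.2 hpq), 0, ?_⟩
    refine Asymptotics.IsBigO.of_bound M ?_
    refine Filter.Eventually.filter_mono inf_le_right (Filter.eventually_principal.2 fun w hw => ?_)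
    simpa using hbound w hw.1.le hw.2.le

section
variable {a T g c : ℝ}

lemma mu_neg_left (T x y : ℝ) : mu T (-x) y = mu T x y := by
  rw [← mu_neg T x y, mu, mu, show ((-x : ℝ) + Complex.I * y : ℂ) =
    -(x + Complex.I * (-y : ℝ)) by push_cast; ring, th_neg, norm_neg]
  simp

lemma mu_add_pi (T x y : ℝ) : mu T (x + Real.pi) y = mu T x y := by
  rw [mu, mu, show ((x + Real.pi : ℝ) + Complex.I * y : ℂ) =
    (x + Complex.I * y) + Real.pi by push_cast; ring, th_add_pi, norm_neg]

/-- A multiple of `‖numX‖ - ‖denX‖`. -/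
def gap (T g x y : ℝ) : ℝ :=
  kap T g * (mu T x y * mu T x (y + g)) - mu T x (y - g) * mu T x (y + 2 * g)

lemma Fits.norm_sub_norm (h : Fits a T g c) (x y : ℝ) :
    ‖numX T g c (x + Complex.I * y)‖ - ‖denX T g (x + Complex.I * y)‖ =
      Real.exp ((y - g) ^ 2 / T) * Real.exp ((y + 2 * g) ^ 2 / T) * gap T g x y := by
  rw [numX, denX, thPair, thPair, add_zero,
    show (x + Complex.I * y + Complex.I * g : ℂ) = x + Complex.I * (y + g : ℝ) by
      push_cast; ring,
    show (x + Complex.I * y + -(Complex.I * g) : ℂ) = x + Complex.I * (y - g : ℝ) by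
      push_cast; ring,
    show (x + Complex.I * y + 2 * (Complex.I * g) : ℂ) = x + Complex.I * (y + 2 * g : ℝ) by
      push_cast; ring, norm_mul, norm_mul, norm_mul, norm_th_eq_mu, norm_th_eq_mu, norm_th_eq_mu,
    norm_th_eq_mu, Complex.norm_real, Real.norm_of_nonneg h.c_pos.le, gap]
  have e : Real.exp (4 * g ^ 2 / T) * (Real.exp (y ^ 2 / T) * Real.exp ((y + g) ^ 2 / T)) =
      Real.exp ((y - g) ^ 2 / T) * Real.exp ((y + 2 * g) ^ 2 / T) := by
    rw [← Real.exp_add, ← Real.exp_add, ← Real.exp_add]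
    congr 1; ring
  rw [h.c_eq]
  linear_combination (kap T g * (mu T x y * mu T x (y + g))) * e

lemma Fits.norm_lt_iff (h : Fits a T g c) (x y : ℝ) :
    ‖numX T g c (x + Complex.I * y)‖ < ‖denX T g (x + Complex.I * y)‖ ↔ gap T g x y < 0 := by
  rw [← sub_neg, h.norm_sub_norm]
  exact ⟨fun h1 => neg_of_mul_neg_right h1 (by positivity),
    fun h1 => mul_neg_of_pos_of_neg (by positivity) h1⟩

lemma Fits.norm_eq_iff (h : Fits a T g c) (x y : ℝ) :
    ‖numX T g c (x + Complex.I * y)‖ = ‖denX T g (x + Complex.I * y)‖ ↔ gap T g x y = 0 := by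
  rw [← sub_eq_zero, h.norm_sub_norm, mul_eq_zero]
  exact or_iff_right (by positivity)

lemma Fits.lt_norm_iff (h : Fits a T g c) (x y : ℝ) :
    ‖denX T g (x + Complex.I * y)‖ < ‖numX T g c (x + Complex.I * y)‖ ↔ 0 < gap T g x y := by
  rw [← sub_pos, h.norm_sub_norm]
  exact ⟨fun h1 => pos_of_mul_pos_right h1 (by positivity), fun h1 => by positivity⟩

lemma gap_neg_left (x y : ℝ) : gap T g (-x) y = gap T g x y := by
  simp only [gap, mu_neg_left]

lemma gap_add_pi (x y : ℝ) : gap T g (x + Real.pi) y = gap T g x y := by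
  simp only [gap, mu_add_pi]

lemma gap_add (hT : 0 < T) (x y : ℝ) : gap T g x (y + T) = gap T g x y := by
  simp only [gap]
  rw [add_right_comm y T g, add_sub_right_comm y T g, add_right_comm y T (2 * g), mu_add hT,
    mu_add hT, mu_add hT, mu_add hT]

lemma gap_reflect (x y : ℝ) : gap T g x (-g - y) = gap T g x y := by
  simp only [gap]
  rw [← mu_neg T x (-g - y), ← mu_neg T x (-g - y + g), ← mu_neg T x (-g - y - g),
    ← mu_neg T x (-g - y + 2 * g), show -(-g - y) = y + g by ring,
    show -(-g - y + g) = y by ring, show -(-g - y - g) = y + 2 * g by ring,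
    show -(-g - y + 2 * g) = y - g by ring]
  ring

/-- For these heights y and y + g lie in [0, T/2], g - y is nonnegative and decreasing, and y + 2g
lies in [T/2, T]. Hence both factors from the numerator grow and both from the denominator shrink.
This uses g > T/4. -/
lemma Fits.gap_strictMonoOn (h : Fits a T g c) (x : ℝ) :
    StrictMonoOn (gap T g x) (Set.Icc 0 (T / 2 - g)) := by
  intro y hy y' hy' hlt
  have hT := h.T_pos
  have h1 := h.lt_g
  have h2 := h.g_lt
  have k := kap_pos hT h1 h2
  obtain ⟨hy0, -⟩ := hy
  obtain ⟨-, hy1⟩ := hy'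
  have m1 : mu T x y < mu T x y' := mu_lt hT x hy0 hlt (by linarith)
  have m2 : mu T x (y + g) < mu T x (y' + g) :=
    mu_lt hT x (by linarith) (by linarith) (by linarith)
  have m3 : mu T x (y' - g) < mu T x (y - g) := by
    rw [← mu_neg T x (y - g), ← mu_neg T x (y' - g)]
    exact mu_lt hT x (by linarith) (by linarith) (by linarith)
  have m4 : mu T x (y' + 2 * g) < mu T x (y + 2 * g) :=
    mu_lt_of_half_le hT x (by linarith) (by linarith) (by linarith)
  have n := mu_nonneg T x
  have p1 := mul_lt_mul'' m1 m2 (n _) (n _)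
  have p2 := mul_lt_mul'' m3 m4 (n _) (n _)
  have p3 := mul_lt_mul_of_pos_left p1 k
  unfold gap
  linarith

lemma continuous_gap (hT : 0 < T) : Continuous fun p : ℝ × ℝ => gap T g p.1 p.2 := by
  refine continuous_iff_continuousAt.2 fun p => ?_
  have h : ∀ k : ℝ, ContinuousAt (fun p : ℝ × ℝ => mu T p.1 (p.2 + k)) p := fun k =>
    continuousAt_mu_comp (by fun_prop) (by fun_prop) (by fun_prop) hT
  have h0 := h 0
  have h1 := h (-g)
  simp only [add_zero, ← sub_eq_add_neg] at h0 h1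
  exact (continuousAt_const.mul (h0.mul (h g))).sub (h1.mul (h (2 * g)))

lemma th_ne_zero_of_im {T : ℝ} (hT : 0 < T) {z : ℂ} (h0 : 0 < z.im) (h1 : z.im < T) :
    th T z ≠ 0 := by
  have e : z = (z.re : ℂ) + Complex.I * (z.im : ℂ) := by
    rw [mul_comm]; exact (Complex.re_add_im z).symm
  rw [e, ← norm_ne_zero_iff, norm_th_eq_mu]
  have := mu_pos hT z.re h0 h1
  positivity

lemma Fits.denX_ne_zero (h : Fits a T g c) {z : ℂ} (h0 : -g ≤ z.im) (h1 : z.im ≤ 0) :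
    denX T g z ≠ 0 := by
  have := h.g_lt
  have := h.g_pos
  refine mul_ne_zero ?_ (th_ne_zero_of_im h.T_pos ?_ ?_)
  · rw [show z + -(Complex.I * g) = -(-z + Complex.I * g) by ring, th_neg, neg_ne_zero]
    refine th_ne_zero_of_im h.T_pos ?_ ?_ <;> simp <;> linarith
  all_goals simp; linarith

lemma Fits.numX_ne_zero (h : Fits a T g c) {z : ℂ} (h0 : T / 2 - g ≤ z.im) (h1 : z.im ≤ T / 2) :
    numX T g c z ≠ 0 := by
  have := h.g_lt
  have := h.lt_g
  have := h.T_pos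
  refine mul_ne_zero (by exact_mod_cast h.c_pos.ne')
    (mul_ne_zero (th_ne_zero_of_im h.T_pos ?_ ?_) (th_ne_zero_of_im h.T_pos ?_ ?_))
  all_goals simp; linarith

lemma Fits.denX_ne_zero_half (h : Fits a T g c) {z : ℂ} (h1 : z.im = T / 2) :
    denX T g z ≠ 0 := by
  have := h.g_lt
  have := h.lt_g
  have := h.T_pos
  refine mul_ne_zero (th_ne_zero_of_im h.T_pos ?_ ?_) ?_
  · simp; linarith
  · simp; linarith
  · rw [show z + 2 * (Complex.I * g) = (z + 2 * (Complex.I * g) - Complex.I * T) + Complex.I * T by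
      ring, th_add_I_mul h.T_pos]
    refine mul_ne_zero (neg_ne_zero.2 (Complex.exp_ne_zero _)) (th_ne_zero_of_im h.T_pos ?_ ?_)
    all_goals simp; linarith

/-- Where `Y` is the conjugate of `X`, the modulus of `X` is bounded away from `1`. -/
lemma Fits.le_diag {E : ℝ} (h : Fits a T g c)
    (hE : thConst T (Complex.I * g) = (c * E : ℝ)) {z : ℂ} {r : ℝ} (hr : 0 < r)
    (hd : denX T g z ≠ 0) (hz : ‖numX T g c z‖ / ‖denX T g z‖ = r)
    (hconj : (starRingEnd ℂ) (numX T g c z) * denX T g (-z) =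
      (starRingEnd ℂ) (denX T g z) * numX T g c (-z)) : E ≤ diag a r := by
  have hf := h.kernel_factor z ((starRingEnd ℂ) (numX T g c z)) ((starRingEnd ℂ) (denX T g z))
  rw [sub_eq_zero.2 hconj, zero_mul, neg_zero, hE] at hf
  set n := numX T g c z
  set d := denX T g z
  set x : ℂ := n / d with hx
  have hn : n = x * d := by rw [hx]; field_simp
  have hxr : ‖x‖ = r := by rw [hx, norm_div]; exact hz
  have hc : (c : ℂ) ≠ 0 := by exact_mod_cast h.c_pos.ne'
  have hd' : (starRingEnd ℂ) d ≠ 0 := (map_ne_zero _).2 hd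
  have hxx : x * (starRingEnd ℂ) x = ((r ^ 2 : ℝ) : ℂ) := by
    rw [Complex.mul_conj, Complex.normSq_eq_norm_sq, hxr]
  have hsum : x + (starRingEnd ℂ) x = ((2 * x.re : ℝ) : ℂ) := Complex.add_conj x
  -- The kernel relation at (x, x̄) is E = 2 Re x (1 + 1/r²) + ar², here multiplied by r².
  have key : E * r ^ 2 = 2 * x.re * (r ^ 2 + 1) + a * (r ^ 2) ^ 2 := by
    have : ((E * r ^ 2 : ℝ) : ℂ) = ((2 * x.re * (r ^ 2 + 1) + a * (r ^ 2) ^ 2 : ℝ) : ℂ) := by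
      push_cast at hxx hsum ⊢
      rw [← hsum, ← hxx]
      have h4 : (c : ℂ) * d ^ 2 * (starRingEnd ℂ) d ^ 2 ≠ 0 := by positivity
      apply mul_left_cancel₀ h4
      rw [hn, map_mul] at hf
      push_cast at hf
      linear_combination hf
    exact_mod_cast this
  have hre : x.re ≤ r := hxr ▸ Complex.re_le_norm x
  rw [diag]
  have h5 : E * r ^ 2 ≤ 2 * r * (r ^ 2 + 1) + a * (r ^ 2) ^ 2 := by
    rw [key]
    gcongr
  have h6 : (2 * r + 2 / r + a * r ^ 2) * r ^ 2 = 2 * r * (r ^ 2 + 1) + a * (r ^ 2) ^ 2 := by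
    field_simp
  rw [← h6] at h5
  exact le_of_mul_le_mul_right h5 (by positivity)

end

section
variable {a T g c : ℝ}

/-- The map z ↦ -z̄ conjugates X, and for real z it is z ↦ -z; thus Y is the conjugate of X on the
real line. -/
lemma Fits.conj_of_real (x : ℝ) :
    (starRingEnd ℂ) (numX T g c x) * denX T g (-x) =
      (starRingEnd ℂ) (denX T g x) * numX T g c (-x) := by
  rw [← numX_neg_conj, ← denX_neg_conj, Complex.conj_ofReal]
  ring

/-- At height T/2 the points -z̄ and -z differ by the period iT. -/
lemma Fits.conj_of_half (hT : 0 < T) (x : ℝ) :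
    (starRingEnd ℂ) (numX T g c (x + Complex.I * (T / 2))) *
        denX T g (-(x + Complex.I * (T / 2))) =
      (starRingEnd ℂ) (denX T g (x + Complex.I * (T / 2))) *
        numX T g c (-(x + Complex.I * (T / 2))) := by
  rw [← numX_neg_conj, ← denX_neg_conj,
    show -(starRingEnd ℂ) (x + Complex.I * (T / 2)) =
      -(x + Complex.I * (T / 2)) + Complex.I * T by
        simp [map_ofNat]; ring, numX_add_I_mul hT, denX_add_I_mul hT]
  ring

lemma continuous_ratio (hT : 0 < T) {w : ℝ → ℂ} (hw : Continuous w)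
    (h : ∀ x, denX T g (w x) ≠ 0) :
    Continuous fun x => ‖numX T g c (w x)‖ / ‖denX T g (w x)‖ :=
  (((differentiable_numX hT).continuous.comp hw).norm).div
    (((differentiable_denX hT).continuous.comp hw).norm) fun x => norm_ne_zero_iff.2 (h x)

/-- By `Fits.le_diag` the modulus never equals 1 - δ on the real line, and it is 0 at 0, so it stays
below by connectedness. -/
lemma Fits.ratio_lt {E δ : ℝ} (h : Fits a T g c)
    (hE : thConst T (Complex.I * g) = (c * E : ℝ)) (hδ1 : δ < 1) (hδE : diag a (1 - δ) < E)
    (x : ℝ) : ‖numX T g c x‖ / ‖denX T g x‖ < 1 - δ := by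
  by_contra! hcon
  have hd : ∀ x : ℝ, denX T g x ≠ 0 := fun x =>
    h.denX_ne_zero (by simpa using h.g_pos.le) (by simp)
  have h0 : ‖numX T g c (0 : ℝ)‖ / ‖denX T g (0 : ℝ)‖ ≤ 1 - δ := by
    rw [show numX T g c (0 : ℝ) = 0 by simp [numX, thPair, th_zero]]
    simpa using hδ1.le
  obtain ⟨y, hy⟩ := mem_range_of_exists_le_of_exists_ge
    (continuous_ratio (c := c) h.T_pos Complex.continuous_ofReal hd) ⟨0, h0⟩ ⟨x, hcon⟩
  exact absurd (h.le_diag hE (by linarith) (hd y) hy (Fits.conj_of_real y)) (not_le.2 hδE)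

/-- As on the real line, but starting from the value `highX` at π/2 + iT/2. It exceeds 1 + δ because
1 + δ lies strictly between `lowX` and `highX`. -/
lemma Fits.lt_ratio {E δ : ℝ} (h : Fits a T g c)
    (hE : thConst T (Complex.I * g) = (c * E : ℝ)) (hlow : diag a (lowX T g) = E) (hδ : 0 < δ)
    (hδE : diag a (1 + δ) < E) (x : ℝ) :
    1 + δ < ‖numX T g c (x + Complex.I * (T / 2))‖ / ‖denX T g (x + Complex.I * (T / 2))‖ := by
  by_contra! hcon
  have hd : ∀ x : ℝ, denX T g (x + Complex.I * (T / 2)) ≠ 0 := fun x =>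
    h.denX_ne_zero_half (by simp)
  have h0 : 1 + δ ≤ ‖numX T g c ((Real.pi / 2 : ℝ) + Complex.I * (T / 2))‖ /
      ‖denX T g ((Real.pi / 2 : ℝ) + Complex.I * (T / 2))‖ := by
    have h1 := hd (Real.pi / 2)
    have h2 := h.numX_high
    push_cast at h1 ⊢
    rw [h2, norm_mul, mul_div_cancel_right₀ _ (norm_ne_zero_iff.2 h1), Complex.norm_real,
      Real.norm_of_nonneg h.highX_pos.le]
    exact (mem_Ioo_of_diag_lt h.a_pos h.lowX_pos h.lowX_lt_highX (by linarith) h.diag_eq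
      (by rwa [hlow])).2.le
  obtain ⟨y, hy⟩ := mem_range_of_exists_le_of_exists_ge
    (continuous_ratio (c := c) h.T_pos (w := fun x : ℝ => (x + Complex.I * (T / 2) : ℂ))
      (by fun_prop) hd) ⟨x, hcon⟩ ⟨_, h0⟩
  exact absurd (h.le_diag hE (by linarith) (hd y) hy (Fits.conj_of_half h.T_pos y))
    (not_le.2 hδE)

/-- The reflection z ↦ -γ-z carries the bound from the real line to height -g. There is no pole in
between, so the maximum principle applies to X. -/
lemma Fits.norm_lt_of_strip {E : ℝ} (h : Fits a T g c)
    (hE : thConst T (Complex.I * g) = (c * E : ℝ)) (hE' : a + 4 < E) {z : ℂ} (h0 : -g ≤ z.im)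
    (h1 : z.im ≤ 0) : ‖numX T g c z‖ < ‖denX T g z‖ := by
  obtain ⟨δ, hδ, hδ1, hδE⟩ := exists_diag_lt hE'
  have hreal : ∀ w : ℂ, w.im = 0 → ‖numX T g c w / denX T g w‖ ≤ 1 - δ := fun w hw => by
    have e : w = (w.re : ℂ) := Complex.ext (by simp) (by simp [hw])
    rw [e, norm_div]
    exact (h.ratio_lt hE hδ1 (hδE _ le_rfl (by linarith)) w.re).le
  have hs := norm_le_of_strip (f := fun w => numX T g c w / denX T g w) (p := -g) (q := 0)
    (C := 1 - δ) (by linarith [h.g_pos])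
    (fun w hw hw' => (differentiable_numX h.T_pos w).div (differentiable_denX h.T_pos w)
      (h.denX_ne_zero hw hw'))
    (fun w => by simp only [numX_add_pi, denX_add_pi])
    (fun w hw => by
      rw [← numX_reflect, ← denX_reflect]
      exact hreal _ (by simp [hw]))
    hreal h0 h1
  have hd := norm_pos_iff.2 (h.denX_ne_zero h0 h1)
  rw [norm_div, div_le_iff₀ hd] at hs
  nlinarith

/-- The same argument for 1/X; the reflection followed by the translation iT exchanges the heights
T/2 and T/2 - g. -/
lemma Fits.lt_norm_of_strip {E : ℝ} (h : Fits a T g c)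
    (hE : thConst T (Complex.I * g) = (c * E : ℝ)) (hlow : diag a (lowX T g) = E)
    (hE' : a + 4 < E) {z : ℂ} (h0 : T / 2 - g ≤ z.im)
    (h1 : z.im ≤ T / 2) : ‖denX T g z‖ < ‖numX T g c z‖ := by
  obtain ⟨δ, hδ, hδ1, hδE⟩ := exists_diag_lt hE'
  have hline : ∀ w : ℂ, w.im = T / 2 → ‖denX T g w / numX T g c w‖ ≤ (1 + δ)⁻¹ := fun w hw => by
    have e : w = (w.re : ℂ) + Complex.I * (T / 2) := Complex.ext (by simp) (by simp [hw])
    rw [e, norm_div, ← inv_div]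
    exact inv_anti₀ (by linarith) (h.lt_ratio hE hlow hδ (hδE _ (by linarith) le_rfl) w.re).le
  have hs := norm_le_of_strip (f := fun w => denX T g w / numX T g c w) (p := T / 2 - g)
    (q := T / 2) (C := (1 + δ)⁻¹) (by linarith [h.g_pos])
    (fun w hw hw' => (differentiable_denX h.T_pos w).div (differentiable_numX h.T_pos w)
      (h.numX_ne_zero hw hw'))
    (fun w => by simp only [numX_add_pi, denX_add_pi])
    (fun w hw => by
      rw [← numX_reflect, ← denX_reflect,
        ← mul_div_mul_left _ _ (Complex.exp_ne_zero (2 * T - 4 * Complex.I *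
          (-(Complex.I * g) - w) - 2 * Complex.I * (Complex.I * g))),
        ← numX_add_I_mul h.T_pos, ← denX_add_I_mul h.T_pos]
      exact hline _ (by simp [hw]; ring))
    hline h0 h1
  have hn := norm_pos_iff.2 (h.numX_ne_zero h0 h1)
  rw [norm_div, div_le_iff₀ hn] at hs
  refine hs.trans_lt (mul_lt_of_lt_one_left hn (inv_lt_one_of_one_lt₀ (by linarith)))

/-- The curve `|X| = 1` closest to the real axis, as a graph. -/
lemma Fits.exists_graph {E : ℝ} (h : Fits a T g c)
    (hE : thConst T (Complex.I * g) = (c * E : ℝ)) (hlow : diag a (lowX T g) = E)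
    (hE' : a + 4 < E) : ∃ η : ℝ → ℝ, Continuous η ∧ (∀ x, 0 < η x) ∧ (∀ x, η x < T / 2 - g) ∧
      (∀ x, η (-x) = η x) ∧ (∀ x, η (x + Real.pi) = η x) ∧ (∀ x, gap T g x (η x) = 0) ∧
      (∀ x y, -g - η x < y → y < η x → gap T g x y < 0) ∧
      (∀ x y, η x < y → y < T - g - η x → 0 < gap T g x y) := by
  have hT := h.T_pos
  have hg := h.g_pos
  have hg1 := h.g_lt
  have hneg : ∀ x y, -g ≤ y → y ≤ 0 → gap T g x y < 0 := fun x y h1 h2 => by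
    rw [← h.norm_lt_iff]
    exact h.norm_lt_of_strip hE hE' (by simpa using h1) (by simpa using h2)
  have hpos : ∀ x y, T / 2 - g ≤ y → y ≤ T / 2 → 0 < gap T g x y := fun x y h1 h2 => by
    rw [← h.lt_norm_iff]
    exact h.lt_norm_of_strip hE hlow hE' (by simpa using h1) (by simpa using h2)
  have hc := continuous_gap (g := g) hT
  have hc₁ : ∀ y, Continuous fun x => gap T g x y := fun y =>
    hc.comp (g := fun p : ℝ × ℝ => gap T g p.1 p.2) (f := fun x => (x, y)) (by fun_prop)
  have hc₂ : ∀ x, Continuous (gap T g x) := fun x =>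
    hc.comp (g := fun p : ℝ × ℝ => gap T g p.1 p.2) (f := fun y => (x, y)) (by fun_prop)
  obtain ⟨η, hη, hη'⟩ := exists_continuous_zero (gap T g) (p := 0) (q := T / 2 - g)
    (by linarith) hc₁ hc₂
    (fun x => hneg x 0 (by linarith) le_rfl) (fun x => hpos x _ le_rfl (by linarith))
    h.gap_strictMonoOn
  have hmem : ∀ x, η x ∈ Set.Icc 0 (T / 2 - g) := fun x => Set.Ioo_subset_Icc_self (hη' x).1
  -- Evenness and periodicity of η follow from the uniqueness of the zero on each vertical line.
  have huniq : ∀ x x', (∀ y, gap T g x y = gap T g x' y) → η x = η x' := fun x x' hxx =>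
    (h.gap_strictMonoOn x).injOn (hmem x) (hmem x') (by rw [(hη' x).2, hxx, (hη' x').2])
  refine ⟨η, hη, fun x => (hη' x).1.1, fun x => (hη' x).1.2,
    fun x => huniq _ _ (gap_neg_left x), fun x => huniq _ _ (gap_add_pi x), fun x => (hη' x).2,
    ?_, ?_⟩
  · intro x
    -- The heights below -g/2 follow by the reflection y ↦ -g-y.
    have main : ∀ y, -g / 2 ≤ y → y < η x → gap T g x y < 0 := fun y h1 h2 => by
      rcases le_total y 0 with h3 | h3
      · exact hneg x y (by linarith) h3
      · rw [← (hη' x).2]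
        exact h.gap_strictMonoOn x ⟨h3, h2.le.trans (hmem x).2⟩ (hmem x) h2
    intro y h1 h2
    rcases le_total (-g / 2) y with h3 | h3
    · exact main y h3 h2
    · rw [← gap_reflect]
      exact main _ (by linarith) (by linarith)
  · intro x
    -- The heights above (T-g)/2 follow by the reflection y ↦ T-g-y.
    have main : ∀ y, y ≤ (T - g) / 2 → η x < y → 0 < gap T g x y := fun y h1 h2 => by
      rcases le_total (T / 2 - g) y with h3 | h3
      · exact hpos x y h3 (by linarith)
      · rw [← (hη' x).2]
        exact h.gap_strictMonoOn x (hmem x) ⟨(hmem x).1.trans h2.le, h3⟩ h2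
    intro y h1 h2
    rcases le_total y ((T - g) / 2) with h3 | h3
    · exact main y h3 h1
    · rw [← gap_reflect, ← gap_add hT]
      exact main _ (by linarith) (by linarith)

end

/-! ### Bands between graphs -/

/-- Rescaling each vertical line so that the two edges become 0 and 1 is a homeomorphism of the
plane that turns the set into the convex set ℝ × J. -/
lemma simplyConnectedSpace_band {p q : ℝ → ℝ} (hp : Continuous p) (hq : Continuous q)
    (hpq : ∀ x, p x < q x) {J : Set ℝ} (hJ : Convex ℝ J) (hne : J.Nonempty) {S : Set ℂ}
    (hS : ∀ z, z ∈ S ↔ (z.im - p z.re) / (q z.re - p z.re) ∈ J) : SimplyConnectedSpace S := by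
  have hpos : ∀ x, q x - p x ≠ 0 := fun x => (sub_pos.2 (hpq x)).ne'
  let e : ℂ ≃ₜ ℝ × ℝ :=
    { toFun := fun z => (z.re, (z.im - p z.re) / (q z.re - p z.re))
      invFun := fun w => ⟨w.1, p w.1 + w.2 * (q w.1 - p w.1)⟩
      left_inv := fun z => by
        apply Complex.ext
        · rfl
        · simp only
          rw [div_mul_cancel₀ _ (hpos _)]
          ring
      right_inv := fun w => by
        apply Prod.ext
        · rfl
        · simp only
          rw [add_sub_cancel_left, mul_div_cancel_right₀ _ (hpos _)]
      continuous_toFun := by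
        refine Complex.continuous_re.prodMk (Continuous.div ?_ ?_ fun z => hpos _) <;> fun_prop
      continuous_invFun := by
        have h : Continuous fun w : ℝ × ℝ =>
            ((w.1 : ℂ) + ((p w.1 + w.2 * (q w.1 - p w.1) : ℝ) : ℂ) * Complex.I) := by fun_prop
        refine h.congr fun w => ?_
        apply Complex.ext <;> simp }
  have hpre : S = e ⁻¹' (Set.univ ×ˢ J) := by
    ext z
    rw [hS]
    simp [e]
  have hconv : Convex ℝ (Set.univ ×ˢ J : Set (ℝ × ℝ)) := convex_univ.prod hJ
  have : ContractibleSpace (Set.univ ×ˢ J : Set (ℝ × ℝ)) :=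
    hconv.contractibleSpace (Set.univ_nonempty.prod hne)
  have : ContractibleSpace S := (e.sets hpre).contractibleSpace
  infer_instance

/-- The height of the lower edge of the band with index `s`, when `e` is the height of the graph. -/
def edge (T g e : ℝ) (s : ℤ) : ℝ := (s / 4 : ℤ) * T +
  (if s % 4 = 0 then -e else if s % 4 = 1 then e else if s % 4 = 2 then g + e else T - g - e)

/-- The lower edges of the bands with these indices are not part of the band. -/
def OpenEdge (s : ℤ) : Prop := s % 4 = 0 ∨ s % 4 = 3

instance (s : ℤ) : Decidable (OpenEdge s) := inferInstanceAs (Decidable (_ ∨ _))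

/-- The height `y` lies on the upper side of the lower edge of the band with index `s`. -/
def Above (T g e y : ℝ) (s : ℤ) : Prop :=
  if OpenEdge s then edge T g e s < y else edge T g e s ≤ y

section
variable {T g e y : ℝ}

/-- In terms of the curves, edges of odd index are those with |X| = 1 and edges of even index those
with |Y| = 1. -/
lemma edge_four (k : ℤ) : edge T g e (4 * k) = k * T - e := by
  rw [edge, show 4 * k / 4 = k by omega, if_pos (by omega)]; ring

lemma edge_four_add_one (k : ℤ) : edge T g e (4 * k + 1) = k * T + e := by
  rw [edge, show (4 * k + 1) / 4 = k by omega, if_neg (by omega), if_pos (by omega)]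

lemma edge_four_add_two (k : ℤ) : edge T g e (4 * k + 2) = k * T + g + e := by
  rw [edge, show (4 * k + 2) / 4 = k by omega, if_neg (by omega), if_neg (by omega),
    if_pos (by omega)]
  ring

lemma edge_four_add_three (k : ℤ) : edge T g e (4 * k + 3) = k * T + T - g - e := by
  rw [edge, show (4 * k + 3) / 4 = k by omega, if_neg (by omega), if_neg (by omega),
    if_neg (by omega)]
  ring

lemma above_four (k : ℤ) : Above T g e y (4 * k) ↔ k * T - e < y := by
  rw [Above, if_pos (by unfold OpenEdge; omega), edge_four]

lemma above_four_add_one (k : ℤ) : Above T g e y (4 * k + 1) ↔ k * T + e ≤ y := by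
  rw [Above, if_neg (by unfold OpenEdge; omega), edge_four_add_one]

lemma above_four_add_two (k : ℤ) : Above T g e y (4 * k + 2) ↔ k * T + g + e ≤ y := by
  rw [Above, if_neg (by unfold OpenEdge; omega), edge_four_add_two]

lemma above_four_add_three (k : ℤ) : Above T g e y (4 * k + 3) ↔ k * T + T - g - e < y := by
  rw [Above, if_pos (by unfold OpenEdge; omega), edge_four_add_three]

lemma exists_four_mul (s : ℤ) :
    ∃ k : ℤ, s = 4 * k ∨ s = 4 * k + 1 ∨ s = 4 * k + 2 ∨ s = 4 * k + 3 :=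
  ⟨s / 4, by omega⟩

lemma edge_strictMono (hg : 0 < g) (he : 0 < e) (he' : e < T / 2 - g) :
    StrictMono (edge T g e) := by
  refine strictMono_int_of_lt_succ fun s => ?_
  obtain ⟨k, rfl | rfl | rfl | rfl⟩ := exists_four_mul s
  · rw [edge_four, edge_four_add_one]; linarith
  · rw [add_assoc, show (1 + 1 : ℤ) = 2 by norm_num, edge_four_add_one, edge_four_add_two]; linarith
  · rw [add_assoc, show (2 + 1 : ℤ) = 3 by norm_num, edge_four_add_two, edge_four_add_three]
    linarith
  · rw [show 4 * k + 3 + 1 = 4 * (k + 1) by ring, edge_four_add_three, edge_four]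
    push_cast
    linarith

lemma Above.edge_le {s : ℤ} (h : Above T g e y s) : edge T g e s ≤ y := by
  unfold Above at h
  split_ifs at h
  · exact h.le
  · exact h

lemma above_of_edge_lt {s : ℤ} (h : edge T g e s < y) : Above T g e y s := by
  unfold Above
  split_ifs
  · exact h
  · exact h.le

lemma Above.anti (hg : 0 < g) (he : 0 < e) (he' : e < T / 2 - g) {r s : ℤ} (hrs : r ≤ s)
    (h : Above T g e y s) : Above T g e y r := by
  rcases hrs.eq_or_lt with rfl | hlt
  · exact h
  · exact above_of_edge_lt ((edge_strictMono hg he he' hlt).trans_le h.edge_le)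

lemma exists_above (hg : 0 < g) (he : 0 < e) (he' : e < T / 2 - g) (y : ℝ) :
    ∃ s, Above T g e y s ∧ ¬ Above T g e y (s + 1) := by
  have hT : 0 < T := by linarith
  obtain ⟨m, hm⟩ := exists_int_gt ((y + e) / T)
  obtain ⟨n, hn⟩ := exists_int_lt (y / T)
  rw [div_lt_iff₀ hT] at hm
  rw [lt_div_iff₀ hT] at hn
  obtain ⟨s, hs, hmax⟩ := Int.exists_greatest_of_bdd (P := Above T g e y)
    ⟨4 * m, fun z hz => by
      by_contra! hlt
      have := (above_four m).1 (hz.anti hg he he' hlt.le)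
      linarith⟩ ⟨4 * n, (above_four n).2 (by linarith)⟩
  exact ⟨s, hs, fun h => by have := hmax _ h; omega⟩

end

/-- The bands cut out by the translates and reflections of the graph of `η`. -/
def band (T g : ℝ) (η : ℝ → ℝ) (s : ℤ) : Set ℂ :=
  {z | Above T g (η z.re) z.im s ∧ ¬ Above T g (η z.re) z.im (s + 1)}

section
variable {T g : ℝ} {η : ℝ → ℝ}

lemma continuous_edge (hη : Continuous η) (s : ℤ) : Continuous fun x => edge T g (η x) s := by
  obtain ⟨k, rfl | rfl | rfl | rfl⟩ := exists_four_mul s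
  · simp only [edge_four]; fun_prop
  · simp only [edge_four_add_one]; fun_prop
  · simp only [edge_four_add_two]; fun_prop
  · simp only [edge_four_add_three]; fun_prop

lemma simplyConnectedSpace_of_band (hη : Continuous η) (hg : 0 < g) (h0 : ∀ x, 0 < η x)
    (h1 : ∀ x, η x < T / 2 - g) (s : ℤ) : SimplyConnectedSpace (band T g η s) := by
  have hlt : ∀ x, edge T g (η x) s < edge T g (η x) (s + 1) := fun x =>
    edge_strictMono hg (h0 x) (h1 x) (lt_add_one s)
  -- An edge belongs to the neighbouring band on which the modulus that equals 1 there is at least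
  -- 1, so J may be open, closed or half-open.
  set J : Set ℝ := {u | (if OpenEdge s then 0 < u else 0 ≤ u) ∧
    (if OpenEdge (s + 1) then u ≤ 1 else u < 1)} with hJ
  refine simplyConnectedSpace_band (continuous_edge hη s) (continuous_edge hη (s + 1)) hlt
    (J := J) ?_ ⟨1 / 2, ?_⟩ fun z => ?_
  · refine Convex.inter (s := {u : ℝ | if OpenEdge s then 0 < u else 0 ≤ u})
      (t := {u : ℝ | if OpenEdge (s + 1) then u ≤ 1 else u < 1}) ?_ ?_
    · split_ifs
      · exact convex_Ioi 0
      · exact convex_Ici 0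
    · split_ifs
      · exact convex_Iic 1
      · exact convex_Iio 1
  · constructor <;> split_ifs <;> norm_num
  · have hd := sub_pos.2 (hlt z.re)
    simp only [band, hJ, Set.mem_ofPred_eq, Above]
    refine and_congr ?_ ?_
    · split_ifs
      · rw [div_pos_iff_of_pos_right hd, sub_pos]
      · rw [le_div_iff₀ hd, zero_mul, sub_nonneg]
    · split_ifs
      · rw [div_le_one hd, not_lt]
        exact (sub_le_sub_iff_right _).symm
      · rw [div_lt_one hd, not_le]
        exact (sub_lt_sub_iff_right _).symm

/-- For the nontrivial inclusion it suffices to approach along vertical lines, on which the band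
contains the open interval between its edges. -/
lemma closure_band (hη : Continuous η) (hg : 0 < g) (h0 : ∀ x, 0 < η x)
    (h1 : ∀ x, η x < T / 2 - g) (s : ℤ) : closure (band T g η s) =
      {z | edge T g (η z.re) s ≤ z.im ∧ z.im ≤ edge T g (η z.re) (s + 1)} := by
  apply Set.Subset.antisymm
  · refine closure_minimal (fun z hz => ⟨hz.1.edge_le, ?_⟩) ?_
    · by_contra! h
      exact hz.2 (above_of_edge_lt h)
    · exact (isClosed_le ((continuous_edge hη s).comp Complex.continuous_re)
        Complex.continuous_im).inter (isClosed_le Complex.continuous_im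
          ((continuous_edge hη (s + 1)).comp Complex.continuous_re))
  · intro z hz
    have hlt := edge_strictMono (T := T) hg (h0 z.re) (h1 z.re) (lt_add_one s)
    have hf : Continuous fun y : ℝ => (z.re + y * Complex.I : ℂ) := by fun_prop
    have hsub : (fun y : ℝ => (z.re + y * Complex.I : ℂ)) ''
        Set.Ioo (edge T g (η z.re) s) (edge T g (η z.re) (s + 1)) ⊆ band T g η s := by
      rintro _ ⟨y, hy, rfl⟩
      refine ⟨?_, ?_⟩
      · simpa using above_of_edge_lt hy.1
      · intro h
        have := h.edge_le
        simp at this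
        linarith [hy.2]
    refine closure_mono hsub (image_closure_subset_closure_image hf ⟨z.im, ?_, ?_⟩)
    · rw [closure_Ioo hlt.ne]
      exact hz
    · exact Complex.re_add_im z

end

/-! ### Sign changes along a vertical line -/

/-- A periodic function with a reflection symmetry which, in each period, is negative
on an open interval ending at `e` and positive on the interior of its complement. -/
structure SignPattern (T g e : ℝ) (G : ℝ → ℝ) : Prop where
  g_pos : 0 < g
  e_pos : 0 < e
  e_lt : e < T / 2 - g
  add_period : ∀ y, G (y + T) = G y
  reflect : ∀ y, G (-g - y) = G y
  zero : G e = 0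
  neg : ∀ y, -g - e < y → y < e → G y < 0
  pos : ∀ y, e < y → y < T - g - e → 0 < G y

namespace SignPattern
variable {T g e : ℝ} {G : ℝ → ℝ}

lemma sub_mul (h : SignPattern T g e G) (k : ℤ) (y : ℝ) : G (y - k * T) = G y :=
  Function.Periodic.sub_int_mul_eq h.add_period k

lemma lt_zero_of_mem (h : SignPattern T g e G) {k : ℤ} {y : ℝ}
    (h0 : k * T - g - e < y) (h1 : y < k * T + e) : G y < 0 := by
  rw [← h.sub_mul k]
  exact h.neg _ (by linarith) (by linarith)

lemma eq_zero_left (h : SignPattern T g e G) (k : ℤ) : G (k * T + e) = 0 := by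
  rw [← h.sub_mul k, add_sub_cancel_left, h.zero]

lemma eq_zero_right (h : SignPattern T g e G) (k : ℤ) : G (k * T + T - g - e) = 0 := by
  rw [← h.sub_mul (k + 1)]
  push_cast
  rw [show (k * T + T - g - e - (k + 1) * T : ℝ) = -g - e by ring, h.reflect, h.zero]

lemma zero_lt_of_mem (h : SignPattern T g e G) {k : ℤ} {y : ℝ}
    (h0 : k * T + e < y) (h1 : y < k * T + T - g - e) :
    0 < G y := by
  rw [← h.sub_mul k]
  exact h.pos _ (by linarith) (by linarith)

lemma zero_le_of_mem (h : SignPattern T g e G) {k : ℤ} {y : ℝ}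
    (h0 : k * T + e ≤ y) (h1 : y ≤ k * T + T - g - e) :
    0 ≤ G y := by
  rcases h0.eq_or_lt with rfl | h0
  · exact (h.eq_zero_left k).ge
  rcases h1.eq_or_lt with rfl | h1
  · exact (h.eq_zero_right k).ge
  exact (h.zero_lt_of_mem h0 h1).le

/-- The period is taken as (-g-e, T-g-e], so that its right end, a zero of G, goes with the set
where G is nonnegative. -/
lemma exists_mem (h : SignPattern T g e G) (y : ℝ) : ∃ k : ℤ, (k * T - g - e < y ∧ y < k * T + e) ∨
    (k * T + e ≤ y ∧ y ≤ k * T + T - g - e) := by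
  have hT : 0 < T := by linarith [h.e_pos, h.e_lt, h.g_pos]
  obtain ⟨k, hk, -⟩ := existsUnique_sub_zsmul_mem_Ioc hT y (-g - e)
  rw [zsmul_eq_mul] at hk
  refine ⟨k, ?_⟩
  rcases lt_or_ge y (k * T + e) with hy | hy
  · exact Or.inl ⟨by linarith [hk.1], hy⟩
  · exact Or.inr ⟨hy, by linarith [hk.2]⟩

lemma lt_zero_iff (h : SignPattern T g e G) (y : ℝ) :
    G y < 0 ↔ ∃ k : ℤ, k * T - g - e < y ∧ y < k * T + e := by
  refine ⟨fun hy => ?_, fun ⟨k, h0, h1⟩ => h.lt_zero_of_mem h0 h1⟩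
  obtain ⟨k, hk | hk⟩ := h.exists_mem y
  · exact ⟨k, hk⟩
  · exact absurd (h.zero_le_of_mem hk.1 hk.2) (not_le.2 hy)

lemma zero_le_iff (h : SignPattern T g e G) (y : ℝ) :
    0 ≤ G y ↔ ∃ k : ℤ, k * T + e ≤ y ∧ y ≤ k * T + T - g - e := by
  refine ⟨fun hy => ?_, fun ⟨k, h0, h1⟩ => h.zero_le_of_mem h0 h1⟩
  obtain ⟨k, hk | hk⟩ := h.exists_mem y
  · exact absurd (h.lt_zero_of_mem hk.1 hk.2) (not_lt.2 hy)
  · exact ⟨k, hk⟩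

lemma eq_zero_iff (h : SignPattern T g e G) (y : ℝ) :
    G y = 0 ↔ ∃ k : ℤ, y = k * T + e ∨ y = k * T + T - g - e := by
  refine ⟨fun hy => ?_, ?_⟩
  · obtain ⟨k, h0, h1⟩ := (h.zero_le_iff y).1 hy.ge
    refine ⟨k, ?_⟩
    by_contra! hne
    exact (h.zero_lt_of_mem (h0.lt_of_ne' hne.1) (h1.lt_of_ne hne.2)).ne' hy
  · rintro ⟨k, rfl | rfl⟩
    · exact h.eq_zero_left k
    · exact h.eq_zero_right k

/-- Y(z) = X(-z), so the sign of |Y| - 1 is governed by G(-y); the intervals are renumbered by k ↦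
-k. -/
lemma neg_lt_zero_iff (h : SignPattern T g e G) (y : ℝ) :
    G (-y) < 0 ↔ ∃ k : ℤ, k * T - e < y ∧ y < k * T + g + e := by
  rw [h.lt_zero_iff]
  refine (Equiv.neg ℤ).exists_congr fun k => ?_
  simp only [Equiv.neg_apply, Int.cast_neg]
  constructor <;> rintro ⟨h0, h1⟩ <;> constructor <;> linarith

lemma zero_le_neg_iff (h : SignPattern T g e G) (y : ℝ) :
    0 ≤ G (-y) ↔ ∃ k : ℤ, k * T - T + g + e ≤ y ∧ y ≤ k * T - e := by
  rw [h.zero_le_iff]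
  refine (Equiv.neg ℤ).exists_congr fun k => ?_
  simp only [Equiv.neg_apply, Int.cast_neg]
  constructor <;> rintro ⟨h0, h1⟩ <;> constructor <;> linarith

lemma neg_eq_zero_iff (h : SignPattern T g e G) (y : ℝ) :
    G (-y) = 0 ↔ ∃ k : ℤ, y = k * T - e ∨ y = k * T - T + g + e := by
  rw [h.eq_zero_iff]
  refine (Equiv.neg ℤ).exists_congr fun k => ?_
  simp only [Equiv.neg_apply, Int.cast_neg]
  constructor <;> rintro (h0 | h0)
  · left; linarith
  · right; linarith
  · left; linarith
  · right; linarith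

end SignPattern

lemma image_sub_eq_self {S : Set ℂ} {w : ℂ} (h : ∀ z ∈ S, w - z ∈ S) :
    (fun z => w - z) '' S = S := by
  refine Set.Subset.antisymm (Set.image_subset_iff.2 h) fun z hz => ⟨w - z, h z hz, ?_⟩
  simp

/-! ### Comparison of the bands with |X| and |Y| -/

section
variable {T g : ℝ} {η : ℝ → ℝ}

lemma disjoint_band (hg : 0 < g) (h0 : ∀ x, 0 < η x) (h1 : ∀ x, η x < T / 2 - g) :
    Pairwise fun r s => Disjoint (band T g η r) (band T g η s) := by
  have hlt : ∀ r s, r < s → Disjoint (band T g η r) (band T g η s) := fun r s hrs =>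
    Set.disjoint_left.2 fun z hr hs => hr.2 (hs.1.anti hg (h0 _) (h1 _) hrs)
  intro r s hrs
  rcases lt_or_gt_of_ne hrs with hrs | hrs
  · exact hlt r s hrs
  · exact (hlt s r hrs).symm

lemma iUnion_band (hg : 0 < g) (h0 : ∀ x, 0 < η x) (h1 : ∀ x, η x < T / 2 - g) :
    ⋃ s, band T g η s = Set.univ :=
  Set.eq_univ_of_forall fun z => Set.mem_iUnion.2 (exists_above hg (h0 _) (h1 _) z.im)

lemma disjoint_closure_band (hη : Continuous η) (hg : 0 < g) (h0 : ∀ x, 0 < η x)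
    (h1 : ∀ x, η x < T / 2 - g) {r s : ℤ} (hrs : r + 1 < s) :
    Disjoint (closure (band T g η r)) (closure (band T g η s)) := by
  rw [closure_band hη hg h0 h1, closure_band hη hg h0 h1]
  refine Set.disjoint_left.2 fun z hr hs => ?_
  exact absurd (hr.2.trans_lt (edge_strictMono hg (h0 _) (h1 _) hrs)) (not_lt.2 hs.1)

lemma mem_closure_band_inter (hη : Continuous η) (hg : 0 < g) (h0 : ∀ x, 0 < η x)
    (h1 : ∀ x, η x < T / 2 - g) (s : ℤ) (z : ℂ) :
    z ∈ closure (band T g η s) ∩ closure (band T g η (s + 1)) ↔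
      z.im = edge T g (η z.re) (s + 1) := by
  rw [closure_band hη hg h0 h1, closure_band hη hg h0 h1]
  have hm := edge_strictMono (T := T) hg (h0 z.re) (h1 z.re)
  exact ⟨fun ⟨hr, hs⟩ => le_antisymm hr.2 hs.1, fun h =>
    ⟨⟨h ▸ (hm (lt_add_one s)).le, h.le⟩, h.ge, h ▸ (hm (lt_add_one (s + 1))).le⟩⟩

lemma mem_band_union (hg : 0 < g) (h0 : ∀ x, 0 < η x) (h1 : ∀ x, η x < T / 2 - g) (s : ℤ)
    (z : ℂ) : z ∈ band T g η s ∪ band T g η (s + 1) ↔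
      Above T g (η z.re) z.im s ∧ ¬ Above T g (η z.re) z.im (s + 2) := by
  have ha : ∀ {r s : ℤ}, r ≤ s → Above T g (η z.re) z.im s → Above T g (η z.re) z.im r :=
    fun hrs h => h.anti hg (h0 _) (h1 _) hrs
  have h2 : s + 1 + 1 = s + 2 := by ring
  simp only [band, Set.mem_union, Set.mem_ofPred_eq, h2]
  constructor
  · rintro (⟨h, h'⟩ | ⟨h, h'⟩)
    · exact ⟨h, fun h2 => h' (ha (by omega) h2)⟩
    · exact ⟨ha (by omega) h, h'⟩
  · rintro ⟨h, h'⟩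
    by_cases h3 : Above T g (η z.re) z.im (s + 1)
    · exact Or.inr ⟨h3, h'⟩
    · exact Or.inl ⟨h, h3⟩

lemma mem_band_zero_one (hg : 0 < g) (h0 : ∀ x, 0 < η x) (h1 : ∀ x, η x < T / 2 - g) (k : ℤ)
    (z : ℂ) : z ∈ band T g η (4 * k) ∪ band T g η (4 * k + 1) ↔
      k * T - η z.re < z.im ∧ z.im < k * T + g + η z.re := by
  rw [mem_band_union hg h0 h1, above_four, above_four_add_two, not_le]

lemma mem_band_one_two (hg : 0 < g) (h0 : ∀ x, 0 < η x) (h1 : ∀ x, η x < T / 2 - g) (k : ℤ)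
    (z : ℂ) : z ∈ band T g η (4 * k + 1) ∪ band T g η (4 * k + 2) ↔
      k * T + η z.re ≤ z.im ∧ z.im ≤ k * T + T - g - η z.re := by
  rw [show 4 * k + 2 = 4 * k + 1 + 1 by ring, mem_band_union hg h0 h1, above_four_add_one,
    show 4 * k + 1 + 2 = 4 * k + 3 by ring, above_four_add_three, not_lt]

lemma mem_band_two_three (hg : 0 < g) (h0 : ∀ x, 0 < η x) (h1 : ∀ x, η x < T / 2 - g) (k : ℤ)
    (z : ℂ) : z ∈ band T g η (4 * k - 2) ∪ band T g η (4 * k - 1) ↔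
      k * T - T + g + η z.re ≤ z.im ∧ z.im ≤ k * T - η z.re := by
  rw [show 4 * k - 1 = 4 * k - 2 + 1 by ring, mem_band_union hg h0 h1, sub_add_cancel, above_four,
    show 4 * k - 2 = 4 * (k - 1) + 2 by ring, above_four_add_two, not_lt]
  push_cast
  rw [sub_one_mul]

lemma mem_band_three_zero (hg : 0 < g) (h0 : ∀ x, 0 < η x) (h1 : ∀ x, η x < T / 2 - g) (k : ℤ)
    (z : ℂ) : z ∈ band T g η (4 * k - 1) ∪ band T g η (4 * k) ↔
      k * T - g - η z.re < z.im ∧ z.im < k * T + η z.re := by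
  have := mem_band_union hg h0 h1 (4 * k - 1) z
  rw [sub_add_cancel] at this
  rw [this, show 4 * k - 1 + 2 = 4 * k + 1 by ring, above_four_add_one,
    show 4 * k - 1 = 4 * (k - 1) + 3 by ring, above_four_add_three, not_le]
  push_cast
  rw [sub_one_mul, sub_add_cancel]

end

lemma SignPattern.mem_closures_iff_even {T g : ℝ} {η : ℝ → ℝ} (hη : Continuous η) (hg : 0 < g)
    (h0 : ∀ x, 0 < η x) (h1 : ∀ x, η x < T / 2 - g) {G : ℝ → ℝ} {z : ℂ}
    (h : SignPattern T g (η z.re) G) :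
    z ∈ ⋃ s : ℤ, closure (band T g η (2 * s)) ∩ closure (band T g η (2 * s + 1)) ↔
      G z.im = 0 := by
  simp only [Set.mem_iUnion, mem_closure_band_inter hη hg h0 h1, h.eq_zero_iff]
  constructor
  · rintro ⟨s, hs⟩
    obtain ⟨k, rfl | rfl⟩ := Int.even_or_odd' s
    · rw [show 2 * (2 * k) + 1 = 4 * k + 1 by ring, edge_four_add_one] at hs
      exact ⟨k, Or.inl hs⟩
    · rw [show 2 * (2 * k + 1) + 1 = 4 * k + 3 by ring, edge_four_add_three] at hs
      exact ⟨k, Or.inr hs⟩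
  · rintro ⟨k, hk | hk⟩
    · exact ⟨2 * k, by rw [show 2 * (2 * k) + 1 = 4 * k + 1 by ring, edge_four_add_one, hk]⟩
    · exact ⟨2 * k + 1, by
        rw [show 2 * (2 * k + 1) + 1 = 4 * k + 3 by ring, edge_four_add_three, hk]⟩

lemma SignPattern.mem_closures_iff_odd {T g : ℝ} {η : ℝ → ℝ} (hη : Continuous η) (hg : 0 < g)
    (h0 : ∀ x, 0 < η x) (h1 : ∀ x, η x < T / 2 - g) {G : ℝ → ℝ} {z : ℂ}
    (h : SignPattern T g (η z.re) G) :
    z ∈ ⋃ s : ℤ, closure (band T g η (2 * s - 1)) ∩ closure (band T g η (2 * s)) ↔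
      G (-z.im) = 0 := by
  have key : ∀ s : ℤ, z ∈ closure (band T g η (2 * s - 1)) ∩ closure (band T g η (2 * s)) ↔
      z.im = edge T g (η z.re) (2 * s) := fun s => by
    have := mem_closure_band_inter hη hg h0 h1 (2 * s - 1) z
    rwa [sub_add_cancel] at this
  simp only [Set.mem_iUnion, key, h.neg_eq_zero_iff]
  constructor
  · rintro ⟨s, hs⟩
    obtain ⟨k, rfl | rfl⟩ := Int.even_or_odd' s
    · rw [show 2 * (2 * k) = 4 * k by ring, edge_four] at hs
      exact ⟨k, Or.inl hs⟩
    · rw [show 2 * (2 * k + 1) = 4 * k + 2 by ring, edge_four_add_two] at hs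
      exact ⟨k + 1, Or.inr (by push_cast; linarith)⟩
  · rintro ⟨k, hk | hk⟩
    · exact ⟨2 * k, by rw [show 2 * (2 * k) = 4 * k by ring, edge_four, hk]⟩
    · exact ⟨2 * k - 1, by
        rw [show 2 * (2 * k - 1) = 4 * (k - 1) + 2 by ring, edge_four_add_two, hk]
        push_cast; ring⟩

lemma image_add_pi_band {T g : ℝ} {η : ℝ → ℝ} (hper : ∀ x, η (x + Real.pi) = η x) (s : ℤ) :
    (fun z : ℂ => (Real.pi : ℂ) + z) '' band T g η s = band T g η s := by
  have hiff : ∀ z : ℂ, (Real.pi : ℂ) + z ∈ band T g η s ↔ z ∈ band T g η s := fun z => by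
    simp only [band, Set.mem_ofPred_eq, Complex.add_re, Complex.add_im, Complex.ofReal_re,
      Complex.ofReal_im, zero_add, add_comm Real.pi z.re, hper]
  refine Set.Subset.antisymm (Set.image_subset_iff.2 fun z hz => (hiff z).2 hz) fun z hz =>
    ⟨-Real.pi + z, (hiff _).1 ?_, ?_⟩
  · rwa [add_neg_cancel_left]
  · exact add_neg_cancel_left _ _

section
variable {T g : ℝ} {η : ℝ → ℝ}

/-- Measured from the centre line, the pair of bands is visibly symmetric under reflection. For even
s it is an open region where |Y| < 1, for odd s a closed one where |Y| ≥ 1. -/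
lemma mem_band_even (hg : 0 < g) (h0 : ∀ x, 0 < η x) (h1 : ∀ x, η x < T / 2 - g) (s : ℤ)
    (z : ℂ) : z ∈ band T g η (2 * s) ∪ band T g η (2 * s + 1) ↔
    |z.im - (s * T + g) / 2| < g / 2 + η z.re ∧ Even s ∨
    |z.im - (s * T + g) / 2| ≤ T / 2 - g / 2 - η z.re ∧ ¬ Even s := by
  obtain ⟨k, rfl | rfl⟩ := Int.even_or_odd' s
  · have : Even (2 * k) := even_two_mul k
    rw [show 2 * (2 * k) = 4 * k by ring, mem_band_zero_one hg h0 h1]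
    simp only [this, not_true_eq_false, and_true, and_false, or_false, abs_lt]
    push_cast
    constructor <;> rintro ⟨h0, h1⟩ <;> constructor <;> linarith
  · have : ¬ Even (2 * k + 1) := by simp
    rw [show 2 * (2 * k + 1) = 4 * (k + 1) - 2 by ring,
      show 4 * (k + 1) - 2 + 1 = 4 * (k + 1) - 1 by ring, mem_band_two_three hg h0 h1]
    simp only [this, not_false_eq_true, and_true, and_false, false_or, abs_le]
    push_cast
    constructor <;> rintro ⟨h0, h1⟩ <;> constructor <;> linarith

lemma mem_band_odd (hg : 0 < g) (h0 : ∀ x, 0 < η x) (h1 : ∀ x, η x < T / 2 - g) (s : ℤ)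
    (z : ℂ) : z ∈ band T g η (2 * s) ∪ band T g η (2 * s - 1) ↔
    |z.im - (s * T - g) / 2| < g / 2 + η z.re ∧ Even s ∨
    |z.im - (s * T - g) / 2| ≤ T / 2 - g / 2 - η z.re ∧ ¬ Even s := by
  rw [Set.union_comm]
  obtain ⟨k, rfl | rfl⟩ := Int.even_or_odd' s
  · have : Even (2 * k) := even_two_mul k
    rw [show 2 * (2 * k) = 4 * k by ring, mem_band_three_zero hg h0 h1]
    simp only [this, not_true_eq_false, and_true, and_false, or_false, abs_lt]
    push_cast
    constructor <;> rintro ⟨h0, h1⟩ <;> constructor <;> linarith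
  · have : ¬ Even (2 * k + 1) := by simp
    rw [show 2 * (2 * k + 1) = 4 * k + 2 by ring,
      show 4 * k + 2 - 1 = 4 * k + 1 by ring, mem_band_one_two hg h0 h1]
    simp only [this, not_false_eq_true, and_true, and_false, false_or, abs_le]
    push_cast
    constructor <;> rintro ⟨h0, h1⟩ <;> constructor <;> linarith

lemma mem_band_even_of_im (hg : 0 < g) (h0 : ∀ x, 0 < η x) (h1 : ∀ x, η x < T / 2 - g)
    {s : ℤ} {z : ℂ} (hz : z.im = (s * T + g) / 2) :
    z ∈ band T g η (2 * s) ∪ band T g η (2 * s + 1) := by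
  rw [mem_band_even hg h0 h1, hz, sub_self, abs_zero]
  have := h0 z.re
  have := h1 z.re
  by_cases hs : Even s
  · exact Or.inl ⟨by linarith, hs⟩
  · exact Or.inr ⟨by linarith, hs⟩

lemma mem_band_odd_of_im (hg : 0 < g) (h0 : ∀ x, 0 < η x) (h1 : ∀ x, η x < T / 2 - g)
    {s : ℤ} {z : ℂ} (hz : z.im = (s * T - g) / 2) :
    z ∈ band T g η (2 * s) ∪ band T g η (2 * s - 1) := by
  rw [mem_band_odd hg h0 h1, hz, sub_self, abs_zero]
  have := h0 z.re
  have := h1 z.re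
  by_cases hs : Even s
  · exact Or.inl ⟨by linarith, hs⟩
  · exact Or.inr ⟨by linarith, hs⟩

end

/-- Each assertion on |X| or |Y| is checked on vertical lines through the sign of `gap`. Its
evenness in x lets the sign for Y be read at the same real part with the height reversed. -/
lemma Fits.isOmegaPartition {a T g c : ℝ} (h : Fits a T g c) {η : ℝ → ℝ} (hη : Continuous η)
    (h0 : ∀ x, 0 < η x) (h1 : ∀ x, η x < T / 2 - g) (heven : ∀ x, η (-x) = η x)
    (hper : ∀ x, η (x + Real.pi) = η x) (hpat : ∀ x, SignPattern T g (η x) (gap T g x)) :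
    IsOmegaPartition (Complex.I * g) (Complex.I * T / Real.pi)
      (Xfun c (Complex.I * g) (Complex.I * T / Real.pi))
      (Yfun c (Complex.I * g) (Complex.I * T / Real.pi)) (band T g η) := by
  have hg := h.g_pos
  have hz : ∀ z : ℂ, z = z.re + Complex.I * z.im := fun z => by
    rw [mul_comm]; exact (Complex.re_add_im z).symm
  have hz' : ∀ z : ℂ, -z = (-z.re : ℝ) + Complex.I * (-z.im : ℝ) := fun z => hz (-z)
  have hcenter : ∀ s : ℤ, (s : ℂ) * Real.pi * (Complex.I * T / Real.pi) = Complex.I * (s * T : ℝ) :=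
    fun s => by
      have := pi_ne_zero'
      push_cast
      field_simp
  have hXlt : ∀ z, modulus (Xfun c (Complex.I * g) (Complex.I * T / Real.pi) z) < 1 ↔
      gap T g z.re z.im < 0 := fun z => by
    rw [Xfun_eq_toP, modulus_toP_lt_one, hz z, h.norm_lt_iff, ← hz]
  have hYlt : ∀ z, modulus (Yfun c (Complex.I * g) (Complex.I * T / Real.pi) z) < 1 ↔
      gap T g z.re (-z.im) < 0 := fun z => by
    rw [Yfun_eq_toP, modulus_toP_lt_one, hz' z, h.norm_lt_iff, gap_neg_left]
  have hXeq : ∀ z, modulus (Xfun c (Complex.I * g) (Complex.I * T / Real.pi) z) = 1 ↔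
      gap T g z.re z.im = 0 := fun z => by
    rw [Xfun_eq_toP, modulus_toP_eq_one (denX_ne_zero_of_numX_eq_zero h), hz z, h.norm_eq_iff, ← hz]
  have hYeq : ∀ z, modulus (Yfun c (Complex.I * g) (Complex.I * T / Real.pi) z) = 1 ↔
      gap T g z.re (-z.im) = 0 := fun z => by
    rw [Yfun_eq_toP, modulus_toP_eq_one (denX_ne_zero_of_numX_eq_zero h), hz' z, h.norm_eq_iff,
      gap_neg_left]
  constructor
  · exact disjoint_band hg h0 h1
  · exact iUnion_band hg h0 h1
  · exact simplyConnectedSpace_of_band hη hg h0 h1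
  · exact fun r s hrs => disjoint_closure_band hη hg h0 h1 hrs
  · ext z
    rw [(hpat z.re).mem_closures_iff_even hη hg h0 h1, Set.mem_ofPred_eq, hXeq]
  · ext z
    rw [(hpat z.re).mem_closures_iff_odd hη hg h0 h1, Set.mem_ofPred_eq, hYeq]
  · ext z
    rw [Set.mem_ofPred_eq, hYlt, (hpat z.re).neg_lt_zero_iff]
    simp only [Set.mem_iUnion, mem_band_zero_one hg h0 h1]
  · ext z
    rw [Set.mem_ofPred_eq, ← not_lt, hYlt, not_lt, (hpat z.re).zero_le_neg_iff]
    simp only [Set.mem_iUnion, mem_band_two_three hg h0 h1]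
  · ext z
    rw [Set.mem_ofPred_eq, hXlt, (hpat z.re).lt_zero_iff]
    simp only [Set.mem_iUnion, mem_band_three_zero hg h0 h1]
  · ext z
    rw [Set.mem_ofPred_eq, ← not_lt, hXlt, not_lt, (hpat z.re).zero_le_iff]
    simp only [Set.mem_iUnion, mem_band_one_two hg h0 h1]
  · exact image_add_pi_band hper
  · refine fun s => image_sub_eq_self fun z hmem => ?_
    rw [mem_band_even hg h0 h1] at hmem ⊢
    have hre : (s * Real.pi * (Complex.I * T / Real.pi) + Complex.I * g - z : ℂ).re = -z.re := by
      rw [hcenter]; simp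
    have him : (s * Real.pi * (Complex.I * T / Real.pi) + Complex.I * g - z : ℂ).im =
        s * T + g - z.im := by
      rw [hcenter]; simp
    rwa [hre, him, heven, show s * T + g - z.im - (s * T + g) / 2 = -(z.im - (s * T + g) / 2) by
      ring, abs_neg]
  · rintro s _ ⟨r, rfl⟩
    refine mem_band_even_of_im hg h0 h1 ?_
    beta_reduce
    rw [hcenter, show ((Complex.I * (s * T : ℝ) + Complex.I * g) / 2 + r : ℂ) =
      r + Complex.I * ((s * T + g) / 2 : ℝ) by push_cast; ring]
    simp
  · refine fun s => image_sub_eq_self fun z hmem => ?_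
    rw [mem_band_odd hg h0 h1] at hmem ⊢
    have hre : (s * Real.pi * (Complex.I * T / Real.pi) - Complex.I * g - z : ℂ).re = -z.re := by
      rw [hcenter]; simp
    have him : (s * Real.pi * (Complex.I * T / Real.pi) - Complex.I * g - z : ℂ).im =
        s * T - g - z.im := by
      rw [hcenter]; simp
    rwa [hre, him, heven, show s * T - g - z.im - (s * T - g) / 2 = -(z.im - (s * T - g) / 2) by
      ring, abs_neg]
  · rintro s _ ⟨r, rfl⟩
    refine mem_band_odd_of_im hg h0 h1 ?_
    beta_reduce
    rw [hcenter, show ((Complex.I * (s * T : ℝ) - Complex.I * g) / 2 + r : ℂ) =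
      r + Complex.I * ((s * T - g) / 2 : ℝ) by push_cast; ring]
    simp

/-! ### Assembly of the two statements -/

lemma pi_mul_tau (T : ℝ) : (Real.pi : ℂ) * (Complex.I * T / Real.pi) = Complex.I * T := by
  have := pi_ne_zero'
  field_simp

section
variable {a T g c : ℝ}

lemma toP_add_pi (z : ℂ) : toP (numX T g c (z + Real.pi)) (denX T g (z + Real.pi)) =
    toP (numX T g c z) (denX T g z) := by
  rw [numX_add_pi, denX_add_pi]

lemma toP_add_I_mul (hT : 0 < T) (z : ℂ) :
    toP (numX T g c (z + Complex.I * T)) (denX T g (z + Complex.I * T)) =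
      toP (numX T g c z) (denX T g z) := by
  rw [numX_add_I_mul hT, denX_add_I_mul hT, toP_mul (Complex.exp_ne_zero _)]

lemma toP_reflect (z : ℂ) :
    toP (numX T g c (-(Complex.I * g) - z)) (denX T g (-(Complex.I * g) - z)) =
      toP (numX T g c z) (denX T g z) := by
  rw [numX_reflect, denX_reflect]

lemma Fits.signPattern (h : Fits a T g c) {x e : ℝ} (h0 : 0 < e) (h1 : e < T / 2 - g)
    (hzero : gap T g x e = 0) (hneg : ∀ y, -g - e < y → y < e → gap T g x y < 0)
    (hpos : ∀ y, e < y → y < T - g - e → 0 < gap T g x y) : SignPattern T g e (gap T g x) where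
  g_pos := h.g_pos
  e_pos := h0
  e_lt := h1
  add_period := gap_add h.T_pos x
  reflect := gap_reflect x
  zero := hzero
  neg := hneg
  pos := hpos

lemma Fits.parametrisesKernel {t : ℝ} (h : Fits a T g c) (ht : t ≠ 0) (ht' : a + 4 < 1 / t)
    (hE : thConst T (Complex.I * g) = (c * (1 / t) : ℝ)) :
    ParametrisesKernel a t (Complex.I * g) (Complex.I * T / Real.pi)
      (Xfun c (Complex.I * g) (Complex.I * T / Real.pi))
      (Yfun c (Complex.I * g) (Complex.I * T / Real.pi)) := by
  have hT := h.T_pos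
  have hg := h.g_pos
  have hg' := h.g_lt
  have hsmall : ‖numX T g c (-(Complex.I * g) / 2)‖ < ‖denX T g (-(Complex.I * g) / 2)‖ := by
    have him : (-(Complex.I * g) / 2 : ℂ).im = -g / 2 := by
      rw [show (-(Complex.I * g) / 2 : ℂ) = Complex.I * (-g / 2 : ℝ) by push_cast; ring]
      simp
    exact h.norm_lt_of_strip hE ht' (by linarith) (by linarith)
  constructor
  · rw [Xfun_funext]
    exact h.reduced_X.isMeromorphic
  · rw [Yfun_funext]
    exact h.reduced_Y.isMeromorphic
  · simp only [Xfun_eq_toP, Yfun_eq_toP]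
    exact h.kernelCurve_eq ht hE
  · simp
  · rw [show Complex.I * T / Real.pi = ((T / Real.pi : ℝ) : ℂ) * Complex.I by push_cast; ring]
    simp
  · simpa using hg
  · rw [pi_mul_tau]
    simp
    linarith
  · intro z
    rw [Xfun_eq_toP, Yfun_eq_toP]
    exact h.kernelExt_eq_zero ht hE z
  · intro z
    rw [Xfun_eq_toP, Xfun_eq_toP, toP_add_pi]
  · intro z
    rw [Xfun_eq_toP, Xfun_eq_toP, pi_mul_tau, toP_add_I_mul hT]
  · intro z
    rw [Xfun_eq_toP, Xfun_eq_toP, toP_reflect]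
  · intro z
    rw [Yfun_eq_toP, Yfun_eq_toP, ← toP_add_pi, neg_add, neg_add_cancel_right]
  · intro z
    rw [Yfun_eq_toP, Yfun_eq_toP, pi_mul_tau, ← toP_add_I_mul hT, neg_add, neg_add_cancel_right]
  · intro z
    rw [Yfun_eq_toP, Yfun_eq_toP, ← toP_reflect, show -(Complex.I * g) - -(Complex.I * g - z) = -z
      by ring]
  · rwa [Xfun_eq_toP, modulus_toP_lt_one]
  · rwa [Yfun_eq_toP, modulus_toP_lt_one, ← neg_div]
  · rw [Xfun_funext]
    exact h.reduced_X.rootCount_eq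
  · rw [Xfun_funext]
    exact h.reduced_X.poleCount_eq
  · rw [Yfun_funext]
    exact h.reduced_Y.rootCount_eq
  · rw [Yfun_funext]
    exact h.reduced_Y.poleCount_eq

end

end

end AModel

theorem mainTheorem5 (a t : ℝ) (ha : 0 < a) (ht : 0 < t) (ht' : t < 1 / (a + 4)) :
    ∃ c γ τ : ℂ,
      γ.re = 0 ∧ τ.re = 0 ∧ 0 < (2 * γ).im ∧ (2 * γ).im < ((Real.pi : ℂ) * τ).im ∧
      (a : ℂ) * c ^ 3 = -(AModel.theta (4 * γ) τ / AModel.theta (2 * γ) τ) ∧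
      c ^ 2 = AModel.theta (3 * γ) τ / AModel.theta γ τ ∧
      c / (t : ℂ) =
        4 * (AModel.thetaDeriv γ τ * AModel.theta (2 * γ) τ /
          (AModel.thetaDeriv 0 τ * AModel.theta γ τ)) -
        2 * (AModel.thetaDeriv (2 * γ) τ / AModel.thetaDeriv 0 τ) ∧
      (∀ z, AModel.Yfun c γ τ z = AModel.Xfun c γ τ (-z)) ∧
      AModel.ParametrisesKernel a t γ τ (AModel.Xfun c γ τ) (AModel.Yfun c γ τ) ∧
      ∃ Ω : ℤ → Set ℂ,
        AModel.IsOmegaPartition γ τ (AModel.Xfun c γ τ) (AModel.Yfun c γ τ) Ω := by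
  have hE : a + 4 < 1 / t := by
    rw [lt_div_iff₀ (by linarith)] at ht'
    rw [lt_div_iff₀ ht]
    linarith
  obtain ⟨T, g, c, h, hconst, hlow⟩ := AModel.exists_fits_thConst ha hE
  obtain ⟨η, hη, h0, h1, heven, hper, hzero, hneg, hpos⟩ := h.exists_graph hconst hlow hE
  have hpar := h.parametrisesKernel ht.ne' hE hconst
  refine ⟨c, Complex.I * g, Complex.I * T / Real.pi, hpar.gamma_re, hpar.tau_re, hpar.gamma_pos,
    hpar.gamma_lt, h.a_mul, h.c_sq, ?_, AModel.Yfun_eq_Xfun _ _ _, hpar, AModel.band T g η,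
    h.isOmegaPartition hη h0 h1 heven hper fun x =>
      h.signPattern (h0 x) (h1 x) (hzero x) (hneg x) (hpos x)⟩
  have hc : (c : ℂ) / t = (c * (1 / t) : ℝ) := by push_cast; ring
  rw [hc, ← hconst]
  rfl
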